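/- **The model.** Write $|\psi\rangle=\sum_{x\in\{0,1\}^l}\alpha_x|x\rangle$ for a pure state of $l$ qubits. A *hidden-variable theory* $\mathcal T$ assigns to every such state (given as the density matrix $|\psi\rangle\langle\psi|$) and every unitary $U$ on $l$ qubits a stochastic matrix $S(|\psi\rangle,U)$, where $S_{xy}$ is the probability of moving from $|x\rangle$ to $|y\rangle$, such that $\sum_x S_{xy}|\alpha_x|^2=|\langle y|U|\psi\rangle|^2$ for all $y$. It is *indifferent* if, whenever $U$ is block-diagonal with respect to a partition of the set of basis states, so is $S(|\psi\rangle,U)$ for every $|\psi\rangle$. Given unitaries $\mathcal U=(U_1,\dots,U_T)$ on $l\ge 1$ qubits, the *history distribution* $\Omega(\mathcal U,\mathcal T)$ is the law of the Markov chain $(v_0,\dots,v_T)$ with $v_0=|0\rangle^{\otimes l}$ whose transition matrix at step $t$ is $S(U_{t-1}\cdots U_1|0\rangle^{\otimes l},U_t)$. Let $f:\{0,1\}^n\to\{0,1\}$ be a database of $N=2^n$ items. Circuits consist of gates from the finite universal set {Hadamard, $\pi/8$ gate, NOT, CNOT, Toffoli} and of query gates $|y\rangle|b\rangle\mapsto|y\rangle|b\oplus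 f(y)\rangle$. A *search algorithm* $A$ is a deterministic classical (multi-stack) Turing machine which on input $1^n$ writes down a number $l\geq 1$ and circuits $U_1,\dots,U_T$ on $l$ qubits gate by gate, makes one call to an oracle that returns a sample of $\Omega(\mathcal U,\mathcal T)$, and computes a string from this history; it has no other access to $f$ or $\mathcal T$. Its number of *queries* is the total number of query gates in $U_1,\dots,U_T$; its number of *computation steps* is the worst-case number of Turing machine steps before and after the oracle call. **Theorem.** There is a single search algorithm $A$ that uses $O(N^{1/3})$ queries and $O\big(N^{1/3}(\log N)^{c}\big)$ computation steps for some constant $c$, and an $n_0$, such that for all $n\ge n_0$, for every indifferent hidden-variable theory $\mathcal T$ (robust under small perturbations or not), and for every $f:\{0,1\}^n\to\{0,1\}$ with a unique $x$ satisfying $f(x)=1$, the algorithm outputs this $x$ with probability at least $2/3$. -/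

import Mathlib

open Matrix Turing Computability

noncomputable section

namespace Histories

/-- Labels of the computational basis states of `l` qubits, i.e. `{0,1}^l`. -/
abbrev Bits (l : ℕ) : Type := Fin l → Bool

/-- The density matrix `|ψ⟩⟨ψ|` of a pure state of `l` qubits. -/
def pureState {l : ℕ} (ψ : Bits l → ℂ) : Matrix (Bits l) (Bits l) ℂ :=
  vecMulVec ψ (star ψ)

/-- A hidden-variable theory (for pure states of qubits): to the density matrix `ρ` of a state and
a unitary `U` it assigns a stochastic matrix `S ρ U`, whose entry `S ρ U y x` (column `x`, row `y`)
is the probability that the hidden variable moves from `|x⟩` to `|y⟩` when `U` is applied. It maps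
the measurement distribution of `ψ` to the measurement distribution of `U ψ`. Values of `S` at
other arguments carry no meaning and are never used. -/
structure HiddenVariableTheory where
  S : {l : ℕ} → Matrix (Bits l) (Bits l) ℂ → Matrix (Bits l) (Bits l) ℂ → Matrix (Bits l) (Bits l) ℝ
  stochastic : ∀ {l : ℕ} (ψ : Bits l → ℂ) (U : Matrix (Bits l) (Bits l) ℂ),
    ∑ x, ‖ψ x‖ ^ 2 = 1 → U ∈ unitaryGroup (Bits l) ℂ →
      S (pureState ψ) U ∈ colStochastic ℝ (Bits l)
  marginal : ∀ {l : ℕ} (ψ : Bits l → ℂ) (U : Matrix (Bits l) (Bits l) ℂ),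
    ∑ x, ‖ψ x‖ ^ 2 = 1 → U ∈ unitaryGroup (Bits l) ℂ →
      ∀ y, ∑ x, S (pureState ψ) U y x * ‖ψ x‖ ^ 2 = ‖(U *ᵥ ψ) y‖ ^ 2

/-- Indifference: whenever `U` is block-diagonal with respect to some partition of the set of basis
states (the classes of the equivalence relation `r`), so is `S`. -/
def HiddenVariableTheory.Indifferent (𝒯 : HiddenVariableTheory) : Prop :=
  ∀ {l : ℕ} (ψ : Bits l → ℂ) (U : Matrix (Bits l) (Bits l) ℂ),
    ∑ x, ‖ψ x‖ ^ 2 = 1 → U ∈ unitaryGroup (Bits l) ℂ →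
      ∀ r : Setoid (Bits l), (∀ x y, ¬ r x y → U y x = 0) →
        ∀ x y, ¬ r x y → 𝒯.S (pureState ψ) U y x = 0

/-- Gates on `l` qubits: the finite universal gate set consisting of the Hadamard gate, the
`π/8` gate, NOT, CNOT and Toffoli, and a query gate for a function on `n`-bit strings, which may be
applied to any `n` distinct address qubits and a further target qubit. -/
inductive Gate (n l : ℕ) : Type
  | hadamard (i : Fin l)
  | piEighth (i : Fin l)
  | not (i : Fin l)
  | cnot (c t : Fin l) (hct : c ≠ t)
  | toffoli (a b t : Fin l) (hab : a ≠ b) (hat : a ≠ t) (hbt : b ≠ t)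
  | query (addr : Fin n ↪ Fin l) (t : Fin l) (ht : ∀ i, addr i ≠ t)

/-- The one-qubit matrix `g` applied to qubit `i`, tensored with the identity on the others. -/
def onQubit {l : ℕ} (g : Matrix Bool Bool ℂ) (i : Fin l) : Matrix (Bits l) (Bits l) ℂ :=
  of fun y x => if ∀ j, j ≠ i → y j = x j then g (y i) (x i) else 0

/-- The matrix sending `|x⟩` to the basis state obtained by XORing the bit `p x` into bit `t`
(used only when `p` does not depend on bit `t`). -/
def xorInto {l : ℕ} (t : Fin l) (p : Bits l → Bool) : Matrix (Bits l) (Bits l) ℂ :=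
  of fun y x => if y = Function.update x t (xor (x t) (p x)) then 1 else 0

/-- The one-qubit Hadamard matrix. -/
def hadamardMatrix : Matrix Bool Bool ℂ :=
  of fun y x => (if y && x then -1 else 1) / (Real.sqrt 2 : ℂ)

/-- The one-qubit `π/8` matrix `diag(1, e^{iπ/4})`. -/
def piEighthMatrix : Matrix Bool Bool ℂ :=
  diagonal fun b => if b then Complex.exp (Real.pi / 4 * Complex.I) else 1

/-- The unitary matrix of a gate when queries are made to `f`. -/
def Gate.matrix {n l : ℕ} (f : Bits n → Bool) : Gate n l → Matrix (Bits l) (Bits l) ℂ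
  | .hadamard i => onQubit hadamardMatrix i
  | .piEighth i => onQubit piEighthMatrix i
  | .not i => xorInto i fun _ => true
  | .cnot c t _ => xorInto t fun x => x c
  | .toffoli a b t _ _ _ => xorInto t fun x => x a && x b
  | .query addr t _ => xorInto t fun x => f fun i => x (addr i)

def Gate.isQuery {n l : ℕ} : Gate n l → Bool
  | .query _ _ _ => true
  | _ => false

/-- A circuit is a list of gates; the head of the list is applied first. -/
def circuitMatrix {n l : ℕ} (f : Bits n → Bool) (c : List (Gate n l)) :
    Matrix (Bits l) (Bits l) ℂ :=
  c.foldl (fun M g => g.matrix f * M) 1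

/-- What is submitted to the history oracle: a positive number of qubits and a sequence
`U₁, …, U_T` of circuits on them. -/
structure Program (n : ℕ) where
  qubits : ℕ
  qubits_pos : 0 < qubits
  circuits : List (List (Gate n qubits))

namespace Program

variable {n : ℕ} (P : Program n)

/-- The number `T` of circuits. -/
def T : ℕ := P.circuits.length

/-- The `t`-th unitary (counted from `0`). -/
def unitary (f : Bits n → Bool) (t : Fin P.T) : Matrix (Bits P.qubits) (Bits P.qubits) ℂ :=
  circuitMatrix f (P.circuits.get t)

/-- The quantum state `U_t ⋯ U₁ |0…0⟩` after the first `t` circuits. -/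
def state (f : Bits n → Bool) (t : ℕ) : Bits P.qubits → ℂ :=
  (P.circuits.take t).foldl (fun ψ c => circuitMatrix f c *ᵥ ψ) (Pi.single (fun _ => false) 1)

/-- The total number `q₁ + ⋯ + q_T` of queries made by the circuits. -/
def queries : ℕ := (P.circuits.map fun c => c.countP Gate.isQuery).sum

/-- Histories `(v₀, …, v_T)`. -/
abbrev History : Type := Fin (P.T + 1) → Bits P.qubits

/-- The probability that the history oracle for the theory `𝒯` returns `H`: the hidden variable
starts at `|0…0⟩` and makes a Markov step with the matrix `S(U_{t-1} ⋯ U₁|0…0⟩, U_t)` for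
each `t`. -/
def historyProb (𝒯 : HiddenVariableTheory) (f : Bits n → Bool) (H : P.History) : ℝ :=
  (if H 0 = fun _ => false then 1 else 0) *
    ∏ t : Fin P.T, 𝒯.S (pureState (P.state f t)) (P.unitary f t) (H t.succ) (H t.castSucc)

end Program

/-- Symbols in which programs are written down. -/
inductive Sym : Type
  | hadamard | piEighth | not | cnot | toffoli | query
  | tick | endNumber | endCircuit

/-- A natural number is written in unary, followed by a terminator. -/
def encodeNumber (k : ℕ) : List Sym := List.replicate k .tick ++ [.endNumber]

/-- A gate is written as its name followed by the indices of its qubits. -/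
def encodeGate {n l : ℕ} : Gate n l → List Sym
  | .hadamard i => .hadamard :: encodeNumber i
  | .piEighth i => .piEighth :: encodeNumber i
  | .not i => .not :: encodeNumber i
  | .cnot c t _ => .cnot :: (encodeNumber c ++ encodeNumber t)
  | .toffoli a b t _ _ _ => .toffoli :: (encodeNumber a ++ encodeNumber b ++ encodeNumber t)
  | .query addr t _ =>
      .query :: ((List.ofFn addr).flatMap (fun i => encodeNumber i) ++ encodeNumber t)

/-- The explicit description of a program, gate by gate. -/
def encodeProgram {n : ℕ} (P : Program n) : List Sym :=
  encodeNumber P.qubits ++ P.circuits.flatMap fun c => c.flatMap encodeGate ++ [.endCircuit]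

/-- What is available after the oracle call, over the alphabet `{0, 1, #}` (with `none` as the
separator `#`): the input `1ⁿ` and the history returned, each entry written as a bit string. -/
def encodeResponse (program : (n : ℕ) → Program n) (p : Σ n, (program n).History) :
    List (Option Bool) :=
  List.replicate p.1 (some true) ++ none ::
    (List.ofFn p.2).flatMap fun v => (List.ofFn v).map some ++ [none]

theorem length_encodeResponse (program : (n : ℕ) → Program n) (p : Σ n, (program n).History) :
    (encodeResponse program p).length =
      p.1 + 1 + ((program p.1).T + 1) * ((program p.1).qubits + 1) := by
  simp [encodeResponse, List.length_flatMap, List.map_ofFn, Function.comp_def]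
  ring

/-- A search algorithm in the history-sampling model: a deterministic classical machine that is
given `1ⁿ`, writes down a program (whose circuits may query the database), makes a single call to
the history oracle, and computes its answer from the history returned. The machines are multi-stack
Turing machines with finite control. What happens before and after the oracle call is
described by two of them, the second of which is given the input again together with the response;
neither has any other access to the database or to the hidden-variable theory. -/
structure SearchAlgorithm where
  program : (n : ℕ) → Program n
  writer : TM2ComputableInTime unaryEncodeNat id fun n => encodeProgram (program n)
  answer : (Σ n, (program n).History) → List Bool
  reader : TM2ComputableInTime (encodeResponse program) id answer

namespace SearchAlgorithm

variable (A : SearchAlgorithm)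

/-- The number of database queries on databases of `2ⁿ` items. -/
def queries (n : ℕ) : ℕ := (A.program n).queries

/-- The number of (classical) computation steps on databases of `2ⁿ` items: those for writing down
the program plus those for processing the history, whose description has the length given by
`length_encodeResponse`. -/
def steps (n : ℕ) : ℕ :=
  A.writer.time (unaryEncodeNat n).length +
    A.reader.time (n + 1 + ((A.program n).T + 1) * ((A.program n).qubits + 1))

/-- The probability that the answer is the string `x` when the database is `f` and histories are
sampled according to the theory `𝒯`. -/
def probAnswer (𝒯 : HiddenVariableTheory) {n : ℕ} (f : Bits n → Bool) (x : Bits n) : ℝ :=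
  ∑ H : (A.program n).History,
    if A.answer ⟨n, H⟩ = List.ofFn x then (A.program n).historyProb 𝒯 f H else 0

end SearchAlgorithm

end Histories

end

/-! Write N = 2^n and K = 2^⌊n/3⌋, so that K³ ≤ N ≤ 4K³. After K Grover steps the marked item x has
amplitude about 2K/√N, while every other item still has about 1/√N. One more query writes f into a
flag qubit. Hadamard gates on the 2⌊n/3⌋ high item bits, applied where the flag is 0, then fold each
block of K² items with common low bits into almost a single basis state, the one with high bits 0.
The resulting `cycleState` is juggled by circuits whose product is the identity and which make no
queries. The history thus contains many trials for the price of one preparation.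

A trial (`cycle`) works as follows. Hadamards on the low bits gather nearly all the measured weight
in the all-zero item, wherever the hidden variable was before (`mass_origin`). The same Hadamards
again spread it over the low parts, and the low part of x is reached with probability about K²/N
(`transition_low`). Hadamards on the high bits move the hidden variable to an unmarked sibling y of
x (`transition_high`). At y the flag values 0 and 1 have amplitudes about 1/√N and, up to sign,
(2K/√N)/K = 2/√N. Since these are comparable, two Hadamards on the flag carry it from 0 to 1 with
constant probability (`transition_flag`). On flag 1 the next high Hadamards leave only x
(`transition_back`), and a CNOT into the mark qubit makes the success visible in the history
(`transition_mark`). Each trial succeeds with probability of order K²/N, about 1/K, so a multiple of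
K trials suffices; this is the balance that singles out K ≈ N^(1/3).

Only three properties of the theory enter: the process is Markov, it has the right marginals, and
indifference forbids transitions that change a qubit outside a circuit's support. The probability of
a particular transition is estimated by comparing the weights of its two endpoints
(`IsTransition.mul_le`), so no continuity of the theory is needed.

The trials are not independent, and conditioning on earlier failures would spoil the marginals.
Instead `survivors` follows the unnormalized mass of histories that have not succeeded yet. It stays
pointwise below the measurement distribution, hence at most 3/100 of it lies off the origin when a
trial starts. With κ = 1/(16K) the surviving mass m becomes at most (1-κ)m + 3κ/100 in each trial
(`survivors_cycle`), and 32K trials leave at most e⁻² + 3/100 ≤ 7/25. Wrong answers do not occur,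
because a marked basis state with other item bits always has amplitude 0 (`vanishesAlong_program`).

For the classical cost, the two machines are programs in a small structured stack language with a
verified compiler to multi-stack machines. The program submitted consists of order K blocks of O(n)
gates with unary qubit indices, so writing it takes O(K n²) steps, and reading the history takes
time linear in its length. -/

noncomputable section

namespace Histories

/-! ### A structured language for multi-stack machines -/

/-- Structured programs over stacks with alphabets `Γ k`. -/
inductive StackCmd {K : Type} (Γ : K → Type) : Type
  | skip : StackCmd Γ
  | push (k : K) (a : Γ k) : StackCmd Γ
  | seq (c d : StackCmd Γ) : StackCmd Γ
  /-- pop a symbol and branch on it -/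
  | case (k : K) (c : Option (Γ k) → StackCmd Γ) : StackCmd Γ
  /-- while the stack is nonempty, pop a symbol and run the body for it -/
  | loop (k : K) (c : Γ k → StackCmd Γ) : StackCmd Γ

namespace StackCmd

variable {K : Type} {Γ : K → Type}

/-- The labels needed to run a command. -/
def Label : StackCmd Γ → Type
  | skip => Empty
  | push _ _ => Empty
  | seq c d => c.Label ⊕ d.Label
  | case _ c => Σ o, Option (c o).Label
  | loop _ c => Option (Σ a, Option (c a).Label)

theorem finite_label [∀ k, Finite (Γ k)] (c : StackCmd Γ) : Finite c.Label := by
  induction c with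
  | skip => unfold Label; infer_instance
  | push => unfold Label; infer_instance
  | seq c d hc hd => unfold Label; infer_instance
  | case k c hc =>
    unfold Label
    have : Finite (Option (Γ k)) := inferInstance
    infer_instance
  | loop k c hc => unfold Label; infer_instance

/-! ### Compiling structured commands to machine code, with an operational semantics. -/

section Machine

variable [DecidableEq K] {Λ : Type}

/-- The internal memory: the symbol last popped from each stack. -/
abbrev Memory (Γ : K → Type) : Type := ∀ k, Option (Γ k)

/-- The code to be run on entering a command whose labels are embedded by `ι`, and which is followed
by `q`. -/
def entry : (c : StackCmd Γ) → (c.Label → Λ) → TM2.Stmt Γ Λ (Memory Γ) →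
    TM2.Stmt Γ Λ (Memory Γ)
  | skip, _, q => q
  | push k a, _, q => .push k (fun _ => a) q
  | seq c d, ι, q => c.entry (fun l => ι (.inl l)) (d.entry (fun l => ι (.inr l)) q)
  | case k _, ι, _ =>
    .pop k (fun v o => Function.update v k o) (.goto fun v => ι ⟨v k, none⟩)
  | loop _ _, ι, _ => .goto fun _ => ι none

/-- The code at the labels of a command. -/
def code : (c : StackCmd Γ) → (c.Label → Λ) → TM2.Stmt Γ Λ (Memory Γ) → c.Label →
    TM2.Stmt Γ Λ (Memory Γ)
  | skip, _, _, l => l.elim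
  | push _ _, _, _, l => l.elim
  | seq c d, ι, q, .inl l =>
    c.code (fun l => ι (.inl l)) (d.entry (fun l => ι (.inr l)) q) l
  | seq _ d, ι, q, .inr l => d.code (fun l => ι (.inr l)) q l
  | case _ c, ι, q, ⟨o, none⟩ => (c o).entry (fun l => ι ⟨o, some l⟩) q
  | case _ c, ι, q, ⟨o, some l⟩ => (c o).code (fun l => ι ⟨o, some l⟩) q l
  | loop k _, ι, q, none =>
    .pop k (fun v o => Function.update v k o)
      (.branch (fun v => (v k).isSome)
        (.goto fun v => match v k with
          | some a => ι (some ⟨a, none⟩)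
          -- This default is never reached: the branch has already checked that a symbol was popped.
          | none => ι none) q)
  | loop _ c, ι, _, some ⟨a, none⟩ =>
    (c a).entry (fun l => ι (some ⟨a, some l⟩)) (.goto fun _ => ι none)
  | loop _ c, ι, _, some ⟨a, some l⟩ =>
    (c a).code (fun l => ι (some ⟨a, some l⟩)) (.goto fun _ => ι none) l

/-- `Runs c s t n`: started with the stacks `s`, the command `c` ends with the stacks `t` after `n`
jumps. -/
inductive Runs : StackCmd Γ → (∀ k, List (Γ k)) → (∀ k, List (Γ k)) → ℕ → Prop
  | skip (s) : Runs skip s s 0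
  | push (k a s) : Runs (push k a) s (Function.update s k (a :: s k)) 0
  | seq {c d s t u n m} : Runs c s t n → Runs d t u m → Runs (seq c d) s u (n + m)
  | case {k c s t n} : Runs (c (s k).head?) (Function.update s k (s k).tail) t n →
      Runs (case k c) s t (n + 1)
  | loop_nil {k c s} : s k = [] → Runs (loop k c) s s 1
  | loop_cons {k c s a l t u n m} : s k = a :: l → Runs (c a) (Function.update s k l) t n →
      Runs (loop k c) t u m → Runs (loop k c) s u (n + 2 + m)

/-- Correctness of the compiler, by induction on the run. The continuation `q` is arbitrary so that
commands compose, and the final memory is left unspecified because no command relies on the memory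
it inherits: each pop overwrites its slot before it is inspected. -/
theorem iterate_step {M : Λ → TM2.Stmt Γ Λ (Memory Γ)} {c : StackCmd Γ} {s t : ∀ k, List (Γ k)}
    {n : ℕ} (h : Runs c s t n) :
    ∀ (ι : c.Label → Λ) (q : TM2.Stmt Γ Λ (Memory Γ)), (∀ l, M (ι l) = c.code ι q l) →
      ∀ v, ∃ v', (flip bind (TM2.step M))^[n] (some (TM2.stepAux (c.entry ι q) v s)) =
        some (TM2.stepAux q v' t) := by
  induction h with
  | skip s => intro ι q _ v; exact ⟨v, rfl⟩
  | push k a s => intro ι q _ v; exact ⟨v, rfl⟩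
  | seq hc hd ihc ihd =>
    intro ι q hM v
    obtain ⟨v₁, h₁⟩ := ihc _ _ (fun l => hM (.inl l)) v
    obtain ⟨v₂, h₂⟩ := ihd (fun l => ι (.inr l)) q (fun l => hM (.inr l)) v₁
    refine ⟨v₂, ?_⟩
    rw [add_comm, Function.iterate_add_apply]
    exact (congrArg _ h₁).trans h₂
  | @case k c s t n hc ih =>
    intro ι q hM v
    obtain ⟨v₁, h₁⟩ := ih (fun l => ι ⟨_, some l⟩) q (fun l => hM ⟨_, some l⟩)
      (Function.update v k (s k).head?)
    refine ⟨v₁, ?_⟩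
    rw [Function.iterate_succ_apply]
    refine Eq.trans (congrArg _ ?_) h₁
    refine congrArg some (Eq.trans (congrArg (TM2.stepAux · _ _) (hM ⟨_, none⟩)) ?_)
    exact congrArg (fun o => TM2.stepAux ((c o).entry (fun l => ι ⟨o, some l⟩) q) _ _)
      (Function.update_self ..)
  | @loop_nil k c s h =>
    intro ι q hM v
    refine ⟨Function.update v k none, ?_⟩
    simp only [Function.iterate_one, entry, TM2.stepAux, flip, Option.bind_eq_bind,
      Option.bind_some, TM2.step, hM none, code, h]
    have : Function.update s k [] = s := by rw [← h, Function.update_eq_self]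
    simp [this]
  | @loop_cons k c s a l t u n m h hc hd ihc ihd =>
    intro ι q hM v
    obtain ⟨v₁, h₁⟩ := ihc (fun l => ι (some ⟨a, some l⟩)) (.goto fun _ => ι none)
      (fun l => hM (some ⟨a, some l⟩)) (Function.update v k (some a))
    obtain ⟨v₂, h₂⟩ := ihd ι q hM v₁
    refine ⟨v₂, ?_⟩
    rw [add_comm, Function.iterate_add_apply]
    refine Eq.trans (congrArg _ ?_) h₂
    rw [Function.iterate_add_apply]
    refine Eq.trans (congrArg _ ?_) h₁
    simp only [Function.iterate_succ_apply, Function.iterate_zero, id, entry, TM2.stepAux, flip,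
      Option.bind_eq_bind, Option.bind_some, TM2.step, hM none, code, h]
    simp [hM (some ⟨a, none⟩), code]

end Machine

/-! ### Upper bounds for running times. -/

section Costs

variable [DecidableEq K]

/-- `RunsIn c s t B`: started with the stacks `s`, the command `c` ends with the stacks `t` after
at most `B` jumps. -/
def RunsIn (c : StackCmd Γ) (s t : ∀ k, List (Γ k)) (B : ℕ) : Prop := ∃ n ≤ B, Runs c s t n

theorem RunsIn.mono {c : StackCmd Γ} {s t : ∀ k, List (Γ k)} {B B' : ℕ} (h : RunsIn c s t B)
    (hB : B ≤ B') : RunsIn c s t B' :=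
  let ⟨n, hn, hr⟩ := h
  ⟨n, hn.trans hB, hr⟩

theorem runsIn_skip (s : ∀ k, List (Γ k)) : RunsIn skip s s 0 := ⟨0, le_rfl, .skip s⟩

theorem runsIn_push (k : K) (a : Γ k) (s : ∀ k, List (Γ k)) :
    RunsIn (push k a) s (Function.update s k (a :: s k)) 0 := ⟨0, le_rfl, .push k a s⟩

theorem RunsIn.seq {c d : StackCmd Γ} {s t u : ∀ k, List (Γ k)} {B B' : ℕ} (h : RunsIn c s t B)
    (h' : RunsIn d t u B') : RunsIn (seq c d) s u (B + B') :=
  let ⟨_, hn, hr⟩ := h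
  let ⟨_, hn', hr'⟩ := h'
  ⟨_, add_le_add hn hn', .seq hr hr'⟩

theorem RunsIn.case {k : K} {c : Option (Γ k) → StackCmd Γ} {s t : ∀ k, List (Γ k)} {B : ℕ}
    (h : RunsIn (c (s k).head?) (Function.update s k (s k).tail) t B) :
    RunsIn (case k c) s t (B + 1) :=
  let ⟨_, hn, hr⟩ := h
  ⟨_, Nat.add_le_add_right hn 1, .case hr⟩

theorem runsIn_loop_nil {k : K} {c : Γ k → StackCmd Γ} {s : ∀ k, List (Γ k)} (h : s k = []) :
    RunsIn (loop k c) s s 1 := ⟨1, le_rfl, .loop_nil h⟩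

theorem RunsIn.loop_cons {k : K} {c : Γ k → StackCmd Γ} {s t u : ∀ k, List (Γ k)} {a : Γ k}
    {l : List (Γ k)} {B B' : ℕ} (hs : s k = a :: l)
    (h : RunsIn (c a) (Function.update s k l) t B) (h' : RunsIn (loop k c) t u B') :
    RunsIn (loop k c) s u (B + 2 + B') :=
  let ⟨_, hn, hr⟩ := h
  let ⟨_, hn', hr'⟩ := h'
  ⟨_, by omega, .loop_cons hs hr hr'⟩

end Costs

/-- The multi-stack Turing machine running a command. -/
def machine [DecidableEq K] [Fintype K] [∀ k, Fintype (Γ k)] (c : StackCmd Γ) (k₀ k₁ : K) :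
    FinTM2 where
  K := K
  k₀ := k₀
  k₁ := k₁
  Γ := Γ
  Λ := Option c.Label
  main := none
  ΛFin := by
    classical
    have := c.finite_label
    exact Fintype.ofFinite _
  σ := Memory Γ
  initialState := fun _ => none
  σFin := inferInstance
  Γk₀Fin := inferInstance
  m l := match l with
    -- The memory is reset before halting because a halting configuration must carry the initial
    -- internal state.
    | none => c.entry some (.load (fun _ _ => none) .halt)
    | some l => c.code some (.load (fun _ _ => none) .halt) l

/-- The stacks that are empty except for the stack `k`, which holds `l`. -/
def single [DecidableEq K] (k : K) (l : List (Γ k)) : ∀ k, List (Γ k) :=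
  Function.update (fun _ => []) k l

theorem initList_machine [DecidableEq K] [Fintype K] [∀ k, Fintype (Γ k)] (c : StackCmd Γ)
    (k₀ k₁ : K) (l : List (Γ k₀)) :
    initList (c.machine k₀ k₁) l = ⟨some none, fun _ => none, single k₀ l⟩ := by
  unfold initList machine single
  congr 1
  refine funext fun (k : K) => ?_
  by_cases hk : k = k₀
  · subst hk; simp
  · simp [hk]

theorem haltList_machine [DecidableEq K] [Fintype K] [∀ k, Fintype (Γ k)] (c : StackCmd Γ)
    (k₀ k₁ : K) (l : List (Γ k₁)) :
    haltList (c.machine k₀ k₁) l = ⟨none, fun _ => none, single k₁ l⟩ := by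
  unfold haltList machine single
  congr 1
  refine funext fun (k : K) => ?_
  by_cases hk : k = k₁
  · subst hk; simp
  · simp [hk]

/-- A command that turns its input into its output is a machine with that output. -/
def outputsInTime [DecidableEq K] [Fintype K] [∀ k, Fintype (Γ k)] {c : StackCmd Γ} {k₀ k₁ : K}
    {l : List (Γ k₀)} {l' : List (Γ k₁)} {B : ℕ}
    (h : RunsIn c (single k₀ l) (single k₁ l') B) :
    TM2OutputsInTime (c.machine k₀ k₁) l (some l') (B + 1) where
  -- The additional step executes the code at the main label, which enters the command.
  steps := h.choose + 1
  evals_in_steps := by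
    obtain ⟨v', hv'⟩ := iterate_step (M := (c.machine k₀ k₁).m) h.choose_spec.2 some
      (.load (fun _ _ => none) .halt) (fun _ => rfl) (fun _ => none)
    rw [Function.iterate_succ_apply, initList_machine]
    refine Eq.trans ?_ (congrArg some (haltList_machine c k₀ k₁ l').symm)
    exact hv'
  steps_le_m := Nat.succ_le_succ h.choose_spec.1

end StackCmd

end Histories

end

noncomputable section

namespace Histories

/-! ### The program submitted to the history oracle -/

namespace Search

/-- The ancilla qubits, used to compute conjunctions of the item bits. -/
def anc {n : ℕ} (i : Fin (n + 1)) : Fin (2 * n + 4) := ⟨2 * i + 1, by omega⟩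

/-- The qubits holding the name of a database item. -/
def item {n : ℕ} (i : Fin n) : Fin (2 * n + 4) := ⟨2 * i + 2, by omega⟩

/-- The target qubit of the queries. -/
def flag (n : ℕ) : Fin (2 * n + 4) := ⟨0, by omega⟩

/-- The qubit that marks a successful entry of the history. -/
def mark (n : ℕ) : Fin (2 * n + 4) := ⟨2 * n + 2, by omega⟩

/-- A qubit that always holds `0`. -/
def pad (n : ℕ) : Fin (2 * n + 4) := ⟨2 * n + 3, by omega⟩

variable {n : ℕ}

theorem item_injective : Function.Injective (item (n := n)) := fun i j h => by
  simp only [item, Fin.mk.injEq] at h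
  omega

theorem anc_injective : Function.Injective (anc (n := n)) := fun i j h => by
  simp only [anc, Fin.mk.injEq] at h
  omega

@[simp] theorem item_inj {i j : Fin n} : item i = item j ↔ i = j := item_injective.eq_iff
@[simp] theorem anc_inj {i j : Fin (n + 1)} : anc i = anc j ↔ i = j := anc_injective.eq_iff
@[simp] theorem anc_ne_item (i : Fin (n + 1)) (j : Fin n) : anc i ≠ item j := by
  simp only [anc, item, ne_eq, Fin.mk.injEq]; omega
@[simp] theorem item_ne_anc (i : Fin (n + 1)) (j : Fin n) : item j ≠ anc i :=
  (anc_ne_item i j).symm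
@[simp] theorem item_ne_flag (j : Fin n) : item j ≠ flag n := by
  simp only [flag, item, ne_eq, Fin.mk.injEq]; omega
@[simp] theorem flag_ne_item (j : Fin n) : flag n ≠ item j := (item_ne_flag j).symm
@[simp] theorem item_ne_mark (j : Fin n) : item j ≠ mark n := by
  simp only [mark, item, ne_eq, Fin.mk.injEq]; omega
@[simp] theorem mark_ne_item (j : Fin n) : mark n ≠ item j := (item_ne_mark j).symm
@[simp] theorem item_ne_pad (j : Fin n) : item j ≠ pad n := by
  simp only [pad, item, ne_eq, Fin.mk.injEq]; omega
@[simp] theorem pad_ne_item (j : Fin n) : pad n ≠ item j := (item_ne_pad j).symm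
@[simp] theorem anc_ne_flag (j : Fin (n + 1)) : anc j ≠ flag n := by
  simp only [flag, anc, ne_eq, Fin.mk.injEq]; omega
@[simp] theorem flag_ne_anc (j : Fin (n + 1)) : flag n ≠ anc j := (anc_ne_flag j).symm
@[simp] theorem anc_ne_mark (j : Fin (n + 1)) : anc j ≠ mark n := by
  simp only [mark, anc, ne_eq, Fin.mk.injEq]; omega
@[simp] theorem mark_ne_anc (j : Fin (n + 1)) : mark n ≠ anc j := (anc_ne_mark j).symm
@[simp] theorem anc_ne_pad (j : Fin (n + 1)) : anc j ≠ pad n := by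
  simp only [pad, anc, ne_eq, Fin.mk.injEq]; omega
@[simp] theorem pad_ne_anc (j : Fin (n + 1)) : pad n ≠ anc j := (anc_ne_pad j).symm
@[simp] theorem flag_ne_mark : flag n ≠ mark n := by simp [flag, mark]
@[simp] theorem mark_ne_flag : mark n ≠ flag n := by simp [flag, mark]
@[simp] theorem pad_ne_flag : pad n ≠ flag n := by simp [flag, pad]
@[simp] theorem pad_ne_mark : pad n ≠ mark n := by simp [mark, pad]

theorem wire_cases {p : Fin (2 * n + 4) → Prop} (hanc : ∀ i, p (anc i)) (hitem : ∀ i, p (item i))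
    (hflag : p (flag n)) (hmark : p (mark n)) (hpad : p (pad n)) (w : Fin (2 * n + 4)) : p w := by
  rcases w with ⟨w, hw⟩
  by_cases h1 : w = 0
  · subst h1; exact hflag
  by_cases h2 : w = 2 * n + 2
  · subst h2; exact hmark
  by_cases h3 : w = 2 * n + 3
  · subst h3; exact hpad
  rcases Nat.even_or_odd' w with ⟨i, rfl | rfl⟩
  · have h : item (⟨i - 1, by omega⟩ : Fin n) = ⟨2 * i, hw⟩ := by
      simp only [item, Fin.mk.injEq]; omega
    exact h ▸ hitem _
  · exact hanc ⟨i, by omega⟩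

/-- The indices of the item bits that are not in the block refreshed by `highHadamards`. -/
def lowItems (n : ℕ) : List (Fin n) :=
  List.ofFn fun i : Fin (n - 2 * (n / 3)) => ⟨i, by omega⟩

/-- The indices of the last `2 ⌊n / 3⌋` item bits. -/
def highItems (n : ℕ) : List (Fin n) :=
  List.ofFn fun i : Fin (2 * (n / 3)) => ⟨n - 2 * (n / 3) + i, by omega⟩

/-- A query with target `flag n`. -/
def queryGate (n : ℕ) : Gate n (2 * n + 4) :=
  .query ⟨item, item_injective⟩ (flag n) item_ne_flag

/-- One step of the computation of the conjunction of the item bits. -/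
def ladderGate (i : Fin n) : Gate n (2 * n + 4) :=
  .toffoli (anc i.castSucc) (item i) (anc i.succ) (by simp)
    (by simpa using (Fin.castSucc_lt_succ (i := i)).ne) (by simp)

/-- One step of Grover's algorithm, with phase kickback from the qubit `flag n`. -/
def groverCircuit (n : ℕ) : List (Gate n (2 * n + 4)) :=
  [queryGate n] ++ (List.finRange n).flatMap (fun i => [.hadamard (item i), .not (item i)]) ++
    (List.finRange n).flatMap (fun i => [ladderGate i]) ++
    [.cnot (anc (Fin.last n)) (flag n) (by simp)] ++
    (List.finRange n).reverse.flatMap (fun i => [ladderGate i]) ++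
    (List.finRange n).flatMap (fun i => [.not (item i), .hadamard (item i)])

/-- A Hadamard gate that is applied if the qubit `flag n` holds `0`. -/
def controlledHadamard (i : Fin n) : List (Gate n (2 * n + 4)) :=
  List.replicate 6 (.piEighth (item i)) ++ [.hadamard (item i)] ++
    List.replicate 7 (.piEighth (item i)) ++ [.cnot (flag n) (item i) (by simp)] ++
    [.piEighth (item i), .hadamard (item i), .piEighth (item i), .piEighth (item i),
      .hadamard (item i)]

def groverStart (n : ℕ) : List (Gate n (2 * n + 4)) :=
  [.not (anc 0)] ++ (List.finRange n).flatMap (fun i => [.hadamard (item i)]) ++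
    [.not (flag n), .hadamard (flag n)]

def groverEnd (n : ℕ) : List (Gate n (2 * n + 4)) :=
  [.hadamard (flag n), .not (flag n), queryGate n] ++ (highItems n).flatMap controlledHadamard

/-- The first circuit: about `N ^ (1/3)` steps of Grover's algorithm, after which the item bits
`highItems n` of the unmarked items are brought back to (almost) `0`. -/
def prepCircuit (n : ℕ) : List (Gate n (2 * n + 4)) :=
  groverStart n ++ (List.replicate (2 ^ (n / 3)) (groverCircuit n)).flatten ++ groverEnd n

def lowHadamards (n : ℕ) : List (Gate n (2 * n + 4)) :=
  (lowItems n).flatMap fun i => [.hadamard (item i)]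

def highHadamards (n : ℕ) : List (Gate n (2 * n + 4)) :=
  (highItems n).flatMap fun i => [.hadamard (item i)]

def flagHadamard (n : ℕ) : List (Gate n (2 * n + 4)) := [.hadamard (flag n)]

def markCircuit (n : ℕ) : List (Gate n (2 * n + 4)) := [.cnot (flag n) (mark n) (by simp)]

/-- The circuits that are repeated; together they are the identity. -/
def cycle (n : ℕ) : List (List (Gate n (2 * n + 4))) :=
  [lowHadamards n, lowHadamards n, highHadamards n, flagHadamard n, flagHadamard n,
    highHadamards n, markCircuit n, markCircuit n]

def program (n : ℕ) : Program n where
  qubits := 2 * n + 4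
  qubits_pos := by omega
  circuits := prepCircuit n :: (List.replicate (32 * 2 ^ (n / 3)) (cycle n)).flatten

theorem T_program (n : ℕ) : (program n).T = 1 + 256 * 2 ^ (n / 3) := by
  simp [Program.T, program, cycle]
  ring

/-- Queries occur only in the first circuit: one per Grover step and one to set the flag. The
repeated circuits contain none. -/
theorem queries_program (n : ℕ) : (program n).queries = 2 ^ (n / 3) + 1 := by
  have h : ∀ (L : List (Fin n)) (g : Fin n → List (Gate n (2 * n + 4))),
      (∀ i, (g i).countP Gate.isQuery = 0) → (L.flatMap g).countP Gate.isQuery = 0 := by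
    intro L g hg
    induction L with
    | nil => rfl
    | cons i L ih => simp [List.countP_append, hg, ih]
  have hlow : (lowHadamards n).countP Gate.isQuery = 0 := h _ _ fun _ => rfl
  have hhigh : (highHadamards n).countP Gate.isQuery = 0 := h _ _ fun _ => rfl
  have hgr : (groverCircuit n).countP Gate.isQuery = 1 := by
    simp only [groverCircuit, List.countP_append]
    rw [h _ _ fun _ => rfl, h _ _ fun _ => rfl, h _ _ fun _ => rfl, h _ _ fun _ => rfl]
    rfl
  have hprep : (prepCircuit n).countP Gate.isQuery = 2 ^ (n / 3) + 1 := by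
    simp only [prepCircuit, groverStart, groverEnd, List.countP_append, List.countP_flatten]
    rw [h _ _ fun _ => rfl, h _ _ fun _ => rfl]
    simp only [List.map_replicate, hgr, List.sum_replicate]
    simp [Gate.isQuery, queryGate]
  have hcyc : ∀ k, (((List.replicate k (cycle n)).flatten).map
      fun c => c.countP Gate.isQuery).sum = 0 := by
    intro k
    induction k with
    | zero => rfl
    | succ k ih =>
      rw [List.replicate_succ, List.flatten_cons, List.map_append, List.sum_append, ih]
      simp [cycle, hlow, hhigh, flagHadamard, markCircuit, Gate.isQuery]
  simp only [Program.queries, program, List.map_cons, List.sum_cons, hprep]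
  exact (congrArg (_ + ·) (hcyc _)).trans (add_zero _)

end Search

end Histories

end

noncomputable section

namespace Histories

namespace Search

/-! ### The machine that writes the program down -/

/-- The counters of the writing machine. -/
inductive Counter : Type
  | inp | n | b | a | idx | tick | save | pow | pow'
  deriving DecidableEq

instance : Fintype Counter :=
  Fintype.ofList [.inp, .n, .b, .a, .idx, .tick, .save, .pow, .pow'] (by rintro ⟨⟩ <;> simp)

open Classical in
instance : Fintype Sym :=
  Fintype.ofList [.hadamard, .piEighth, .not, .cnot, .toffoli, .query, .tick, .endNumber,
    .endCircuit] (by rintro ⟨⟩ <;> simp)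

/-- The stacks of the writing machine are the output and unary counters. -/
@[reducible] def WAlphabet : Option Counter → Type
  | none => Sym
  | some _ => Bool

instance : ∀ k, Fintype (WAlphabet k)
  | none => inferInstanceAs (Fintype Sym)
  | some _ => inferInstanceAs (Fintype Bool)

abbrev WCmd : Type := StackCmd WAlphabet

/-- The stacks with counter values `r` and output `o`. -/
def conf (r : Counter → ℕ) (o : List Sym) : ∀ k, List (WAlphabet k)
  | none => o
  | some c => List.replicate (r c) true

def inc (c : Counter) : WCmd := .push (some c) true

def dec (c : Counter) : WCmd := .case (some c) fun _ => .skip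

def emit (s : Sym) : WCmd := .push none s

/-- Decrement `c` until it is `0`, running `d` each time. -/
def drain (c : Counter) (d : WCmd) : WCmd := .loop (some c) fun _ => d

theorem update_conf_some (r : Counter → ℕ) (o : List Sym) (c : Counter) (x : ℕ) :
    Function.update (conf r o) (some c) (List.replicate x true) =
      conf (Function.update r c x) o := by
  funext k
  rcases k with _ | k
  · rfl
  · by_cases h : k = c
    · subst h; simp [conf]
    · simp [conf, h]

theorem update_conf_none (r : Counter → ℕ) (o o' : List Sym) :
    Function.update (conf r o) none o' = conf r o' := by
  funext k
  rcases k with _ | k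
  · simp [conf]
  · simp [conf]

theorem runsIn_inc (r : Counter → ℕ) (o : List Sym) (c : Counter) :
    StackCmd.RunsIn (inc c) (conf r o) (conf (Function.update r c (r c + 1)) o) 0 := by
  rw [← update_conf_some]
  exact StackCmd.runsIn_push (some c) true (conf r o)

theorem runsIn_dec (r : Counter → ℕ) (o : List Sym) (c : Counter) :
    StackCmd.RunsIn (dec c) (conf r o) (conf (Function.update r c (r c - 1)) o) 1 := by
  rw [← update_conf_some]
  refine StackCmd.RunsIn.case (B := 0) ?_
  have : (conf r o (some c)).tail = List.replicate (r c - 1) true := by simp [conf]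
  rw [this]
  exact StackCmd.runsIn_skip _

theorem runsIn_emit (r : Counter → ℕ) (o : List Sym) (s : Sym) :
    StackCmd.RunsIn (emit s) (conf r o) (conf r (s :: o)) 0 := by
  rw [← update_conf_none r o (s :: o)]
  exact StackCmd.runsIn_push (none : Option Counter) s (conf r o)

theorem runsIn_drain_zero {c : Counter} {d : WCmd} {r : Counter → ℕ} {o : List Sym} (h : r c = 0) :
    StackCmd.RunsIn (drain c d) (conf r o) (conf r o) 1 :=
  StackCmd.runsIn_loop_nil (by simp [conf, h])

theorem runsIn_drain_succ {c : Counter} {d : WCmd} {r r' r'' : Counter → ℕ} {o o' o'' : List Sym}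
    {x B B' : ℕ} (h : r c = x + 1)
    (hd : StackCmd.RunsIn d (conf (Function.update r c x) o) (conf r' o') B)
    (hl : StackCmd.RunsIn (drain c d) (conf r' o') (conf r'' o'') B') :
    StackCmd.RunsIn (drain c d) (conf r o) (conf r'' o'') (B + 2 + B') :=
  StackCmd.RunsIn.loop_cons (a := true) (l := List.replicate x true)
    (by simp [conf, h, List.replicate_succ]) (by rwa [update_conf_some]) hl

/-- The rule for bodies that transform a sequence of states. -/
theorem runsIn_drain {c : Counter} {d : WCmd} (r : ℕ → Counter → ℕ) (o : ℕ → List Sym) {B : ℕ}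
    (N : ℕ) (h0 : ∀ j ≤ N, r j c = N - j)
    (hd : ∀ j < N, StackCmd.RunsIn d (conf (Function.update (r j) c (N - (j + 1))) (o j))
      (conf (r (j + 1)) (o (j + 1))) B) :
    StackCmd.RunsIn (drain c d) (conf (r 0) (o 0)) (conf (r N) (o N)) (N * (B + 2) + 1) := by
  -- Induction backwards from the end of the loop; `k` is the number of rounds still to be run.
  have key : ∀ k ≤ N, StackCmd.RunsIn (drain c d) (conf (r (N - k)) (o (N - k)))
      (conf (r N) (o N)) (k * (B + 2) + 1) := by
    intro k
    induction k with
    | zero =>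
      intro _
      simpa using runsIn_drain_zero (d := d) (by simpa using h0 N le_rfl)
    | succ k ih =>
      intro hk
      have h1 : N - k = N - (k + 1) + 1 := by omega
      have h2 := hd (N - (k + 1)) (by omega)
      rw [← h1] at h2
      refine (runsIn_drain_succ (x := k) (B := B) ?_ ?_ (ih (by omega))).mono ?_
      · rw [h0 _ (by omega)]; omega
      · convert h2 using 4; omega
      · exact (by ring : _ = _).le
  simpa using key N le_rfl

/-- Run `d` as many times as the counter `k` says, using the counter `sv` to restore it. -/
def rep (k sv : Counter) (d : WCmd) : WCmd :=
  .seq (drain k (.seq (inc sv) d)) (drain sv (inc k))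

theorem runsIn_restore {k sv : Counter} (hk : k ≠ sv) (r : Counter → ℕ) (o : List Sym) (N : ℕ)
    (h0 : r k = 0) (hs : r sv = N) :
    StackCmd.RunsIn (drain sv (inc k)) (conf r o)
      (conf (Function.update (Function.update r sv 0) k N) o) (N * 2 + 1) := by
  have h := runsIn_drain (c := sv) (d := inc k) (B := 0)
    (fun j => Function.update (Function.update r sv (N - j)) k j) (fun _ => o) N
    (fun j _ => by simp [hk.symm]) (fun j _ => by
      convert runsIn_inc _ o k using 2
      funext c
      by_cases hc : c = k
      · subst hc; simp [hk]
      · by_cases hc' : c = sv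
        · subst hc'; simp [hc]
        · simp [hc, hc'])
  convert h using 2
  · funext c
    by_cases hc : c = k
    · subst hc; simp [h0]
    · by_cases hc' : c = sv
      · subst hc'; simp [hc, hs]
      · simp [hc, hc']
  · simp

/-- The rule for repetitions that change only the counter `idx` and the output. -/
theorem runsIn_rep {k sv : Counter} {d : WCmd} (hk : k ≠ sv) (hki : k ≠ .idx) (hsi : sv ≠ .idx)
    (r : Counter → ℕ) (i : ℕ → ℕ) (o : ℕ → List Sym) {B : ℕ} (N : ℕ) (hN : r k = N)
    (hs : r sv = 0)
    (hd : ∀ j < N, ∀ u w, StackCmd.RunsIn d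
      (conf (Function.update (Function.update (Function.update r k u) sv w) .idx (i j)) (o j))
      (conf (Function.update (Function.update (Function.update r k u) sv w) .idx (i (j + 1)))
        (o (j + 1))) B) :
    StackCmd.RunsIn (rep k sv d) (conf (Function.update r .idx (i 0)) (o 0))
      (conf (Function.update r .idx (i N)) (o N)) (N * (B + 4) + 2) := by
  have h := runsIn_drain (c := k) (d := .seq (inc sv) d) (B := 0 + B)
    (fun j => Function.update (Function.update (Function.update r k (N - j)) sv j) .idx (i j)) o N
    (fun j _ => by simp [hk, hki]) (fun j hj => by
      refine StackCmd.RunsIn.seq (runsIn_inc _ _ _) ?_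
      -- During round `j` the drained counter holds `N - (j + 1)` and its backup `j + 1`. The body
      -- is assumed to work for all values of these two counters, so it is instantiated at these.
      convert hd j hj (N - (j + 1)) (j + 1) using 2
      funext c
      by_cases hc : c = .idx
      · subst hc; simp [hki.symm, hsi.symm]
      · by_cases hc' : c = sv
        · subst hc'; simp [hc, hk.symm]
        · by_cases hc'' : c = k
          · subst hc''; simp [hc, hc']
          · simp [hc, hc', hc''])
  have h' := runsIn_restore hk
    (Function.update (Function.update (Function.update r k (N - N)) sv N) .idx (i N)) (o N) N
    (by simp [hk, hki]) (by simp [hsi])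
  refine StackCmd.RunsIn.mono (B := N * (0 + B + 2) + 1 + (N * 2 + 1)) ?_
    (by ring_nf; exact le_rfl)
  unfold rep
  convert StackCmd.RunsIn.seq h h' using 2
  · funext c
    by_cases hc : c = .idx
    · subst hc; simp
    · by_cases hc' : c = sv
      · subst hc'; simp [hc, hs]
      · by_cases hc'' : c = k
        · subst hc''; simp [hc, hc', ← hN]
        · simp [hc, hc', hc'']
  · funext c
    by_cases hc : c = .idx
    · subst hc; simp [hki.symm, hsi.symm]
    · by_cases hc' : c = sv
      · subst hc'; simp [hc, hs, hk.symm]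
      · by_cases hc'' : c = k
        · subst hc''; simp [hc, ← hN]
        · simp [hc, hc', hc'']

end Search

end Histories

end

/-! ### Text templates and loops over the item index. -/

noncomputable section

namespace Histories

namespace Search

/-- Write `2 * idx` ticks. -/
def emitIdx : WCmd :=
  .seq (drain .idx (inc .tick)) (drain .tick (.seq (inc .idx) (.seq (emit .tick) (emit .tick))))

/-- Reading a unary counter destroys it, so `idx` is first moved to `tick`; moving it back writes
two ticks per unit. -/
theorem runsIn_emitIdx (r : Counter → ℕ) (o : List Sym) (ht : r .tick = 0) :
    StackCmd.RunsIn emitIdx (conf r o) (conf r (List.replicate (2 * r .idx) .tick ++ o))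
      (4 * r .idx + 2) := by
  have h := runsIn_drain (c := .idx) (d := inc .tick) (B := 0)
    (fun j => Function.update (Function.update r .idx (r .idx - j)) .tick j) (fun _ => o) (r .idx)
    (fun j _ => by simp) (fun j _ => by
      convert runsIn_inc _ o .tick using 2
      funext c
      cases c <;> simp)
  have h' := runsIn_drain (c := .tick)
    (d := .seq (inc .idx) (.seq (emit .tick) (emit .tick))) (B := 0)
    (fun j => Function.update (Function.update r .idx j) .tick (r .idx - j))
    (fun j => List.replicate (2 * j) .tick ++ o) (r .idx)
    (fun j _ => by simp) (fun j _ => by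
      refine StackCmd.RunsIn.seq (B := 0) (B' := 0) (runsIn_inc _ _ _)
        (StackCmd.RunsIn.seq (B := 0) (B' := 0) (runsIn_emit _ _ _) ?_)
      convert runsIn_emit _ _ _ using 2
      · funext c
        cases c <;> simp
      · rw [show 2 * (j + 1) = 2 * j + 1 + 1 by ring, List.replicate_succ, List.replicate_succ]
        rfl)
  refine StackCmd.RunsIn.mono (B := r .idx * (0 + 2) + 1 + (r .idx * (0 + 2) + 1)) ?_ (by omega)
  unfold emitIdx
  refine StackCmd.RunsIn.seq (t := conf (Function.update (Function.update r .idx 0) .tick (r .idx)) o)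
    ?_ ?_
  · convert h using 2
    · funext c
      cases c <;> simp [ht]
    · simp
  · convert h' using 2
    · funext c
      cases c <;> simp
    · simp
    · funext c
      cases c <;> simp [ht]

/-- A template of a piece of text: `none` stands for `2 * idx` ticks. -/
abbrev Template : Type := List (Option Sym)

/-- Ancillas and item bits are interleaved so that all qubit indices needed have the form `2 * idx +
d` with a fixed `d`, or are constant. One template thus serves for every item, and `idx = n` yields
the last ancilla, the mark and the number of qubits. -/
def Template.expand (t : Template) (i : ℕ) : List Sym :=
  t.flatMap fun p => p.elim (List.replicate (2 * i) .tick) fun s => [s]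

/-- The output is a stack, so the end of the text has to be written first. -/
def emitTemplate : Template → WCmd
  | [] => .skip
  | p :: t => .seq (emitTemplate t) (p.elim emitIdx emit)

theorem runsIn_emitTemplate (t : Template) (r : Counter → ℕ) (o : List Sym) (ht : r .tick = 0) :
    StackCmd.RunsIn (emitTemplate t) (conf r o) (conf r (t.expand (r .idx) ++ o))
      (t.length * (4 * r .idx + 2)) := by
  induction t with
  | nil => exact (StackCmd.runsIn_skip (conf r o)).mono (Nat.zero_le _)
  | cons p t ih =>
    refine StackCmd.RunsIn.mono (B := t.length * (4 * r .idx + 2) + (4 * r .idx + 2)) ?_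
      (by simp only [List.length_cons]; ring_nf; exact le_rfl)
    refine StackCmd.RunsIn.seq ih ?_
    rcases p with _ | s
    · simpa [Template.expand] using runsIn_emitIdx r (Template.expand t (r .idx) ++ o) ht
    · simpa [Template.expand] using (runsIn_emit r (Template.expand t (r .idx) ++ o) s).mono (Nat.zero_le _)

/-- Texts for descending values of `idx`; since writing is done backwards, the text for the smallest
value comes first. -/
theorem runsIn_rep_dec (k : Counter) (hk : k ≠ .save) (hki : k ≠ .idx) (hkt : k ≠ .tick)
    (t : Template) (r : Counter → ℕ) (o : List Sym) (i X : ℕ) (ht : r .tick = 0)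
    (hs : r .save = 0) (hX : r .idx = i + r k) (hX' : r .idx ≤ X) :
    StackCmd.RunsIn (rep k .save (.seq (dec .idx) (emitTemplate t))) (conf r o)
      (conf (Function.update r .idx i) ((List.range' i (r k)).flatMap t.expand ++ o))
      (r k * (t.length * (4 * X + 2) + 5) + 2) := by
  have h := runsIn_rep (d := .seq (dec .idx) (emitTemplate t)) hk hki (by decide : Counter.save ≠ .idx)
    r (fun j => i + (r k - j)) (fun j => (List.range' (i + (r k - j)) j).flatMap t.expand ++ o)
    (B := 1 + t.length * (4 * X + 2)) (r k) rfl hs (fun j hj u w => by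
      refine StackCmd.RunsIn.seq (runsIn_dec _ _ _) ?_
      have h1 := runsIn_emitTemplate t
        (Function.update (Function.update (Function.update r k u) .save w) .idx
          (i + (r k - (j + 1)))) ((List.range' (i + (r k - j)) j).flatMap t.expand ++ o)
        (by simp [hkt.symm, ht])
      refine StackCmd.RunsIn.mono ?_ (B := t.length * (4 * (i + (r k - (j + 1))) + 2))
        (Nat.mul_le_mul_left _ (by omega))
      convert h1 using 2
      · funext c
        by_cases hc : c = .idx
        · subst hc; simp; omega
        · simp [hc]
      · have : i + (r k - j) = i + (r k - (j + 1)) + 1 := by omega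
        rw [this, List.range'_succ]
        simp
      · simp)
  refine StackCmd.RunsIn.mono (B := r k * (1 + t.length * (4 * X + 2) + 4) + 2) ?_
    (by ring_nf; exact le_rfl)
  convert h using 2
  · funext c
    by_cases hc : c = .idx
    · subst hc; simp [hX]
    · simp [hc]
  · simp
  · simp
  · simp

/-- Here `idx` is changed after the text is written, and later texts land further left, hence the
reversed range. With the empty template this only moves `idx` back up. -/
theorem runsIn_rep_inc (k : Counter) (hk : k ≠ .save) (hki : k ≠ .idx) (hkt : k ≠ .tick)
    (t : Template) (r : Counter → ℕ) (o : List Sym) (X : ℕ) (ht : r .tick = 0)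
    (hs : r .save = 0) (hX : r .idx + r k ≤ X) :
    StackCmd.RunsIn (rep k .save (.seq (emitTemplate t) (inc .idx))) (conf r o)
      (conf (Function.update r .idx (r .idx + r k))
        ((List.range' (r .idx) (r k)).reverse.flatMap t.expand ++ o))
      (r k * (t.length * (4 * X + 2) + 5) + 2) := by
  have h := runsIn_rep (d := .seq (emitTemplate t) (inc .idx)) hk hki
    (by decide : Counter.save ≠ .idx)
    r (fun j => r .idx + j)
    (fun j => (List.range' (r .idx) j).reverse.flatMap t.expand ++ o)
    (B := t.length * (4 * X + 2) + 0) (r k) rfl hs (fun j hj u w => by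
      have h1 := runsIn_emitTemplate t
        (Function.update (Function.update (Function.update r k u) .save w) .idx
          (r .idx + j)) ((List.range' (r .idx) j).reverse.flatMap t.expand ++ o)
        (by simp [hkt.symm, ht])
      refine StackCmd.RunsIn.seq (StackCmd.RunsIn.mono h1 (Nat.mul_le_mul_left _ ?_)) ?_
      · simp; omega
      convert runsIn_inc _ _ _ using 2
      · funext c
        by_cases hc : c = .idx
        · subst hc; simp; omega
        · simp [hc]
      · rw [List.range'_concat]
        simp)
  refine StackCmd.RunsIn.mono (B := r k * (t.length * (4 * X + 2) + 0 + 4) + 2) ?_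
    (Nat.add_le_add_right (Nat.mul_le_mul_left _
      (Nat.add_le_add (le_refl (t.length * (4 * X + 2))) (by norm_num))) 2)
  convert h using 2
  · funext c
    by_cases hc : c = .idx
    · subst hc; simp
    · simp [hc]
  · simp

/-- The values of the counters while the program is written. -/
structure Ready (n : ℕ) (r : Counter → ℕ) : Prop where
  b : r .b = 2 * (n / 3)
  a : r .a = n - 2 * (n / 3)
  idx : r .idx = n
  tick : r .tick = 0
  save : r .save = 0
  n : r .n = n

/-- The command `c` writes `w` (to the left of what is already written) and leaves the counters
unchanged. -/
def Emits (n : ℕ) (c : WCmd) (w : List Sym) (B : ℕ) : Prop :=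
  ∀ r o, Ready n r → StackCmd.RunsIn c (conf r o) (conf r (w ++ o)) B

theorem Emits.append {n : ℕ} {c d : WCmd} {w w' : List Sym} {B B' : ℕ} (h : Emits n c w B)
    (h' : Emits n d w' B') : Emits n (.seq d c) (w ++ w') (B' + B) := fun r o hr => by
  rw [List.append_assoc]
  exact StackCmd.RunsIn.seq (h' r o hr) (h r _ hr)

theorem Emits.mono {n : ℕ} {c : WCmd} {w w' : List Sym} {B B' : ℕ} (h : Emits n c w B)
    (hw : w = w') (hB : B ≤ B') : Emits n c w' B' := fun r o hr => hw ▸ (h r o hr).mono hB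

theorem emits_template (n : ℕ) (t : Template) :
    Emits n (emitTemplate t) (t.expand n) (t.length * (4 * n + 2)) := fun r o hr => by
  simpa [hr.idx] using runsIn_emitTemplate t r o hr.tick

/-- A text for each item, in ascending order. -/
def emitAll (t : Template) : WCmd :=
  .seq (rep .n .save (.seq (dec .idx) (emitTemplate t)))
    (rep .n .save (.seq (emitTemplate []) (inc .idx)))

/-- A text for each item, in descending order. -/
def emitAllReverse (t : Template) : WCmd :=
  .seq (rep .n .save (.seq (dec .idx) (emitTemplate [])))
    (rep .n .save (.seq (emitTemplate t) (inc .idx)))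

/-- A text for each of `highItems`. -/
def emitHigh (t : Template) : WCmd :=
  .seq (rep .b .save (.seq (dec .idx) (emitTemplate t)))
    (rep .b .save (.seq (emitTemplate []) (inc .idx)))

/-- A text for each of `lowItems`. -/
def emitLow (t : Template) : WCmd :=
  .seq (rep .b .save (.seq (dec .idx) (emitTemplate [])))
    (.seq (rep .a .save (.seq (dec .idx) (emitTemplate t)))
      (rep .n .save (.seq (emitTemplate []) (inc .idx))))

theorem update_idx_self {n : ℕ} {r : Counter → ℕ} (hr : Ready n r) (i : ℕ) :
    Function.update (Function.update r .idx i) .idx n = r := by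
  funext c
  by_cases hc : c = .idx
  · subst hc; simp [hr.idx]
  · simp [hc]

/-- A bound for the time needed to write a text for each item. -/
def layerCost (n : ℕ) (t : Template) : ℕ := n * (t.length * (4 * n + 2) + 15) + 6

theorem emits_all (n : ℕ) (t : Template) :
    Emits n (emitAll t) ((List.range n).flatMap t.expand) (layerCost n t) := fun r o hr => by
  have h1 := runsIn_rep_dec .n (by decide) (by decide) (by decide) t r o 0 n hr.tick hr.save
    (by rw [hr.idx, hr.n, zero_add]) hr.idx.le
  -- The second loop writes nothing; it restores `idx` to `n`, as the invariant `Ready` demands.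
  have h2 := runsIn_rep_inc .n (by decide) (by decide) (by decide) [] (Function.update r .idx 0)
    ((List.range' 0 (r .n)).flatMap t.expand ++ o) n (by simp [hr.tick]) (by simp [hr.save])
    (by simp [hr.n])
  refine StackCmd.RunsIn.mono (StackCmd.RunsIn.seq (B := n * (t.length * (4 * n + 2) + 5) + 2)
    (B' := n * 5 + 2)
    (t := conf (Function.update r .idx 0) ((List.range' 0 (r .n)).flatMap t.expand ++ o)) ?_ ?_)
    (by simp only [layerCost]; nlinarith)
  · convert h1 using 2
    simp [hr.n]
  · convert h2 using 2
    · simp [hr.n, update_idx_self hr]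
    · simp [Template.expand, hr.n, List.range_eq_range']
    · simp [hr.n]

theorem emits_allReverse (n : ℕ) (t : Template) :
    Emits n (emitAllReverse t) ((List.range n).reverse.flatMap t.expand) (layerCost n t) :=
  fun r o hr => by
  have h1 := runsIn_rep_dec .n (by decide) (by decide) (by decide) [] r o 0 n hr.tick hr.save
    (by rw [hr.idx, hr.n, zero_add]) hr.idx.le
  have h2 := runsIn_rep_inc .n (by decide) (by decide) (by decide) t (Function.update r .idx 0)
    o n (by simp [hr.tick]) (by simp [hr.save]) (by simp [hr.n])
  refine StackCmd.RunsIn.mono (StackCmd.RunsIn.seq (B := n * 5 + 2)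
    (B' := n * (t.length * (4 * n + 2) + 5) + 2) (t := conf (Function.update r .idx 0) o) ?_ ?_)
    (by simp only [layerCost]; nlinarith)
  · convert h1 using 2
    · simp [Template.expand]
    · simp [hr.n]
  · convert h2 using 2
    · simp [hr.n, update_idx_self hr]
    · simp [hr.n, List.range_eq_range']
    · simp [hr.n]

theorem emits_high (n : ℕ) (t : Template) :
    Emits n (emitHigh t) ((List.range' (n - 2 * (n / 3)) (2 * (n / 3))).flatMap t.expand)
      (layerCost n t) := fun r o hr => by
  have hn : 2 * (n / 3) ≤ n := by omega
  have h1 := runsIn_rep_dec .b (by decide) (by decide) (by decide) t r o (n - 2 * (n / 3)) n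
    hr.tick hr.save (by rw [hr.idx, hr.b]; omega) hr.idx.le
  have h2 := runsIn_rep_inc .b (by decide) (by decide) (by decide) []
    (Function.update r .idx (n - 2 * (n / 3)))
    ((List.range' (n - 2 * (n / 3)) (r .b)).flatMap t.expand ++ o) n (by simp [hr.tick])
    (by simp [hr.save]) (by simp [hr.b]; omega)
  refine StackCmd.RunsIn.mono (StackCmd.RunsIn.seq (B := n * (t.length * (4 * n + 2) + 5) + 2)
    (B' := n * 5 + 2) (h1.mono ?_) ?_) (by simp only [layerCost]; nlinarith)
  · rw [hr.b]; gcongr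
  · refine StackCmd.RunsIn.mono (B := 2 * (n / 3) * 5 + 2) ?_ (by omega)
    convert h2 using 2
    · simp [hr.b, Nat.sub_add_cancel hn, update_idx_self hr]
    · simp [Template.expand, hr.b]
    · simp [hr.b]

theorem emits_low (n : ℕ) (t : Template) :
    Emits n (emitLow t) ((List.range (n - 2 * (n / 3))).flatMap t.expand)
      (layerCost n t) := fun r o hr => by
  have hn : 2 * (n / 3) ≤ n := by omega
  have h1 := runsIn_rep_dec .b (by decide) (by decide) (by decide) [] r o (n - 2 * (n / 3)) n
    hr.tick hr.save (by rw [hr.idx, hr.b]; omega) hr.idx.le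
  have h2 := runsIn_rep_dec .a (by decide) (by decide) (by decide) t
    (Function.update r .idx (n - 2 * (n / 3))) o 0 n (by simp [hr.tick])
    (by simp [hr.save]) (by simp [hr.a]) (by simp)
  have h3 := runsIn_rep_inc .n (by decide) (by decide) (by decide) []
    (Function.update r .idx 0) ((List.range (n - 2 * (n / 3))).flatMap t.expand ++ o) n
    (by simp [hr.tick]) (by simp [hr.save]) (by simp [hr.n])
  refine StackCmd.RunsIn.mono (StackCmd.RunsIn.seq (B := n * 5 + 2)
    (t := conf (Function.update r .idx (n - 2 * (n / 3))) o) ?_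
    (StackCmd.RunsIn.seq (B := n * (t.length * (4 * n + 2) + 5) + 2) (B' := n * 5 + 2)
      (t := conf (Function.update r .idx 0)
        ((List.range (n - 2 * (n / 3))).flatMap t.expand ++ o)) ?_ ?_))
    (by simp only [layerCost]; nlinarith)
  · refine StackCmd.RunsIn.mono (B := 2 * (n / 3) * 5 + 2) ?_ (by omega)
    convert h1 using 2
    · simp [Template.expand]
    · simp [hr.b]
  · refine StackCmd.RunsIn.mono
      (B := (n - 2 * (n / 3)) * (t.length * (4 * n + 2) + 5) + 2) ?_ (by gcongr; omega)
    convert h2 using 2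
    · simp
    · simp [hr.a, List.range_eq_range']
    · simp [hr.a]
  · convert h3 using 2
    · simp [hr.n, update_idx_self hr]
    · simp [Template.expand]
    · simp [hr.n]

end Search

end Histories

end

/-! ### Texts of gates, layers of gates and the Grover step. -/

noncomputable section

namespace Histories

namespace Search

/-- The number `2 * idx + d`. -/
def numberT (d : ℕ) : Template := none :: List.replicate d (some .tick) ++ [some .endNumber]

/-- A gate on the qubit `2 * idx + d`. -/
def gateT (s : Sym) (d : ℕ) : Template := some s :: numberT d

theorem expand_append (t t' : Template) (i : ℕ) :
    Template.expand (t ++ t') i = Template.expand t i ++ Template.expand t' i := by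
  simp [Template.expand]

theorem expand_cons_some (s : Sym) (t : Template) (i : ℕ) :
    Template.expand (some s :: t) i = s :: Template.expand t i := by
  simp [Template.expand]

theorem expand_numberT (d i : ℕ) : Template.expand (numberT d) i = encodeNumber (2 * i + d) := by
  simp only [numberT, List.cons_append]
  rw [← List.singleton_append, expand_append, expand_append, encodeNumber]
  simp [Template.expand, List.flatMap_replicate, List.flatten_replicate_singleton]
  rw [← List.append_assoc, List.replicate_append_replicate]

theorem expand_gateT (s : Sym) (d i : ℕ) :
    Template.expand (gateT s d) i = s :: encodeNumber (2 * i + d) := by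
  rw [gateT, expand_cons_some, expand_numberT]

theorem length_numberT (d : ℕ) : (numberT d).length = d + 2 := by
  simp [numberT]

theorem length_gateT (s : Sym) (d : ℕ) : (gateT s d).length = d + 3 := by
  simp [gateT, numberT]

theorem layerCost_le (n : ℕ) (t : Template) :
    layerCost n t ≤ (4 * t.length + 21) * (n + 1) ^ 2 := by
  simp only [layerCost]
  nlinarith [Nat.zero_le t.length, Nat.zero_le (t.length * n), Nat.zero_le n]

theorem templateCost_le (n : ℕ) (t : Template) :
    t.length * (4 * n + 2) ≤ (4 * t.length) * (n + 1) ^ 2 := by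
  nlinarith [Nat.zero_le t.length, Nat.zero_le (t.length * n), Nat.zero_le (t.length * n ^ 2)]

theorem flatMap_finRange {n : ℕ} (h : ℕ → List Sym) :
    (List.finRange n).flatMap (fun i : Fin n => h (i : ℕ)) = (List.range n).flatMap h := by
  rw [← List.map_coe_finRange_eq_range, List.flatMap_map]

theorem flatMap_finRange_reverse {n : ℕ} (h : ℕ → List Sym) :
    (List.finRange n).reverse.flatMap (fun i : Fin n => h (i : ℕ)) = (List.range n).reverse.flatMap h := by
  rw [← List.map_coe_finRange_eq_range, ← List.map_reverse, List.flatMap_map]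

theorem flatMap_lowItems {n : ℕ} (h : ℕ → List Sym) :
    (lowItems n).flatMap (fun i : Fin n => h (i : ℕ)) = (List.range (n - 2 * (n / 3))).flatMap h := by
  have : (lowItems n).map (fun i : Fin n => (i : ℕ)) = List.range (n - 2 * (n / 3)) := by
    rw [lowItems, List.map_ofFn]
    exact List.ext_getElem (by simp) (by simp)
  rw [← this, List.flatMap_map]

theorem flatMap_highItems {n : ℕ} (h : ℕ → List Sym) :
    (highItems n).flatMap (fun i : Fin n => h (i : ℕ)) =
      (List.range' (n - 2 * (n / 3)) (2 * (n / 3))).flatMap h := by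
  have : (highItems n).map (fun i : Fin n => (i : ℕ)) = List.range' (n - 2 * (n / 3)) (2 * (n / 3)) := by
    rw [highItems, List.map_ofFn]
    exact List.ext_getElem (by simp) (by simp)
  rw [← this, List.flatMap_map]

variable {n : ℕ}

theorem emits_template' (t : Template) :
    Emits n (emitTemplate t) (Template.expand t n) ((4 * t.length) * (n + 1) ^ 2) :=
  (emits_template n t).mono rfl (templateCost_le n t)

theorem emits_all_gates (t : Template) (g : Fin n → List (Gate n (2 * n + 4)))
    (h : ∀ i, (g i).flatMap encodeGate = Template.expand t i) :
    Emits n (emitAll t) (((List.finRange n).flatMap g).flatMap encodeGate)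
      ((4 * t.length + 21) * (n + 1) ^ 2) :=
  (emits_all n t).mono (by
    rw [List.flatMap_assoc]; simp only [h]; exact (flatMap_finRange _).symm) (layerCost_le n t)

theorem emits_allReverse_gates (t : Template) (g : Fin n → List (Gate n (2 * n + 4)))
    (h : ∀ i, (g i).flatMap encodeGate = Template.expand t i) :
    Emits n (emitAllReverse t) (((List.finRange n).reverse.flatMap g).flatMap encodeGate)
      ((4 * t.length + 21) * (n + 1) ^ 2) :=
  (emits_allReverse n t).mono (by
    rw [List.flatMap_assoc]; simp only [h]; exact (flatMap_finRange_reverse _).symm)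
    (layerCost_le n t)

theorem emits_low_gates (t : Template) (g : Fin n → List (Gate n (2 * n + 4)))
    (h : ∀ i, (g i).flatMap encodeGate = Template.expand t i) :
    Emits n (emitLow t) (((lowItems n).flatMap g).flatMap encodeGate)
      ((4 * t.length + 21) * (n + 1) ^ 2) :=
  (emits_low n t).mono (by
    rw [List.flatMap_assoc]; simp only [h]; exact (flatMap_lowItems _).symm) (layerCost_le n t)

theorem emits_high_gates (t : Template) (g : Fin n → List (Gate n (2 * n + 4)))
    (h : ∀ i, (g i).flatMap encodeGate = Template.expand t i) :
    Emits n (emitHigh t) (((highItems n).flatMap g).flatMap encodeGate)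
      ((4 * t.length + 21) * (n + 1) ^ 2) :=
  (emits_high n t).mono (by
    rw [List.flatMap_assoc]; simp only [h]; exact (flatMap_highItems _).symm) (layerCost_le n t)

theorem emits_fixed_gates (t : Template) (l : List (Gate n (2 * n + 4)))
    (h : l.flatMap encodeGate = Template.expand t n) :
    Emits n (emitTemplate t) (l.flatMap encodeGate) ((4 * t.length) * (n + 1) ^ 2) :=
  h ▸ emits_template' t

theorem Emits.append_gates {c d : WCmd} {l l' : List (Gate n (2 * n + 4))} {B B' : ℕ}
    (h : Emits n c (l.flatMap encodeGate) (B * (n + 1) ^ 2))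
    (h' : Emits n d (l'.flatMap encodeGate) (B' * (n + 1) ^ 2)) :
    Emits n (.seq d c) ((l ++ l').flatMap encodeGate) ((B + B') * (n + 1) ^ 2) :=
  (h.append h').mono List.flatMap_append.symm (by ring_nf; exact le_rfl)

def emitQuery : WCmd :=
  .seq (.seq (emitTemplate [some .endNumber]) (emitAll (numberT 2)))
    (emitTemplate [some .query])

theorem emits_query :
    Emits n emitQuery ([queryGate n].flatMap encodeGate) (45 * (n + 1) ^ 2) := by
  have h := (emits_template' (n := n) [some .query]).append
    (((emits_all n (numberT 2)).mono rfl (layerCost_le n _)).append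
      (emits_template' (n := n) [some .endNumber]))
  refine h.mono ?_ ?_
  · simp only [List.flatMap_cons, List.flatMap_nil, List.append_nil, encodeGate, queryGate]
    rw [show (List.range n).flatMap (Template.expand (numberT 2)) =
      (List.ofFn fun i : Fin n => (item i)).flatMap
        (fun i : Fin (2 * n + 4) => encodeNumber (i : ℕ)) by
        rw [← flatMap_finRange, List.ofFn_eq_map, List.flatMap_map]
        simp [expand_numberT, item]]
    simp [Template.expand, flag, encodeNumber, List.flatMap_assoc]
  · simp only [length_numberT, List.length_cons, List.length_nil]
    ring_nf
    exact le_rfl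

theorem encode_hadamard_item (i : Fin n) :
    encodeGate (.hadamard (item i) : Gate n (2 * n + 4)) = Template.expand (gateT .hadamard 2) i :=
  (expand_gateT ..).symm

theorem encode_piEighth_item (i : Fin n) :
    encodeGate (.piEighth (item i) : Gate n (2 * n + 4)) = Template.expand (gateT .piEighth 2) i :=
  (expand_gateT ..).symm

theorem encode_not_item (i : Fin n) :
    encodeGate (.not (item i) : Gate n (2 * n + 4)) = Template.expand (gateT .not 2) i :=
  (expand_gateT ..).symm

/-- The offsets 1, 2, 3 belong to the ancilla before item bit `i`, the item bit itself and the next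
ancilla. -/
def ladderT : Template := some .toffoli :: (numberT 1 ++ numberT 2 ++ numberT 3)

theorem encode_ladder (i : Fin n) :
    [ladderGate i].flatMap encodeGate = Template.expand ladderT i := by
  simp only [ladderT, expand_cons_some, expand_append, expand_numberT]
  simp [encodeGate, ladderGate, anc, item]
  ring_nf

def emitGrover : WCmd :=
  .seq (emitAll (gateT .not 2 ++ gateT .hadamard 2))
    (.seq (emitAllReverse ladderT)
      (.seq (emitTemplate (some .cnot :: (numberT 1 ++ [some .endNumber])))
        (.seq (emitAll ladderT)
          (.seq (emitAll (gateT .hadamard 2 ++ gateT .not 2)) emitQuery))))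

theorem emits_grover :
    Emits n emitGrover ((groverCircuit n).flatMap encodeGate) (345 * (n + 1) ^ 2) := by
  unfold groverCircuit
  refine Emits.mono (B := (45 + _ + _ + _ + _ + _) * (n + 1) ^ 2) (Emits.append_gates
    (Emits.append_gates (Emits.append_gates (Emits.append_gates (Emits.append_gates emits_query
      (emits_all_gates (gateT .hadamard 2 ++ gateT .not 2) _ ?_))
      (emits_all_gates ladderT _ encode_ladder))
      (emits_fixed_gates (some .cnot :: (numberT 1 ++ [some .endNumber])) _ ?_))
      (emits_allReverse_gates ladderT _ encode_ladder))
      (emits_all_gates (gateT .not 2 ++ gateT .hadamard 2) _ ?_)) rfl ?_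
  · intro i
    simp [expand_append, encode_hadamard_item, encode_not_item]
  · simp only [expand_cons_some, expand_append, expand_numberT]
    simp [encodeGate, anc, flag, Template.expand, encodeNumber]
  · intro i
    simp [expand_append, encode_hadamard_item, encode_not_item]
  · simp only [ladderT, length_numberT, length_gateT, List.length_cons, List.length_append,
      List.length_nil]
    gcongr
    norm_num

end Search

end Histories

end

/-! ### Texts of the circuits and of the whole program. -/

noncomputable section

namespace Histories

namespace Search

variable {n : ℕ}

def emitGroverStart : WCmd :=
  .seq (.seq (emitTemplate [some .not, some .endNumber, some .hadamard, some .endNumber])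
      (emitAll (gateT .hadamard 2)))
    (emitTemplate [some .not, some .tick, some .endNumber])

theorem emits_groverStart :
    Emits n emitGroverStart ((groverStart n).flatMap encodeGate) (69 * (n + 1) ^ 2) := by
  unfold groverStart
  rw [List.append_assoc]
  refine Emits.mono (B := (_ + (_ + _)) * (n + 1) ^ 2) (Emits.append_gates
    (emits_fixed_gates [some .not, some .tick, some .endNumber] _ ?_)
    (Emits.append_gates (emits_all_gates (gateT .hadamard 2) _ ?_)
      (emits_fixed_gates [some .not, some .endNumber, some .hadamard, some .endNumber] _ ?_)))
    rfl ?_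
  · simp [encodeGate, anc, Template.expand, encodeNumber]
  · intro i
    simp [encode_hadamard_item]
  · simp [encodeGate, flag, Template.expand, encodeNumber]
  · simp only [length_gateT, List.length_cons, List.length_nil]
    gcongr

def controlledHadamardT : Template :=
  (List.replicate 6 (gateT .piEighth 2)).flatten ++ gateT .hadamard 2 ++
    (List.replicate 7 (gateT .piEighth 2)).flatten ++
    some .cnot :: some .endNumber :: numberT 2 ++ gateT .piEighth 2 ++ gateT .hadamard 2 ++
    gateT .piEighth 2 ++ gateT .piEighth 2 ++ gateT .hadamard 2

theorem encode_controlledHadamard (i : Fin n) :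
    (controlledHadamard i).flatMap encodeGate = Template.expand controlledHadamardT i := by
  have h : ∀ k, (List.replicate k (.piEighth (item i) : Gate n (2 * n + 4))).flatMap encodeGate =
      Template.expand (List.replicate k (gateT .piEighth 2)).flatten i := by
    intro k
    induction k with
    | zero => simp [Template.expand]
    | succ k ih =>
      rw [List.replicate_succ, List.flatMap_cons, ih, List.replicate_succ, List.flatten_cons,
        expand_append, encode_piEighth_item]
  have hc : encodeGate (.cnot (flag n) (item i) (by simp) : Gate n (2 * n + 4)) =
      Template.expand (some .cnot :: some .endNumber :: numberT 2) i := by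
    simp [expand_cons_some, expand_numberT, encodeGate, item, flag, encodeNumber]
  simp only [controlledHadamard, List.flatMap_append, h, List.flatMap_cons, List.flatMap_nil,
    encode_hadamard_item, encode_piEighth_item, hc, controlledHadamardT, expand_append,
    List.append_nil, List.append_assoc]

def emitGroverEnd : WCmd :=
  .seq (emitHigh controlledHadamardT)
    (.seq emitQuery (emitTemplate [some .hadamard, some .endNumber, some .not, some .endNumber]))

theorem emits_groverEnd :
    Emits n emitGroverEnd ((groverEnd n).flatMap encodeGate) (486 * (n + 1) ^ 2) := by
  unfold groverEnd
  refine Emits.mono (B := (_ + 45 + _) * (n + 1) ^ 2) (Emits.append_gates (Emits.append_gates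
    (l := [.hadamard (flag n), .not (flag n)])
    (emits_fixed_gates [some .hadamard, some .endNumber, some .not, some .endNumber] _ ?_)
    emits_query) (emits_high_gates controlledHadamardT _ encode_controlledHadamard)) rfl ?_
  · simp [encodeGate, flag, Template.expand, encodeNumber]
  · have : List.length controlledHadamardT = 101 := by
      simp [controlledHadamardT, length_gateT, length_numberT]
    rw [this]
    simp only [List.length_cons, List.length_nil]
    gcongr

/-- The text of a sequence of circuits. -/
def circuitsText (l : List (List (Gate n (2 * n + 4)))) : List Sym :=
  l.flatMap fun c => c.flatMap encodeGate ++ [.endCircuit]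

/-- Write a further circuit. -/
def consCircuit (c d : WCmd) : WCmd := .seq d (.seq (emitTemplate [some .endCircuit]) c)

theorem emits_consCircuit {c d : WCmd} {l : List (Gate n (2 * n + 4))}
    {L : List (List (Gate n (2 * n + 4)))} {B B' : ℕ}
    (h : Emits n c (l.flatMap encodeGate) (B * (n + 1) ^ 2))
    (h' : Emits n d (circuitsText L) (B' * (n + 1) ^ 2)) :
    Emits n (consCircuit c d) (circuitsText (l :: L)) ((B + 4 + B') * (n + 1) ^ 2) := by
  have := (h.append (emits_template' [some .endCircuit])).append h'
  refine this.mono ?_ ?_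
  · simp [circuitsText, Template.expand]
  · simp only [List.length_cons, List.length_nil]
    ring_nf
    exact le_rfl

theorem emits_nil : Emits n .skip (circuitsText (n := n) []) (0 * (n + 1) ^ 2) := fun r o _ =>
  (StackCmd.runsIn_skip (conf r o)).mono (Nat.zero_le _)

def flagHadamardT : Template := [some .hadamard, some .endNumber]

def markT : Template := some .cnot :: some .endNumber :: numberT 2

theorem encode_flagHadamard :
    (flagHadamard n).flatMap encodeGate = Template.expand flagHadamardT n := by
  simp [flagHadamard, flagHadamardT, encodeGate, flag, Template.expand, encodeNumber]

theorem encode_markCircuit : (markCircuit n).flatMap encodeGate = Template.expand markT n := by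
  simp [markT, markCircuit, expand_cons_some, expand_numberT, encodeGate, mark, flag, encodeNumber]

def emitCycle : WCmd :=
  consCircuit (emitLow (gateT .hadamard 2)) <| consCircuit (emitLow (gateT .hadamard 2)) <|
  consCircuit (emitHigh (gateT .hadamard 2)) <| consCircuit (emitTemplate flagHadamardT) <|
  consCircuit (emitTemplate flagHadamardT) <| consCircuit (emitHigh (gateT .hadamard 2)) <|
  consCircuit (emitTemplate markT) <| consCircuit (emitTemplate markT) .skip

theorem emits_cycle :
    Emits n emitCycle (circuitsText (cycle n)) (260 * (n + 1) ^ 2) := by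
  have hg : ∀ i : Fin n, [(.hadamard (item i) : Gate n (2 * n + 4))].flatMap encodeGate =
      Template.expand (gateT .hadamard 2) i := fun i => by simp [encode_hadamard_item]
  refine Emits.mono (B := _ * (n + 1) ^ 2) (
    emits_consCircuit (emits_low_gates (gateT .hadamard 2) _ hg) <|
    emits_consCircuit (emits_low_gates (gateT .hadamard 2) _ hg) <|
    emits_consCircuit (emits_high_gates (gateT .hadamard 2) _ hg) <|
    emits_consCircuit (emits_fixed_gates flagHadamardT _ encode_flagHadamard) <|
    emits_consCircuit (emits_fixed_gates flagHadamardT _ encode_flagHadamard) <|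
    emits_consCircuit (emits_high_gates (gateT .hadamard 2) _ hg) <|
    emits_consCircuit (emits_fixed_gates markT _ encode_markCircuit) <|
    emits_consCircuit (emits_fixed_gates markT _ encode_markCircuit) emits_nil) rfl ?_
  simp only [flagHadamardT, markT, length_gateT, length_numberT, List.length_cons, List.length_nil]
  gcongr

/-- Repeat a command a fixed number of times. -/
def times (c : WCmd) : ℕ → WCmd
  | 0 => .skip
  | k + 1 => .seq (times c k) c

theorem emits_times {c : WCmd} {w : List Sym} {B : ℕ} (h : Emits n c w B) (k : ℕ) :
    Emits n (times c k) (List.replicate k w).flatten (k * B) := by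
  induction k with
  | zero =>
    intro r o _
    simpa [times] using StackCmd.runsIn_skip (conf r o)
  | succ k ih =>
    exact (h.append ih).mono (by simp [List.replicate_succ]) (by ring_nf; exact le_rfl)

/-- The outer repetition has its own backup counter `pow'`, since the loops inside `c` expect `save`
to be empty. -/
theorem runsIn_rep_pow {c : WCmd} {w : List Sym} {B : ℕ} (h : Emits n c w B) (r : Counter → ℕ)
    (o : List Sym) (hr : Ready n r) (h0 : r .pow' = 0) :
    StackCmd.RunsIn (rep .pow .pow' c) (conf r o)
      (conf r ((List.replicate (r .pow) w).flatten ++ o)) (r .pow * (B + 4) + 2) := by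
  have key := runsIn_rep (k := .pow) (sv := .pow') (d := c) (by decide) (by decide) (by decide) r
    (fun _ => n) (fun j => (List.replicate j w).flatten ++ o) (B := B) (r .pow) rfl h0
    (fun j _ u v => by
      rw [List.replicate_succ, List.flatten_cons, List.append_assoc]
      refine h _ _ ⟨?_, ?_, ?_, ?_, ?_, ?_⟩ <;>
        simp [hr.b, hr.a, hr.tick, hr.save, hr.n])
  have : Function.update r .idx n = r := by
    funext c
    by_cases hc : c = .idx
    · subst hc; simp [hr.idx]
    · simp [hc]
  simpa [this] using key

/-- Written from the end of the text to its beginning: the cycles, the first circuit backwards, and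
finally the number of qubits. -/
def emitProgram : WCmd :=
  .seq (rep .pow .pow' (times emitCycle 32)) <|
  .seq (emitTemplate [some .endCircuit]) <|
  .seq emitGroverEnd <|
  .seq (rep .pow .pow' emitGrover) <|
  .seq emitGroverStart (emitTemplate (numberT 4))

theorem flatten_replicate_mul {α : Type} (a b : ℕ) (w : List α) :
    (List.replicate b (List.replicate a w).flatten).flatten = (List.replicate (a * b) w).flatten := by
  induction b with
  | zero => simp
  | succ b ih =>
    rw [List.replicate_succ, List.flatten_cons, ih, Nat.mul_succ, Nat.add_comm,
      List.replicate_add, List.flatten_append]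

theorem flatMap_flatten_replicate {α β : Type} (k : ℕ) (l : List α) (f : α → List β) :
    (List.replicate k l).flatten.flatMap f = (List.replicate k (l.flatMap f)).flatten := by
  induction k with
  | zero => rfl
  | succ k ih => simp [List.replicate_succ, ih]

theorem runsIn_emitProgram (r : Counter → ℕ) (hr : Ready n r) (h0 : r .pow' = 0)
    (hp : r .pow = 2 ^ (n / 3)) :
    StackCmd.RunsIn emitProgram (conf r []) (conf r (encodeProgram (program n)))
      (9300 * (2 ^ (n / 3) * (n + 1) ^ 2)) := by
  have h := (runsIn_rep_pow (emits_times (emits_cycle (n := n)) 32) r [] hr h0).seq <|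
    (emits_template' [some .endCircuit] r _ hr).seq <|
    (emits_groverEnd r _ hr).seq <|
    (runsIn_rep_pow (emits_grover (n := n)) r _ hr h0).seq <|
    (emits_groverStart r _ hr).seq (emits_template' (numberT 4) r _ hr)
  have hw : encodeProgram (program n) = Template.expand (numberT 4) n ++
      ((groverStart n).flatMap encodeGate ++
      ((List.replicate (r .pow) ((groverCircuit n).flatMap encodeGate)).flatten ++
      ((groverEnd n).flatMap encodeGate ++ (Template.expand [some .endCircuit] n ++
      ((List.replicate (r .pow) (List.replicate 32 (circuitsText (cycle n))).flatten).flatten ++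
        []))))) := by
    rw [flatten_replicate_mul, hp]
    unfold encodeProgram program prepCircuit circuitsText
    simp only [List.flatMap_cons, List.flatMap_append, flatMap_flatten_replicate,
      List.append_assoc, List.append_nil]
    congr 1
    exact (expand_numberT 4 n).symm
  rw [hw]
  refine StackCmd.RunsIn.mono h ?_
  rw [hp, length_numberT]
  simp only [List.length_cons, List.length_nil]
  have h1 : 1 ≤ 2 ^ (n / 3) := Nat.one_le_two_pow
  have h2 : 1 ≤ (n + 1) ^ 2 := Nat.one_le_pow _ _ (by omega)
  nlinarith [Nat.mul_le_mul h1 h2, Nat.mul_le_mul_left (2 ^ (n / 3)) h2,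
    Nat.mul_le_mul_right ((n + 1) ^ 2) h1]

end Search

end Histories

end

/-! ### Counter arithmetic and the complete writing machine. -/

noncomputable section

namespace Histories

namespace Search

/-- Counter values. -/
def regs (inp n b a idx save pow pow' : ℕ) : Counter → ℕ
  | .inp => inp
  | .n => n
  | .b => b
  | .a => a
  | .idx => idx
  | .tick => 0
  | .save => save
  | .pow => pow
  | .pow' => pow'

def readInput : WCmd :=
  drain .inp (.seq (inc .n) (.seq (inc .idx) (.seq (inc .a) (inc .save))))

theorem runsIn_readInput (n : ℕ) :
    StackCmd.RunsIn readInput (conf (regs n 0 0 0 0 0 0 0) []) (conf (regs 0 n 0 n n n 0 0) [])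
      (n * 2 + 1) := by
  have h := runsIn_drain (c := .inp) (d := .seq (inc .n) (.seq (inc .idx) (.seq (inc .a)
    (inc .save)))) (B := 0) (fun j => regs (n - j) j 0 j j j 0 0) (fun _ => []) n
    (fun _ _ => rfl) (fun j _ => by
      refine StackCmd.RunsIn.seq (B := 0) (B' := 0) (runsIn_inc _ _ _) <|
        StackCmd.RunsIn.seq (B := 0) (B' := 0) (runsIn_inc _ _ _) <|
        StackCmd.RunsIn.seq (B := 0) (B' := 0) (runsIn_inc _ _ _) ?_
      convert runsIn_inc _ _ _ using 2
      funext c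
      cases c <;> simp [regs])
  simpa [readInput] using h

def double : WCmd :=
  .seq (drain .pow (.seq (inc .pow') (inc .pow'))) (drain .pow' (inc .pow))

theorem runsIn_double (n b a i s p : ℕ) :
    StackCmd.RunsIn double (conf (regs 0 n b a i s p 0) []) (conf (regs 0 n b a i s (2 * p) 0) [])
      (6 * p + 2) := by
  have h := runsIn_drain (c := .pow) (d := .seq (inc .pow') (inc .pow')) (B := 0)
    (fun j => regs 0 n b a i s (p - j) (2 * j)) (fun _ => []) p (fun _ _ => rfl) (fun j _ => by
      refine StackCmd.RunsIn.seq (B := 0) (B' := 0) (runsIn_inc _ _ _) ?_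
      convert runsIn_inc _ _ _ using 2
      funext c
      cases c <;> simp [regs]; ring)
  have h' := runsIn_drain (c := .pow') (d := inc .pow) (B := 0)
    (fun j => regs 0 n b a i s j (2 * p - j)) (fun _ => []) (2 * p) (fun _ _ => rfl)
    (fun j _ => by
      convert runsIn_inc _ _ _ using 2
      funext c
      cases c <;> simp [regs])
  have h2 : StackCmd.RunsIn double _ _ _ := StackCmd.RunsIn.seq h (by simpa using h')
  exact StackCmd.RunsIn.mono (by simpa using h2) (by ring_nf; exact le_rfl)

/-- Divide the counter `save` by `3`, rounding up, and double `pow` as many times. -/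
def divide : WCmd :=
  drain .save (.seq (dec .save) (.seq (dec .save) (.seq (inc .b) (.seq (inc .b)
    (.seq (dec .a) (.seq (dec .a) double))))))

/-- Each round removes three units from `save`, or whatever is left of it, because decrementing 0
has no effect; this is what rounds up. `P` bounds the power of two in all rounds, so that one cost
estimate serves for each. -/
theorem runsIn_divide (n i P : ℕ) : ∀ k s b a p : ℕ, (s + 2) / 3 = k → p * 2 ^ k ≤ P →
    StackCmd.RunsIn divide (conf (regs 0 n b a i s p 0) [])
      (conf (regs 0 n (b + 2 * k) (a - 2 * k) i 0 (p * 2 ^ k) 0) []) (k * (6 * P + 8) + 1) := by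
  intro k
  induction k with
  | zero =>
    intro s b a p hs _
    obtain rfl : s = 0 := by omega
    simpa [divide] using runsIn_drain_zero rfl
  | succ k ih =>
    intro s b a p hs hp
    obtain ⟨s, rfl⟩ : ∃ s', s = s' + 1 := ⟨s - 1, by omega⟩
    have h1 : (s - 1 - 1 + 2) / 3 = k := by omega
    have hp' : 2 * p * 2 ^ k = p * 2 ^ (k + 1) := by ring
    have h2 := ih (s - 1 - 1) (b + 1 + 1) (a - 1 - 1) (2 * p) h1 (hp'.le.trans hp)
    have hpP : p ≤ P := (Nat.le_mul_of_pos_right p (by positivity)).trans hp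
    refine StackCmd.RunsIn.mono (runsIn_drain_succ (x := s)
      (r' := regs 0 n (b + 1 + 1) (a - 1 - 1) i (s - 1 - 1) (2 * p) 0) (o' := [])
      (B := 1 + (1 + (0 + (0 + (1 + (1 + (6 * p + 2))))))) rfl ?_ ?_)
      (B := 1 + (1 + (0 + (0 + (1 + (1 + (6 * p + 2)))))) + 2 + (k * (6 * P + 8) + 1))
      (by nlinarith)
    · refine (runsIn_dec _ _ _).seq <| (runsIn_dec _ _ _).seq <| (runsIn_inc _ _ _).seq <|
        (runsIn_inc _ _ _).seq <| (runsIn_dec _ _ _).seq <| (runsIn_dec _ _ _).seq ?_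
      convert runsIn_double n (b + 1 + 1) (a - 1 - 1) i (s - 1 - 1) p using 2
      funext c
      cases c <;> simp [regs]
    · convert h2 using 3
      · rfl
      · omega
      · omega
      · exact hp'.symm

def clear (c : Counter) : WCmd := drain c .skip

theorem runsIn_clear (c : Counter) (r : Counter → ℕ) (o : List Sym) :
    StackCmd.RunsIn (clear c) (conf r o) (conf (Function.update r c 0) o) (r c * 2 + 1) := by
  have h := runsIn_drain (c := c) (d := .skip) (B := 0)
    (fun j => Function.update r c (r c - j)) (fun _ => o) (r c) (fun _ _ => by simp)
    (fun j _ => by simpa using StackCmd.runsIn_skip _)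
  simpa [clear] using h

/-- Decrementing `save` twice before the division turns rounding up into rounding down, since ⌈(n -
2)/3⌉ = ⌊n/3⌋ with truncated subtraction. The counters are cleared at the end because only the
output stack may be nonempty on halting. -/
def writerCmd : WCmd :=
  .seq readInput <| .seq (inc .pow) <| .seq (dec .save) <| .seq (dec .save) <| .seq divide <|
  .seq emitProgram <| .seq (clear .n) <| .seq (clear .b) <| .seq (clear .a) <|
  .seq (clear .idx) (clear .pow)

def writeTime (n : ℕ) : ℕ := 9400 * (2 ^ (n / 3) * (n + 1) ^ 2)

/-- One unit of `writeTime` is kept back for the step that enters the command. -/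
theorem runsIn_writer (n : ℕ) :
    StackCmd.RunsIn writerCmd (conf (regs n 0 0 0 0 0 0 0) [])
      (conf (regs 0 0 0 0 0 0 0 0) (encodeProgram (program n))) (writeTime n - 1) := by
  have hdiv := runsIn_divide n n (2 ^ (n / 3)) (n / 3) (n - 1 - 1) 0 n 1 (by omega) (by simp)
  have hready : Ready n (regs 0 n (0 + 2 * (n / 3)) (n - 2 * (n / 3)) n 0 (1 * 2 ^ (n / 3)) 0) :=
    ⟨by simp [regs], rfl, rfl, rfl, rfl, rfl⟩
  have hmain := runsIn_emitProgram _ hready rfl (by simp [regs])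
  have h := (runsIn_readInput n).seq <| (runsIn_inc _ _ .pow).seq <|
    (runsIn_dec _ _ .save).seq <| (runsIn_dec _ _ .save).seq <|
    StackCmd.RunsIn.seq (c := divide) (B := n / 3 * (6 * 2 ^ (n / 3) + 8) + 1)
      (t := conf (regs 0 n (0 + 2 * (n / 3)) (n - 2 * (n / 3)) n 0 (1 * 2 ^ (n / 3)) 0) [])
      (by
        convert hdiv using 2
        funext c
        cases c <;> simp [regs]) <|
    hmain.seq <| (runsIn_clear .n _ _).seq <| (runsIn_clear .b _ _).seq <|
    (runsIn_clear .a _ _).seq <| (runsIn_clear .idx _ _).seq <| runsIn_clear .pow _ _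
  refine StackCmd.RunsIn.mono (t := conf (regs 0 0 0 0 0 0 0 0) (encodeProgram (program n))) ?_ ?_
    (B := ?_)
  rotate_left
  · unfold writerCmd
    convert h using 2
    funext c
    cases c <;> simp [regs]
  · simp only [regs, Function.update_apply]
    simp only [reduceCtorEq, if_false]
    have h1 : 1 ≤ 2 ^ (n / 3) := Nat.one_le_two_pow
    have h2 : n + 1 ≤ (n + 1) ^ 2 := by nlinarith
    have h3 : n / 3 ≤ n := Nat.div_le_self _ _
    have h4 : 2 ^ (n / 3) * (n + 1) ≤ 2 ^ (n / 3) * (n + 1) ^ 2 := Nat.mul_le_mul_left _ h2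
    have h5 : 1 * (n + 1) ≤ 2 ^ (n / 3) * (n + 1) := Nat.mul_le_mul_right _ h1
    have h6 : 2 ^ (n / 3) * (n / 3) ≤ 2 ^ (n / 3) * n := Nat.mul_le_mul_left _ h3
    have h7 : n / 3 * (6 * 2 ^ (n / 3) + 8) = 6 * (2 ^ (n / 3) * (n / 3)) + 8 * (n / 3) := by ring
    have h8 : 2 ^ (n / 3) * (n + 1) = 2 ^ (n / 3) * n + 2 ^ (n / 3) := by ring
    rw [h7]
    unfold writeTime
    generalize 2 ^ (n / 3) * (n + 1) ^ 2 = Z at *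
    generalize 2 ^ (n / 3) * (n / 3) = Y at *
    generalize 2 ^ (n / 3) * n = W at *
    omega

/-- The machine that writes the program down. -/
def writer : TM2ComputableInTime unaryEncodeNat id fun n => encodeProgram (program n) where
  tm := writerCmd.machine (some .inp) none
  inputAlphabet := Equiv.refl Bool
  outputAlphabet := Equiv.refl Sym
  time := writeTime
  outputsFun n := by
    have h := runsIn_writer n
    have h1 : ∀ n, conf (regs n 0 0 0 0 0 0 0) [] =
        StackCmd.single (some Counter.inp) (List.replicate n true) := by
      intro n
      funext k
      rcases k with _ | k
      · rfl
      · cases k <;> simp [StackCmd.single, conf, regs]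
    have h2 : ∀ o, conf (regs 0 0 0 0 0 0 0 0) o =
        StackCmd.single (none : Option Counter) o := by
      intro o
      funext k
      rcases k with _ | k
      · simp [StackCmd.single, conf]
      · cases k <;> simp [StackCmd.single, conf, regs]
    rw [h1, h2] at h
    have h3 : ∀ n, unaryEncodeNat n = List.replicate n true := by
      intro n
      induction n with
      | zero => rfl
      | succ n ih => rw [unaryEncodeNat, ih, List.replicate_succ]
    have h4 : 1 ≤ writeTime n :=
      Nat.mul_pos (by norm_num) (Nat.mul_pos (by positivity) (by positivity))
    have h5 : (unaryEncodeNat n).length = n := by simp [h3]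
    have h6 := StackCmd.outputsInTime h
    rw [Nat.sub_add_cancel h4] at h6
    rw [h5, h3]
    simp only [Equiv.invFun_as_coe, Equiv.refl_symm, Equiv.coe_refl]
    have e : ∀ (α : Type) (l : List α), List.map id l = l := fun _ => List.map_id
    exact cast (congrArg₂ (fun a b => TM2OutputsInTime _ a (some b) _) (e _ _).symm
      (e _ _).symm) h6

theorem time_writer (n : ℕ) : writer.time n = 9400 * (2 ^ (n / 3) * (n + 1) ^ 2) := rfl

end Search

end Histories

end

noncomputable section

namespace Histories

namespace Search

/-! ### The machine that reads the history -/

/-- The stacks of the reading machine. -/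
inductive RStack : Type
  | inp | out | tmp
  deriving DecidableEq

instance : Fintype RStack := Fintype.ofList [.inp, .out, .tmp] (by rintro ⟨⟩ <;> simp)

@[reducible] def RAlphabet : RStack → Type
  | .inp => Option Bool
  | _ => Bool

instance : ∀ k, Fintype (RAlphabet k)
  | .inp => inferInstanceAs (Fintype (Option Bool))
  | .out => inferInstanceAs (Fintype Bool)
  | .tmp => inferInstanceAs (Fintype Bool)

abbrev RCmd : Type := StackCmd RAlphabet

def rconf (i : List (Option Bool)) (t o : List Bool) : ∀ k, List (RAlphabet k)
  | .inp => i
  | .out => o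
  | .tmp => t

theorem update_rconf_inp (i i' : List (Option Bool)) (t o : List Bool) :
    Function.update (rconf i t o) .inp i' = rconf i' t o := by
  funext k; cases k <;> simp [rconf]

theorem update_rconf_tmp (i : List (Option Bool)) (t t' o : List Bool) :
    Function.update (rconf i t o) .tmp t' = rconf i t' o := by
  funext k; cases k <;> simp [rconf]

theorem update_rconf_out (i : List (Option Bool)) (t o o' : List Bool) :
    Function.update (rconf i t o) .out o' = rconf i t o' := by
  funext k; cases k <;> simp [rconf]

/-- Write every second symbol of `tmp` to the output. -/
def readPairs : RCmd :=
  .loop .tmp fun _ => .case .tmp fun b => b.elim .skip fun b => .push .out b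

/-- Any earlier answer is discarded. The pairs pair the flag with ancilla 0 and each item bit with
the next ancilla, so `readPairs` also puts the flag on top of the item bits; the final pop removes
it. -/
def readAnswer : RCmd :=
  .seq (.loop .out fun _ => .skip) (.seq readPairs (.case .out fun _ => .skip))

/-- Process a history entry. -/
def readEntry : RCmd :=
  .case .tmp fun z => if z = some false then
      .case .tmp fun g => if g = some true then readAnswer else .loop .tmp fun _ => .skip
    else .loop .tmp fun _ => .skip

/-- The input `1ⁿ` at the front is handled like a history entry. It is rejected because its last
symbol is not `0`, whereas the pad qubit ends every proper entry with `0`; this is the purpose of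
that qubit. -/
def readerCmd : RCmd :=
  .loop .inp fun s => s.elim readEntry fun b => .push .tmp b

theorem runsIn_clear_tmp (i : List (Option Bool)) (t o : List Bool) :
    StackCmd.RunsIn (.loop RStack.tmp fun _ => .skip : RCmd) (rconf i t o) (rconf i [] o)
      (t.length * 2 + 1) := by
  induction t with
  | nil => exact StackCmd.runsIn_loop_nil rfl
  | cons b t ih =>
    refine StackCmd.RunsIn.mono (StackCmd.RunsIn.loop_cons (k := RStack.tmp) (a := b) (l := t) rfl
      (StackCmd.runsIn_skip _) ?_) (B := 0 + 2 + (t.length * 2 + 1))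
      (by simp only [List.length_cons]; omega)
    rwa [update_rconf_tmp]

theorem runsIn_clear_out (i : List (Option Bool)) (t o : List Bool) :
    StackCmd.RunsIn (.loop RStack.out fun _ => .skip : RCmd) (rconf i t o) (rconf i t [])
      (o.length * 2 + 1) := by
  induction o with
  | nil => exact StackCmd.runsIn_loop_nil rfl
  | cons b o ih =>
    refine StackCmd.RunsIn.mono (StackCmd.RunsIn.loop_cons (k := RStack.out) (a := b) (l := o) rfl
      (StackCmd.runsIn_skip _) ?_) (B := 0 + 2 + (o.length * 2 + 1))
      (by simp only [List.length_cons]; omega)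
    rwa [update_rconf_out]

theorem runsIn_readPairs (i : List (Option Bool)) (u : ℕ → Bool) (k : ℕ) (o : List Bool) :
    StackCmd.RunsIn readPairs (rconf i ((List.range (2 * k)).map u).reverse o)
      (rconf i [] ((List.range k).map (fun j => u (2 * j)) ++ o)) (k * 3 + 1) := by
  induction k generalizing o with
  | zero => exact StackCmd.runsIn_loop_nil rfl
  | succ k ih =>
    have h : ((List.range (2 * (k + 1))).map u).reverse =
        u (2 * k + 1) :: u (2 * k) :: ((List.range (2 * k)).map u).reverse := by
      rw [show 2 * (k + 1) = 2 * k + 1 + 1 by ring, List.range_succ, List.range_succ]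
      simp
    rw [h]
    refine StackCmd.RunsIn.mono (StackCmd.RunsIn.loop_cons (k := RStack.tmp) (a := u (2 * k + 1))
      (l := u (2 * k) :: ((List.range (2 * k)).map u).reverse) rfl
      (t := rconf i ((List.range (2 * k)).map u).reverse (u (2 * k) :: o)) (B := 0 + 1)
      (StackCmd.RunsIn.case ?_) ?_)
      (B := 0 + 1 + 2 + (k * 3 + 1)) (by omega)
    · rw [update_rconf_tmp]
      have := StackCmd.runsIn_push (Γ := RAlphabet) .out (u (2 * k))
        (rconf i ((List.range (2 * k)).map u).reverse o)
      rw [update_rconf_out] at this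
      simpa [rconf, update_rconf_tmp] using this
    · have := ih (u (2 * k) :: o)
      rw [List.range_succ]
      simpa [readPairs] using this

/-- The answer after a further history entry. -/
def readStep {n : ℕ} (o : List Bool) (v : Bits (2 * n + 4)) : List Bool :=
  if v (mark n) = true ∧ v (pad n) = false then List.ofFn fun i => v (item i) else o

theorem runsIn_readEntry {n : ℕ} (i : List (Option Bool)) (o : List Bool) (ho : o.length ≤ n)
    (v : Bits (2 * n + 4)) :
    StackCmd.RunsIn readEntry (rconf i (List.ofFn v).reverse o) (rconf i [] (readStep o v))
      (5 * n + 9) := by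
  set u : ℕ → Bool := fun j => if h : j < 2 * n + 4 then v ⟨j, h⟩ else false with hu
  -- The entry was pushed bit by bit and lies reversed on the stack, so the two qubits to be tested
  -- are on top.
  have hv : (List.ofFn v).reverse = v (pad n) :: v (mark n) ::
      ((List.range (2 * (n + 1))).map u).reverse := by
    have h1 : List.ofFn v = (List.range (2 * n + 4)).map u := by
      refine List.ext_getElem (by simp) fun j h1 h2 => ?_
      have : j < 2 * n + 4 := by rwa [List.length_ofFn] at h1
      rw [List.getElem_ofFn, List.getElem_map, List.getElem_range, hu]
      simp [this]
    rw [h1, show 2 * n + 4 = 2 * (n + 1) + 1 + 1 by ring, List.range_succ, List.range_succ]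
    simp [hu, mark, pad, mul_add]
  rw [hv]
  -- The bits at even positions are the flag followed by the item bits.
  have hans : (List.ofFn fun i => v (item i)) =
      ((List.range (n + 1)).map (fun j => u (2 * j))).tail := by
    refine List.ext_getElem (by simp) fun j h1 h2 => ?_
    have : j < n := by simpa using h1
    simp only [hu, List.getElem_ofFn, List.getElem_tail, List.getElem_map, List.getElem_range, item]
    rw [dif_pos (by omega)]
    congr 1
  have hlen : ((List.range (2 * (n + 1))).map u).reverse.length = 2 * (n + 1) := by simp
  refine StackCmd.RunsIn.case (B := 5 * n + 8) ?_
  rw [update_rconf_tmp]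
  simp only [rconf, List.head?_cons, List.tail_cons, Option.some.injEq, readStep]
  by_cases hz : v (pad n) = false
  · simp only [hz, if_true, and_true]
    refine StackCmd.RunsIn.case (B := 5 * n + 7) ?_
    rw [update_rconf_tmp]
    simp only [rconf, List.head?_cons, List.tail_cons, Option.some.injEq]
    by_cases hg : v (mark n) = true
    · simp only [hg, if_true]
      refine StackCmd.RunsIn.mono ((runsIn_clear_out _ _ _).seq
        ((runsIn_readPairs i u (n + 1) []).seq (StackCmd.RunsIn.case (B := 0) ?_))) (by omega)
      rw [update_rconf_out, hans]
      simpa [rconf] using StackCmd.runsIn_skip _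
    · simp only [hg, if_false, Bool.false_eq_true]
      exact (runsIn_clear_tmp _ _ _).mono (by rw [hlen]; omega)
  · simp only [hz, if_false, and_false, Bool.true_eq_false]
    refine (runsIn_clear_tmp _ _ _).mono ?_
    rw [List.length_cons, hlen]; omega

theorem runsIn_readBits {w : List Bool} {i : List (Option Bool)} {t o : List Bool}
    {T : ∀ k, List (RAlphabet k)} {B : ℕ}
    (h : StackCmd.RunsIn readerCmd (rconf i (w.reverse ++ t) o) T B) :
    StackCmd.RunsIn readerCmd (rconf (w.map some ++ i) t o) T (w.length * 2 + B) := by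
  induction w generalizing t with
  | nil => simpa using h
  | cons b w ih =>
    refine StackCmd.RunsIn.mono (StackCmd.RunsIn.loop_cons (k := RStack.inp) (a := some b)
      (l := w.map some ++ i) rfl (t := rconf (w.map some ++ i) (b :: t) o) (B := 0) ?_
      (ih (by simpa using h))) (by simp only [List.length_cons]; omega)
    rw [update_rconf_inp]
    have := StackCmd.runsIn_push (Γ := RAlphabet) .tmp b (rconf (w.map some ++ i) t o)
    rwa [update_rconf_tmp] at this

theorem length_readStep {n : ℕ} {o : List Bool} (ho : o.length ≤ n) (v : Bits (2 * n + 4)) :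
    (readStep o v).length ≤ n := by
  unfold readStep
  split_ifs
  · simp
  · exact ho

theorem runsIn_readHistory {n : ℕ} (H : List (Bits (2 * n + 4))) (o : List Bool)
    (ho : o.length ≤ n) :
    StackCmd.RunsIn readerCmd
      (rconf (H.flatMap fun v => (List.ofFn v).map some ++ [none]) [] o)
      (rconf [] [] (H.foldl readStep o)) (H.length * (9 * n + 19) + 1) := by
  induction H generalizing o with
  | nil =>
    unfold readerCmd
    exact (StackCmd.runsIn_loop_nil rfl).mono (by simp)
  | cons v H ih =>
    have h1 := ih (readStep o v) (length_readStep ho v)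
    set rest := H.flatMap fun v => (List.ofFn v).map some ++ [none] with hrest
    have h2 : StackCmd.RunsIn readerCmd (rconf (none :: rest) (List.ofFn v).reverse o)
        (rconf [] [] (H.foldl readStep (readStep o v)))
        (5 * n + 9 + 2 + (H.length * (9 * n + 19) + 1)) := by
      unfold readerCmd at h1 ⊢
      refine StackCmd.RunsIn.loop_cons (k := RStack.inp) (a := none) (l := rest) rfl ?_ h1
      rw [update_rconf_inp]
      exact runsIn_readEntry rest o ho v
    have h3 := runsIn_readBits (w := List.ofFn v) (t := []) (by rwa [List.append_nil])
    rw [List.flatMap_cons, List.append_assoc, List.singleton_append, List.foldl_cons]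
    refine h3.mono ?_
    simp only [List.length_ofFn, List.length_cons]
    ring_nf
    omega

/-- The answer computed from a history: the item named by the last marked entry. -/
def answer (p : Σ n, (program n).History) : List Bool :=
  (List.ofFn p.2).foldl (readStep (n := p.1)) []

theorem runsIn_reader (p : Σ n, (program n).History) :
    StackCmd.RunsIn readerCmd (rconf (encodeResponse program p) [] []) (rconf [] [] (answer p))
      (10 * (encodeResponse program p).length) := by
  obtain ⟨n, H⟩ := p
  have h1 := runsIn_readHistory (List.ofFn H) [] (Nat.zero_le n)
  set rest := (List.ofFn H).flatMap fun v => (List.ofFn v).map some ++ [none] with hrest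
  have h2 : StackCmd.RunsIn readerCmd (rconf (none :: rest) (List.replicate n true) [])
      (rconf [] [] (answer ⟨n, H⟩))
      (2 * n + 2 + 2 + ((List.ofFn H).length * (9 * n + 19) + 1)) := by
    unfold readerCmd at h1 ⊢
    refine StackCmd.RunsIn.loop_cons (k := RStack.inp) (a := none) (l := rest) rfl ?_ h1
    rw [update_rconf_inp]
    refine StackCmd.RunsIn.case (B := 2 * n + 1) ?_
    rw [update_rconf_tmp]
    -- The prefix `1ⁿ` fails the test on the pad symbol, also when it is empty.
    have h3 : (List.replicate n true).head? ≠ some false := by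
      cases n <;> simp [List.replicate_succ]
    simp only [rconf, h3, if_false]
    refine (runsIn_clear_tmp _ _ _).mono ?_
    simp only [List.length_tail, List.length_replicate]
    omega
  have h3 := runsIn_readBits (w := List.replicate n true) (t := []) (o := []) (i := none :: rest)
    (by simpa using h2)
  have h4 : encodeResponse program ⟨n, H⟩ = (List.replicate n true).map some ++ none :: rest := by
    simp [encodeResponse, hrest]
  have h5 : (encodeResponse program ⟨n, H⟩).length =
      n + 1 + ((program n).T + 1) * (2 * n + 4 + 1) := length_encodeResponse _ _
  rw [h5, h4]
  refine h3.mono ?_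
  simp only [List.length_replicate]
  nlinarith

/-- The machine that reads the history. -/
def reader : TM2ComputableInTime (encodeResponse program) id answer where
  tm := readerCmd.machine .inp .out
  inputAlphabet := Equiv.refl (Option Bool)
  outputAlphabet := Equiv.refl Bool
  time L := 10 * L + 1
  outputsFun p := by
    have h := runsIn_reader p
    have h1 : ∀ i, rconf i [] [] = StackCmd.single RStack.inp i := by
      intro i
      funext k
      cases k <;> simp [StackCmd.single, rconf]
    have h2 : ∀ o, rconf [] [] o = StackCmd.single RStack.out o := by
      intro o
      funext k
      cases k <;> simp [StackCmd.single, rconf]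
    rw [h1, h2] at h
    have h6 := StackCmd.outputsInTime h
    simp only [Equiv.invFun_as_coe, Equiv.refl_symm, Equiv.coe_refl]
    have e : ∀ (α : Type) (l : List α), List.map id l = l := fun _ => List.map_id
    exact cast (congrArg₂ (fun a b => TM2OutputsInTime _ a (some b) _) (e _ _).symm
      (e _ _).symm) h6

theorem time_reader (L : ℕ) : reader.time L = 10 * L + 1 := rfl

/-- The search algorithm. -/
def algorithm : SearchAlgorithm where
  program := program
  writer := writer
  answer := answer
  reader := reader

end Search

end Histories

end

noncomputable section

namespace Histories

/-! ### Gates acting on vectors -/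

variable {l : ℕ}

theorem onQubit_mulVec (g : Matrix Bool Bool ℂ) (i : Fin l) (ψ : Bits l → ℂ) (v : Bits l) :
    (onQubit g i *ᵥ ψ) v = ∑ b, g (v i) b * ψ (Function.update v i b) := by
  simp only [mulVec, dotProduct, onQubit, of_apply]
  have hinj : Function.Injective fun b : Bool => Function.update v i b := fun b b' h => by
    simpa using congrFun h i
  rw [← Finset.sum_subset (Finset.subset_univ (Finset.univ.map ⟨_, hinj⟩)), Finset.sum_map]
  · refine Finset.sum_congr rfl fun b _ => ?_
    have : ∀ j, j ≠ i → v j = Function.update v i b j := fun j hj => by simp [hj]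
    simp only [Function.Embedding.coeFn_mk, Function.update_self]
    rw [if_pos this]
  · intro x _ hx
    rw [if_neg, zero_mul]
    intro h
    refine hx (Finset.mem_map.2 ⟨x i, Finset.mem_univ _, ?_⟩)
    funext j
    by_cases hj : j = i
    · subst hj; simp
    · simp [hj, h j hj]

theorem xorInto_involutive {t : Fin l} {p : Bits l → Bool}
    (hp : ∀ v b, p (Function.update v t b) = p v) :
    Function.Involutive fun v : Bits l => Function.update v t (xor (v t) (p v)) := by
  intro v
  simp [hp]

theorem xorInto_mulVec {t : Fin l} {p : Bits l → Bool}
    (hp : ∀ v b, p (Function.update v t b) = p v) (ψ : Bits l → ℂ) (v : Bits l) :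
    (xorInto t p *ᵥ ψ) v = ψ (Function.update v t (xor (v t) (p v))) := by
  simp only [mulVec, dotProduct, xorInto, of_apply, ite_mul, one_mul, zero_mul]
  rw [Finset.sum_eq_single (Function.update v t (xor (v t) (p v)))]
  · rw [if_pos (xorInto_involutive hp v).symm]
  · intro x _ hx
    rw [if_neg]
    rintro rfl
    exact hx (xorInto_involutive hp x).symm
  · simp

theorem ext_of_mulVec {m : Type*} [Fintype m] [DecidableEq m] {M N : Matrix m m ℂ}
    (h : ∀ ψ : m → ℂ, M *ᵥ ψ = N *ᵥ ψ) : M = N := by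
  ext i j
  have := congrFun (h (Pi.single j 1)) i
  simpa using this

theorem onQubit_mul (g h : Matrix Bool Bool ℂ) (i : Fin l) :
    onQubit g i * onQubit h i = onQubit (g * h) i := by
  refine ext_of_mulVec fun ψ => ?_
  rw [← mulVec_mulVec]
  funext v
  simp only [onQubit_mulVec, Function.update_self, Function.update_idem, mul_apply,
    Fintype.sum_bool]
  ring

theorem onQubit_one (i : Fin l) : onQubit 1 i = 1 := by
  refine ext_of_mulVec fun ψ => ?_
  funext v
  rw [onQubit_mulVec, one_mulVec, Finset.sum_eq_single (v i)]
  · simp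
  · intro b _ hb; simp [one_apply_ne hb.symm]
  · simp

theorem star_onQubit (g : Matrix Bool Bool ℂ) (i : Fin l) :
    star (onQubit g i) = onQubit (star g) i := by
  ext y x
  simp only [star_apply, onQubit, of_apply]
  by_cases h : ∀ j, j ≠ i → y j = x j
  · rw [if_pos h, if_pos fun j hj => (h j hj).symm]
  · rw [if_neg h, if_neg fun h' => h fun j hj => (h' j hj).symm, star_zero]

theorem onQubit_mem_unitaryGroup {g : Matrix Bool Bool ℂ} (hg : g ∈ unitaryGroup Bool ℂ)
    (i : Fin l) : onQubit g i ∈ unitaryGroup (Bits l) ℂ := by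
  rw [mem_unitaryGroup_iff] at hg ⊢
  rw [star_onQubit, onQubit_mul, hg, onQubit_one]

theorem xorInto_mem_unitaryGroup {t : Fin l} {p : Bits l → Bool}
    (hp : ∀ v b, p (Function.update v t b) = p v) :
    xorInto t p ∈ unitaryGroup (Bits l) ℂ := by
  have hstar : star (xorInto t p) = xorInto t p := by
    ext y x
    simp only [star_apply, xorInto, of_apply]
    have hiff : x = Function.update y t (xor (y t) (p y)) ↔
        y = Function.update x t (xor (x t) (p x)) :=
      ⟨fun h => by rw [h]; exact (xorInto_involutive hp y).symm,
        fun h => by rw [h]; exact (xorInto_involutive hp x).symm⟩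
    simp only [hiff]
    split_ifs <;> simp
  rw [mem_unitaryGroup_iff, hstar]
  refine ext_of_mulVec fun ψ => ?_
  rw [← mulVec_mulVec, one_mulVec]
  funext v
  rw [xorInto_mulVec hp, xorInto_mulVec hp]
  exact congrArg ψ (xorInto_involutive hp v)

theorem sqrt_two_mul_self : (Real.sqrt 2 : ℂ) * (Real.sqrt 2 : ℂ) = 2 := by
  rw [← Complex.ofReal_mul, Real.mul_self_sqrt (by norm_num)]
  norm_num

theorem sqrt_two_ne_zero : (Real.sqrt 2 : ℂ) ≠ 0 := by
  intro h
  have := sqrt_two_mul_self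
  rw [h] at this
  norm_num at this

theorem hadamardMatrix_mul_self : hadamardMatrix * hadamardMatrix = 1 := by
  have h := sqrt_two_mul_self
  have h0 := sqrt_two_ne_zero
  ext y x
  rw [mul_apply, Fintype.sum_bool]
  cases y <;> cases x <;> simp [hadamardMatrix] <;> field_simp <;> rw [pow_two, h] <;> norm_num

theorem hadamardMatrix_mem_unitaryGroup : hadamardMatrix ∈ unitaryGroup Bool ℂ := by
  have : star hadamardMatrix = hadamardMatrix := by
    ext y x
    cases y <;> cases x <;> simp [hadamardMatrix, star_apply]
  rw [mem_unitaryGroup_iff, this, hadamardMatrix_mul_self]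

theorem piEighthMatrix_mem_unitaryGroup : piEighthMatrix ∈ unitaryGroup Bool ℂ := by
  have h : Complex.exp (Real.pi / 4 * Complex.I) *
      (starRingEnd ℂ) (Complex.exp (Real.pi / 4 * Complex.I)) = 1 := by
    have hr : (Real.pi / 4 * Complex.I : ℂ) = ((Real.pi / 4 : ℝ) : ℂ) * Complex.I := by push_cast; rfl
    rw [← Complex.exp_conj, ← Complex.exp_add, hr, map_mul, Complex.conj_ofReal, Complex.conj_I]
    simp
  rw [mem_unitaryGroup_iff]
  ext y x
  rw [mul_apply, Fintype.sum_bool]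
  cases y <;> cases x <;> simp [piEighthMatrix, star_apply, h]

variable {n : ℕ}

theorem Gate.matrix_mem_unitaryGroup (f : Bits n → Bool) (g : Gate n l) :
    g.matrix f ∈ unitaryGroup (Bits l) ℂ := by
  cases g with
  | hadamard i => exact onQubit_mem_unitaryGroup hadamardMatrix_mem_unitaryGroup i
  | piEighth i => exact onQubit_mem_unitaryGroup piEighthMatrix_mem_unitaryGroup i
  | not i => exact xorInto_mem_unitaryGroup fun _ _ => rfl
  | cnot c t h => exact xorInto_mem_unitaryGroup fun v b => by simp [h]
  | toffoli a b t h₁ h₂ h₃ => exact xorInto_mem_unitaryGroup fun v b => by simp [h₂, h₃]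
  | query addr t h => exact xorInto_mem_unitaryGroup fun v b => by simp [h]

section Circuits

variable (f : Bits n → Bool)

theorem foldl_matrix (c : List (Gate n l)) (M : Matrix (Bits l) (Bits l) ℂ) :
    c.foldl (fun M g => g.matrix f * M) M = circuitMatrix f c * M := by
  induction c generalizing M with
  | nil => simp [circuitMatrix]
  | cons g c ih =>
    rw [List.foldl_cons, ih]
    conv_rhs => rw [circuitMatrix, List.foldl_cons, ih, Matrix.mul_one]
    rw [Matrix.mul_assoc]

theorem circuitMatrix_cons (g : Gate n l) (c : List (Gate n l)) :
    circuitMatrix f (g :: c) = circuitMatrix f c * g.matrix f := by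
  rw [circuitMatrix, List.foldl_cons, foldl_matrix, Matrix.mul_one]

theorem circuitMatrix_mem_unitaryGroup (c : List (Gate n l)) :
    circuitMatrix f c ∈ unitaryGroup (Bits l) ℂ := by
  induction c with
  | nil => exact Submonoid.one_mem _
  | cons g c ih =>
    rw [circuitMatrix_cons]
    exact Submonoid.mul_mem _ ih (g.matrix_mem_unitaryGroup f)

/-- The action of a circuit on a vector. -/
def applyCircuit (c : List (Gate n l)) (ψ : Bits l → ℂ) : Bits l → ℂ := circuitMatrix f c *ᵥ ψ

@[simp] theorem applyCircuit_nil (ψ : Bits l → ℂ) : applyCircuit f [] ψ = ψ := by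
  simp [applyCircuit, circuitMatrix]

theorem applyCircuit_cons (g : Gate n l) (c : List (Gate n l)) (ψ : Bits l → ℂ) :
    applyCircuit f (g :: c) ψ = applyCircuit f c (g.matrix f *ᵥ ψ) := by
  rw [applyCircuit, circuitMatrix_cons, applyCircuit, mulVec_mulVec]

theorem applyCircuit_append (c d : List (Gate n l)) (ψ : Bits l → ℂ) :
    applyCircuit f (c ++ d) ψ = applyCircuit f d (applyCircuit f c ψ) := by
  induction c generalizing ψ with
  | nil => simp
  | cons g c ih => rw [List.cons_append, applyCircuit_cons, ih, applyCircuit_cons]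

theorem applyCircuit_add (c : List (Gate n l)) (ψ φ : Bits l → ℂ) :
    applyCircuit f c (ψ + φ) = applyCircuit f c ψ + applyCircuit f c φ := mulVec_add ..

theorem applyCircuit_sub (c : List (Gate n l)) (ψ φ : Bits l → ℂ) :
    applyCircuit f c (ψ - φ) = applyCircuit f c ψ - applyCircuit f c φ := mulVec_sub ..

theorem applyCircuit_smul (c : List (Gate n l)) (a : ℂ) (ψ : Bits l → ℂ) :
    applyCircuit f c (a • ψ) = a • applyCircuit f c ψ := mulVec_smul ..

theorem applyCircuit_singleton (g : Gate n l) (ψ : Bits l → ℂ) :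
    applyCircuit f [g] ψ = g.matrix f *ᵥ ψ := by
  rw [applyCircuit_cons, applyCircuit_nil]

theorem sum_norm_mulVec {m : Type*} [Fintype m] [DecidableEq m] {U : Matrix m m ℂ}
    (hU : U ∈ unitaryGroup m ℂ) (ψ : m → ℂ) : ∑ x, ‖(U *ᵥ ψ) x‖ ^ 2 = ∑ x, ‖ψ x‖ ^ 2 := by
  have h : ∀ φ : m → ℂ, ((∑ x, ‖φ x‖ ^ 2 : ℝ) : ℂ) = star φ ⬝ᵥ φ := fun φ => by
    simp only [dotProduct, Pi.star_apply, RCLike.star_def, Complex.conj_mul', Complex.ofReal_sum,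
      Complex.ofReal_pow]
  have : ((∑ x, ‖(U *ᵥ ψ) x‖ ^ 2 : ℝ) : ℂ) = ((∑ x, ‖ψ x‖ ^ 2 : ℝ) : ℂ) := by
    rw [h, h, star_mulVec, dotProduct_mulVec, vecMul_vecMul, ← star_eq_conjTranspose,
      mem_unitaryGroup_iff'.1 hU, vecMul_one]
  exact_mod_cast this

theorem sum_norm_applyCircuit (c : List (Gate n l)) (ψ : Bits l → ℂ) :
    ∑ x, ‖applyCircuit f c ψ x‖ ^ 2 = ∑ x, ‖ψ x‖ ^ 2 :=
  sum_norm_mulVec (circuitMatrix_mem_unitaryGroup f c) ψ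

/-! ### Block structure -/

/-- Two basis states are equivalent if they differ only on the qubits in `s`. -/
def agreeOff (s : Set (Fin l)) : Setoid (Bits l) where
  r x y := ∀ j, j ∉ s → x j = y j
  iseqv := ⟨fun _ _ _ => rfl, fun h j hj => (h j hj).symm,
    fun h h' j hj => (h j hj).trans (h' j hj)⟩

/-- The matrix changes only the qubits in `s`. -/
def ActsOn (s : Set (Fin l)) (U : Matrix (Bits l) (Bits l) ℂ) : Prop :=
  ∀ x y, ¬ agreeOff s x y → U y x = 0

theorem ActsOn.mul {s : Set (Fin l)} {U V : Matrix (Bits l) (Bits l) ℂ} (hU : ActsOn s U)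
    (hV : ActsOn s V) : ActsOn s (U * V) := fun x y h => by
  rw [mul_apply]
  refine Finset.sum_eq_zero fun z _ => ?_
  by_cases hx : agreeOff s x z
  · rw [hU z y fun hz => h ((agreeOff s).trans hx hz), zero_mul]
  · rw [hV x z hx, mul_zero]

theorem actsOn_onQubit {s : Set (Fin l)} (g : Matrix Bool Bool ℂ) {i : Fin l} (hi : i ∈ s) :
    ActsOn s (onQubit g i) := fun x y h => by
  rw [onQubit, of_apply, if_neg]
  intro h'
  exact h fun j hj => (h' j fun hji => hj (hji ▸ hi)).symm

theorem actsOn_xorInto {s : Set (Fin l)} (p : Bits l → Bool) {t : Fin l} (ht : t ∈ s) :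
    ActsOn s (xorInto t p) := fun x y h => by
  rw [xorInto, of_apply, if_neg]
  rintro rfl
  refine h fun j hj => ?_
  rw [Function.update_of_ne]
  rintro rfl
  exact hj ht

/-- Supplies the block-diagonality that indifference takes as its hypothesis. -/
theorem actsOn_circuitMatrix {s : Set (Fin l)} {c : List (Gate n l)}
    (h : ∀ g ∈ c, ActsOn s (g.matrix f)) : ActsOn s (circuitMatrix f c) := by
  induction c with
  | nil =>
    intro x y hxy
    rw [circuitMatrix, List.foldl_nil, one_apply_ne]
    rintro rfl
    exact hxy fun _ _ => rfl
  | cons g c ih =>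
    rw [circuitMatrix_cons]
    exact (ih fun g hg => h g (List.mem_cons_of_mem _ hg)).mul (h g List.mem_cons_self)

end Circuits

end Histories

end

noncomputable section

namespace Histories

/-! ### Product states -/

namespace Search

variable {n : ℕ}

/-- The ancilla qubits are in the state `10…0` and the pad qubit holds `0`. -/
def Clean (v : Bits (2 * n + 4)) : Prop :=
  (∀ i : Fin (n + 1), v (anc i) = decide (i = 0)) ∧ v (pad n) = false

instance : DecidablePred (Clean (n := n)) := fun v => by unfold Clean; infer_instance

@[simp] theorem clean_update_item {v : Bits (2 * n + 4)} {i : Fin n} {b : Bool} :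
    Clean (Function.update v (item i) b) ↔ Clean v := by simp [Clean, Function.update_of_ne]

@[simp] theorem clean_update_flag {v : Bits (2 * n + 4)} {b : Bool} :
    Clean (Function.update v (flag n) b) ↔ Clean v := by simp [Clean, Function.update_of_ne]

@[simp] theorem clean_update_mark {v : Bits (2 * n + 4)} {b : Bool} :
    Clean (Function.update v (mark n) b) ↔ Clean v := by simp [Clean, Function.update_of_ne]

/-- The product state with the item bits in the states `φ i`, the flag in the state `χ`, the mark
in the state `μ`, and clean ancillas. -/
def productState (φ : Fin n → Bool → ℂ) (χ μ : Bool → ℂ) : Bits (2 * n + 4) → ℂ := fun v =>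
  if Clean v then (∏ i, φ i (v (item i))) * χ (v (flag n)) * μ (v (mark n)) else 0

/-- A basis state of one qubit. -/
abbrev ket (b : Bool) : Bool → ℂ := Pi.single b 1

/-- The matrix of the NOT gate. -/
def notMatrix : Matrix Bool Bool ℂ := of fun y x => if y = x then 0 else 1

theorem notMatrix_mulVec (φ : Bool → ℂ) : notMatrix *ᵥ φ = fun b => φ (!b) := by
  funext b
  cases b <;> simp [notMatrix, mulVec, dotProduct]

theorem notMatrix_mul_self : notMatrix * notMatrix = 1 := by
  ext y x
  cases y <;> cases x <;> simp [notMatrix, mul_apply]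

theorem xorInto_true {l : ℕ} (i : Fin l) : xorInto i (fun _ => true) = onQubit notMatrix i := by
  refine ext_of_mulVec fun ψ => ?_
  funext v
  rw [xorInto_mulVec fun _ _ => rfl, onQubit_mulVec]
  cases h : v i <;> simp [notMatrix]

theorem prod_update_item (φ : Fin n → Bool → ℂ) (v : Bits (2 * n + 4)) (i : Fin n) (b : Bool) :
    ∏ j, φ j (Function.update v (item i) b (item j)) =
      φ i b * ∏ j ∈ Finset.univ.erase i, φ j (v (item j)) := by
  rw [← Finset.mul_prod_erase _ _ (Finset.mem_univ i), Function.update_self]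
  congr 1
  refine Finset.prod_congr rfl fun j hj => ?_
  rw [Function.update_of_ne]
  simpa using Finset.ne_of_mem_erase hj

theorem prod_update_fun (φ : Fin n → Bool → ℂ) (v : Bits (2 * n + 4)) (i : Fin n) (g : Bool → ℂ) :
    ∏ j, Function.update φ i g j (v (item j)) =
      g (v (item i)) * ∏ j ∈ Finset.univ.erase i, φ j (v (item j)) := by
  rw [← Finset.mul_prod_erase _ _ (Finset.mem_univ i), Function.update_self]
  congr 1
  refine Finset.prod_congr rfl fun j hj => ?_
  rw [Function.update_of_ne (Finset.ne_of_mem_erase hj)]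

theorem onQubit_item_productState (g : Matrix Bool Bool ℂ) (i : Fin n) (φ : Fin n → Bool → ℂ)
    (χ μ : Bool → ℂ) :
    onQubit g (item i) *ᵥ productState φ χ μ =
      productState (Function.update φ i (g *ᵥ φ i)) χ μ := by
  funext v
  rw [onQubit_mulVec]
  simp only [productState, clean_update_item]
  by_cases hv : Clean v
  · simp only [hv, if_true, prod_update_item, prod_update_fun]
    simp [mulVec, dotProduct, Function.update_of_ne]
    ring
  · simp [hv]

theorem onQubit_flag_productState (g : Matrix Bool Bool ℂ) (φ : Fin n → Bool → ℂ)
    (χ μ : Bool → ℂ) :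
    onQubit g (flag n) *ᵥ productState φ χ μ = productState φ (g *ᵥ χ) μ := by
  funext v
  rw [onQubit_mulVec]
  simp only [productState, clean_update_flag]
  by_cases hv : Clean v
  · simp only [hv, if_true]
    simp [mulVec, dotProduct, Function.update_of_ne]
    ring
  · simp [hv]

/-- The flag must be a basis state here; otherwise the gate would entangle it with the item bit and
the result would not be a product. -/
theorem cnot_flag_item_productState (i : Fin n) (φ : Fin n → Bool → ℂ) (b : Bool) (μ : Bool → ℂ) :
    xorInto (item i) (fun x => x (flag n)) *ᵥ productState φ (ket b) μ =
      productState (Function.update φ i fun c => φ i (xor c b)) (ket b) μ := by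
  funext v
  rw [xorInto_mulVec fun v b => by simp [Function.update_of_ne]]
  simp only [productState, clean_update_item]
  by_cases hv : Clean v
  · simp only [hv, if_true, prod_update_item, prod_update_fun]
    by_cases hb : v (flag n) = b
    · simp [hb, Function.update_of_ne]
    · simp [hb, Function.update_of_ne]
  · simp [hv]

theorem cnot_flag_mark_productState (φ : Fin n → Bool → ℂ) (b : Bool) (μ : Bool → ℂ) :
    xorInto (mark n) (fun x => x (flag n)) *ᵥ productState φ (ket b) μ =
      productState φ (ket b) fun c => μ (xor c b) := by
  funext v
  rw [xorInto_mulVec fun v b => by simp [Function.update_of_ne]]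
  simp only [productState, clean_update_mark]
  by_cases hv : Clean v
  · by_cases hb : v (flag n) = b
    · simp [hv, hb, Function.update_of_ne]
    · simp [hv, hb, Function.update_of_ne]
  · simp [hv]

theorem productState_const_smul (c : ℂ) (φ : Fin n → Bool → ℂ) (χ μ : Bool → ℂ) :
    productState (fun i => c • φ i) χ μ = c ^ n • productState φ χ μ := by
  funext v
  simp only [productState, Pi.smul_apply, smul_eq_mul, Finset.prod_mul_distrib, Finset.prod_const,
    Finset.card_univ, Fintype.card_fin]
  split_ifs <;> ring

theorem productState_smul_flag (c : ℂ) (φ : Fin n → Bool → ℂ) (χ μ : Bool → ℂ) :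
    productState φ (c • χ) μ = c • productState φ χ μ := by
  funext v
  simp only [productState, Pi.smul_apply, smul_eq_mul]
  split_ifs <;> ring

/-- A circuit that acts on each of the item bits in a list separately. -/
theorem layer_productState (f : Bits n → Bool) {c : Fin n → List (Gate n (2 * n + 4))}
    {G : (Bool → ℂ) → Bool → ℂ} {χ μ : Bool → ℂ}
    (h : ∀ i φ, applyCircuit f (c i) (productState φ χ μ) =
      productState (Function.update φ i (G (φ i))) χ μ)
    {L : List (Fin n)} (hL : L.Nodup) (φ : Fin n → Bool → ℂ) :
    applyCircuit f (L.flatMap c) (productState φ χ μ) =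
      productState (fun i => if i ∈ L then G (φ i) else φ i) χ μ := by
  induction L generalizing φ with
  | nil => simp
  | cons i L ih =>
    rw [List.nodup_cons] at hL
    rw [List.flatMap_cons, applyCircuit_append, h, ih hL.2]
    congr 1
    funext j
    by_cases hj : j = i
    · subst hj; simp [hL.1]
    · simp [hj]

theorem applyCircuit_hadamard_item (f : Bits n → Bool) (i : Fin n) (φ : Fin n → Bool → ℂ)
    (χ μ : Bool → ℂ) : applyCircuit f [.hadamard (item i)] (productState φ χ μ) =
      productState (Function.update φ i (hadamardMatrix *ᵥ φ i)) χ μ := by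
  rw [applyCircuit_singleton, Gate.matrix, onQubit_item_productState]

theorem applyCircuit_hadamard_flag (f : Bits n → Bool) (φ : Fin n → Bool → ℂ)
    (χ μ : Bool → ℂ) : applyCircuit f [.hadamard (flag n)] (productState φ χ μ) =
      productState φ (hadamardMatrix *ᵥ χ) μ := by
  rw [applyCircuit_singleton, Gate.matrix, onQubit_flag_productState]

/-! ### The controlled Hadamard gate -/

theorem piEighthMatrix_pow (k : ℕ) : piEighthMatrix ^ k =
    diagonal fun b => if b then Complex.exp (Real.pi / 4 * Complex.I) ^ k else 1 := by
  rw [piEighthMatrix, diagonal_pow]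
  congr 1
  funext b
  cases b <;> simp

theorem exp_pi_div_four : Complex.exp (Real.pi / 4 * Complex.I) =
    (1 + Complex.I) / (Real.sqrt 2 : ℂ) := by
  have hr : (Real.pi / 4 * Complex.I : ℂ) = ((Real.pi / 4 : ℝ) : ℂ) * Complex.I := by
    push_cast; rfl
  rw [hr, Complex.exp_mul_I, ← Complex.ofReal_cos, ← Complex.ofReal_sin, Real.cos_pi_div_four,
    Real.sin_pi_div_four]
  have h := sqrt_two_mul_self
  have h0 := sqrt_two_ne_zero
  push_cast
  field_simp
  linear_combination (1 + Complex.I) * h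

theorem exp_pi_div_four_sq : Complex.exp (Real.pi / 4 * Complex.I) ^ 2 = Complex.I := by
  have h := sqrt_two_mul_self
  have h0 := sqrt_two_ne_zero
  rw [exp_pi_div_four, div_pow, div_eq_iff (pow_ne_zero 2 h0), pow_two (Real.sqrt 2 : ℂ), h]
  linear_combination Complex.I_sq

theorem exp_pi_div_four_pow_eight : Complex.exp (Real.pi / 4 * Complex.I) ^ 8 = 1 := by
  rw [show 8 = 2 * 4 from rfl, pow_mul, exp_pi_div_four_sq, Complex.I_pow_four]

/-- The matrix applied to the target of `controlledHadamard` before the CNOT gate. -/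
def hadamardConjugator : Matrix Bool Bool ℂ :=
  piEighthMatrix ^ 7 * hadamardMatrix * piEighthMatrix ^ 6

/-- The inverse of `hadamardConjugator`. -/
def hadamardConjugatorInv : Matrix Bool Bool ℂ :=
  hadamardMatrix * piEighthMatrix ^ 2 * hadamardMatrix * piEighthMatrix

/-- Let T be the π/8 matrix and V = T⁷HT⁶ = `hadamardConjugator`. As T⁸ = 1, V⁻¹ = T²HT, so
`hadamardConjugatorInv` is HV⁻¹, with an extra factor H in front. That factor is what makes the gate
act on flag 0 rather than on flag 1. -/
theorem hadamardConjugatorInv_mul : hadamardConjugatorInv * hadamardConjugator = hadamardMatrix := by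
  have h8 : piEighthMatrix ^ 2 * piEighthMatrix ^ 6 = 1 := by
    rw [← pow_add, piEighthMatrix_pow, ← diagonal_one]
    congr 1
    funext b
    cases b <;> simp [exp_pi_div_four_pow_eight]
  have h8' : piEighthMatrix * piEighthMatrix ^ 7 = 1 := by
    rw [← pow_succ', pow_succ' _ 7, ← h8]
    noncomm_ring
  calc hadamardConjugatorInv * hadamardConjugator
      = hadamardMatrix * piEighthMatrix ^ 2 * (hadamardMatrix *
          (piEighthMatrix * piEighthMatrix ^ 7) * hadamardMatrix) * piEighthMatrix ^ 6 := by
        simp only [hadamardConjugatorInv, hadamardConjugator, Matrix.mul_assoc]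
    _ = hadamardMatrix := by
        rw [h8', Matrix.mul_one, hadamardMatrix_mul_self, Matrix.mul_one, Matrix.mul_assoc, h8,
          Matrix.mul_one]

/-- V conjugates NOT into H, that is V⁻¹XV = H, and the extra factor H cancels it. -/
theorem hadamardConjugatorInv_mul_not_mul :
    hadamardConjugatorInv * notMatrix * hadamardConjugator = 1 := by
  obtain ⟨t, ht⟩ : ∃ t : ℂ, t = (Real.sqrt 2 : ℂ)⁻¹ := ⟨_, rfl⟩
  have ht2 : t ^ 2 = 1 / 2 := by
    rw [ht, inv_pow, pow_two, sqrt_two_mul_self, one_div]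
  have hI := Complex.I_sq
  have hω : Complex.exp (Real.pi / 4 * Complex.I) = (1 + Complex.I) * t := by
    rw [exp_pi_div_four, ht, div_eq_mul_inv]
  have hp : ∀ k, piEighthMatrix ^ k =
      diagonal fun b => if b then ((1 + Complex.I) * t) ^ k else 1 := fun k => by
    rw [piEighthMatrix_pow, hω]
  have hp1 := hp 1
  rw [pow_one, pow_one] at hp1
  rw [hadamardConjugatorInv, hadamardConjugator, hp, hp, hp, hp1]
  ext y x
  cases y <;> cases x <;>
    simp only [mul_apply, Fintype.sum_bool, notMatrix, hadamardMatrix, of_apply, diagonal_apply,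
      -- With t = 1/√2 every entry is a polynomial in t and i, to be reduced by t² = 1/2 and i² =
      -- -1.
      div_eq_mul_inv, ← ht] <;>
    simp <;> grind

theorem applyCircuit_replicate_piEighth (f : Bits n → Bool) (i : Fin n) (k : ℕ)
    (φ : Fin n → Bool → ℂ) (χ μ : Bool → ℂ) :
    applyCircuit f (List.replicate k (.piEighth (item i))) (productState φ χ μ) =
      productState (Function.update φ i (piEighthMatrix ^ k *ᵥ φ i)) χ μ := by
  induction k generalizing φ with
  | zero => simp
  | succ k ih =>
    rw [List.replicate_succ, applyCircuit_cons, Gate.matrix, onQubit_item_productState, ih]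
    simp [pow_succ]

theorem applyCircuit_controlledHadamard (f : Bits n → Bool) (i : Fin n) (φ : Fin n → Bool → ℂ)
    (b : Bool) (μ : Bool → ℂ) :
    applyCircuit f (controlledHadamard i) (productState φ (ket b) μ) =
      productState (Function.update φ i (if b then φ i else hadamardMatrix *ᵥ φ i)) (ket b) μ := by
  have hc : (fun c => (hadamardConjugator *ᵥ φ i) (xor c b)) =
      (if b then notMatrix else 1) *ᵥ (hadamardConjugator *ᵥ φ i) := by
    cases b
    · simp
    · rw [if_pos rfl, notMatrix_mulVec]
      simp
  simp only [controlledHadamard, applyCircuit_append, applyCircuit_replicate_piEighth,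
    applyCircuit_cons, applyCircuit_nil, Gate.matrix, onQubit_item_productState,
    cnot_flag_item_productState, Function.update_self, Function.update_idem, mulVec_mulVec]
  have h1 : piEighthMatrix ^ 7 * (hadamardMatrix * piEighthMatrix ^ 6) = hadamardConjugator :=
    (Matrix.mul_assoc ..).symm
  simp only [h1, hc, mulVec_mulVec]
  have h2 : hadamardMatrix * (piEighthMatrix * (piEighthMatrix * (hadamardMatrix *
      piEighthMatrix))) * ((if b then notMatrix else 1) * hadamardConjugator) =
      hadamardConjugatorInv * (if b then notMatrix else 1) * hadamardConjugator := by
    simp only [hadamardConjugatorInv, pow_two, Matrix.mul_assoc]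
  rw [h2]
  cases b
  · simp [hadamardConjugatorInv_mul]
  · simp [hadamardConjugatorInv_mul_not_mul]

/-! ### Reflections -/

/-- A circuit that flips the flag if the item bits are those of `z`. -/
theorem flip_productState (f : Bits n → Bool) {c : List (Gate n (2 * n + 4))} {z : Bits n}
    {φ : Fin n → Bool → ℂ} {χ μ : Bool → ℂ}
    (hc : ∀ v, applyCircuit f c (productState φ χ μ) v = productState φ χ μ
      (Function.update v (flag n) (xor (v (flag n)) (decide (∀ i, v (item i) = z i))))) :
    applyCircuit f c (productState φ χ μ) = productState φ χ μ +
      (∏ i, φ i (z i)) • (productState (fun i => ket (z i)) (fun b => χ !b) μ -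
        productState (fun i => ket (z i)) χ μ) := by
  funext v
  rw [hc]
  simp only [productState, clean_update_flag, Pi.add_apply, Pi.smul_apply, Pi.sub_apply,
    smul_eq_mul]
  by_cases hv : Clean v
  · simp only [hv, if_true, Function.update_self, ne_eq, item_ne_flag, not_false_eq_true,
      Function.update_of_ne, mark_ne_flag]
    by_cases hz : ∀ i, v (item i) = z i
    · simp [hz]
      ring
    · have h0 : ∏ i, ket (z i) (v (item i)) = 0 := by
        obtain ⟨i, hi⟩ := not_forall.1 hz
        exact Finset.prod_eq_zero (Finset.mem_univ i) (Pi.single_eq_of_ne hi _)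
      simp [hz, h0]
  · simp [hv]

theorem queryGate_productState {f : Bits n → Bool} {x : Bits n} (hf : ∀ y, f y = true ↔ y = x)
    (φ : Fin n → Bool → ℂ) (χ μ : Bool → ℂ) :
    applyCircuit f [queryGate n] (productState φ χ μ) = productState φ χ μ +
      (∏ i, φ i (x i)) • (productState (fun i => ket (x i)) (fun b => χ !b) μ -
        productState (fun i => ket (x i)) χ μ) := by
  refine flip_productState f fun v => ?_
  rw [applyCircuit_singleton, queryGate, Gate.matrix,
    xorInto_mulVec fun v b => by simp [Function.update_of_ne]]
  congr 3
  rw [Bool.eq_iff_iff, hf, decide_eq_true_iff, funext_iff]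
  rfl

/-- The permutation of the basis states that `ladderGate i` effects. -/
def ladderStep (v : Bits (2 * n + 4)) (i : Fin n) : Bits (2 * n + 4) :=
  Function.update v (anc i.succ) (xor (v (anc i.succ)) (v (anc i.castSucc) && v (item i)))

theorem anc_castSucc_ne_anc_succ (i : Fin n) : anc i.castSucc ≠ anc i.succ := by
  simpa using (Fin.castSucc_lt_succ (i := i)).ne

theorem ladderGate_mulVec (f : Bits n → Bool) (i : Fin n) (ψ : Bits (2 * n + 4) → ℂ)
    (v : Bits (2 * n + 4)) :
    ((ladderGate i).matrix f *ᵥ ψ) v = ψ (ladderStep v i) := by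
  rw [ladderGate, Gate.matrix, xorInto_mulVec fun v b => by
    simp [Function.update_of_ne, anc_castSucc_ne_anc_succ, -anc_inj]]
  rfl

theorem ladderStep_ladderStep (v : Bits (2 * n + 4)) (i : Fin n) :
    ladderStep (ladderStep v i) i = v := by
  simp [ladderStep, Function.update_of_ne, anc_castSucc_ne_anc_succ, -anc_inj]

theorem ladderStep_update_flag (v : Bits (2 * n + 4)) (i : Fin n) (b : Bool) :
    ladderStep (Function.update v (flag n) b) i = Function.update (ladderStep v i) (flag n) b := by
  simp [ladderStep, Function.update_of_ne, Function.update_comm]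

/-- A permutation acts on amplitudes through its inverse. Each step is its own inverse, so only the
order is reversed. -/
theorem applyCircuit_ladder (f : Bits n → Bool) (L : List (Fin n)) (ψ : Bits (2 * n + 4) → ℂ)
    (v : Bits (2 * n + 4)) :
    applyCircuit f (L.flatMap fun i => [ladderGate i]) ψ v = ψ (L.reverse.foldl ladderStep v) := by
  induction L generalizing ψ with
  | nil => simp
  | cons i L ih =>
    rw [List.flatMap_cons, applyCircuit_append, ih, applyCircuit_singleton, ladderGate_mulVec]
    simp

theorem foldl_ladderStep_reverse (L : List (Fin n)) (v : Bits (2 * n + 4)) :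
    L.reverse.foldl ladderStep (L.foldl ladderStep v) = v := by
  induction L generalizing v with
  | nil => rfl
  | cons i L ih => simp at ih ⊢; rw [ih, ladderStep_ladderStep]

theorem foldl_ladderStep_update_flag (L : List (Fin n)) (v : Bits (2 * n + 4)) (b : Bool) :
    L.foldl ladderStep (Function.update v (flag n) b) =
      Function.update (L.foldl ladderStep v) (flag n) b := by
  induction L generalizing v with
  | nil => rfl
  | cons i L ih => rw [List.foldl_cons, List.foldl_cons, ladderStep_update_flag, ih]

theorem foldl_ladderStep_of_ne_anc (L : List (Fin n)) (v : Bits (2 * n + 4))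
    {w : Fin (2 * n + 4)} (hw : ∀ i, w ≠ anc i) : L.foldl ladderStep v w = v w := by
  induction L generalizing v with
  | nil => rfl
  | cons i L ih => rw [List.foldl_cons, ih, ladderStep, Function.update_of_ne (hw _)]

/-- After `k` steps ancilla `j ≤ k` holds the conjunction of the first `j` item bits and the later
ancillas are still 0. Ancilla 0 starts as 1, the empty conjunction. -/
theorem foldl_ladderStep_take {v : Bits (2 * n + 4)} (hv : Clean v) {k : ℕ} (hk : k ≤ n)
    (j : Fin (n + 1)) : ((List.finRange n).take k).foldl ladderStep v (anc j) =
      decide ((j : ℕ) ≤ k ∧ ∀ i : Fin n, (i : ℕ) < j → v (item i) = true) := by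
  induction k generalizing j with
  | zero =>
    simp only [List.take_zero, List.foldl_nil, hv.1 j, nonpos_iff_eq_zero, decide_eq_decide]
    refine ⟨fun h => by subst h; simp, fun h => Fin.ext h.1⟩
  | succ k ih =>
    have ih := fun j => ih (by omega) j
    have hlen : k < (List.finRange n).length := by simp; omega
    rw [List.take_add_one, List.getElem?_eq_getElem hlen, Option.toList_some, List.foldl_append,
      List.foldl_cons, List.foldl_nil, ladderStep]
    set i : Fin n := (List.finRange n)[k] with hi
    have hik : (i : ℕ) = k := by simp [hi]
    by_cases hj : j = i.succ
    · subst hj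
      rw [Function.update_self, ih, ih, foldl_ladderStep_of_ne_anc _ _ (fun _ => item_ne_anc _ _)]
      rw [Bool.eq_iff_iff]
      simp only [Fin.val_succ, hik, Fin.val_castSucc]
      simp only [show ¬ (k + 1 ≤ k) by omega, false_and, decide_false, Bool.false_xor,
        Bool.and_eq_true, decide_eq_true_eq, le_refl, true_and]
      constructor
      · rintro ⟨h, h'⟩ a ha
        rcases Nat.lt_succ_iff_lt_or_eq.1 ha with h'' | h''
        · exact h a h''
        · rwa [show a = i from Fin.ext (h''.trans hik.symm)]
      · exact fun h => ⟨fun a ha => h a (by omega), h i (by omega)⟩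
    · rw [Function.update_of_ne (by simpa using hj), ih, decide_eq_decide]
      have : (j : ℕ) ≠ k + 1 := fun h => hj (Fin.ext (by simp [hik, h]))
      constructor <;> rintro ⟨h, h'⟩ <;> exact ⟨by omega, h'⟩

/-- The reflection about the states in which all item bits are `1`. -/
theorem conjunction_productState (f : Bits n → Bool) (φ : Fin n → Bool → ℂ) (χ μ : Bool → ℂ) :
    applyCircuit f ((List.finRange n).flatMap (fun i => [ladderGate i]) ++
      [.cnot (anc (Fin.last n)) (flag n) (by simp)] ++
      (List.finRange n).reverse.flatMap (fun i => [ladderGate i])) (productState φ χ μ) =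
    productState φ χ μ + (∏ i, φ i true) • (productState (fun _ => ket true) (fun b => χ !b) μ -
        productState (fun _ => ket true) χ μ) := by
  refine flip_productState (z := fun _ => true) f fun v => ?_
  rw [applyCircuit_append, applyCircuit_append, applyCircuit_ladder, List.reverse_reverse,
    applyCircuit_singleton, Gate.matrix, xorInto_mulVec fun v b => by simp [Function.update_of_ne],
    applyCircuit_ladder, foldl_ladderStep_update_flag, foldl_ladderStep_reverse]
  by_cases hv : Clean v
  · have h := foldl_ladderStep_take hv le_rfl (Fin.last n)
    rw [List.take_of_length_le (by simp)] at h
    rw [h, foldl_ladderStep_of_ne_anc _ _ (fun _ => flag_ne_anc _)]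
    congr 3
    simp
  · simp [productState, hv]

end Search

end Histories

end

noncomputable section

namespace Histories

/-! ### Grover's algorithm -/

namespace Search

variable {n : ℕ}

theorem hadamard_mulVec (φ : Bool → ℂ) (b : Bool) : (hadamardMatrix *ᵥ φ) b =
    (Real.sqrt 2 : ℂ)⁻¹ * (φ false + if b then -φ true else φ true) := by
  cases b <;> simp [hadamardMatrix, mulVec, dotProduct, div_eq_mul_inv] <;> ring

theorem hadamard_mulVec_mulVec (φ : Bool → ℂ) : hadamardMatrix *ᵥ (hadamardMatrix *ᵥ φ) = φ := by
  rw [mulVec_mulVec, hadamardMatrix_mul_self, one_mulVec]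

theorem hadamard_mulVec_ket_false : hadamardMatrix *ᵥ ket false = (Real.sqrt 2 : ℂ)⁻¹ • 1 := by
  funext b
  cases b <;> simp [hadamard_mulVec]

theorem hadamard_mulVec_one : hadamardMatrix *ᵥ 1 = (Real.sqrt 2 : ℂ) • ket false := by
  have h := sqrt_two_mul_self
  have h0 := sqrt_two_ne_zero
  funext b
  cases b
  · simp [hadamard_mulVec]
    field_simp
    linear_combination -h
  · simp [hadamard_mulVec]

/-- The state of the flag during Grover's algorithm. -/
def minus : Bool → ℂ := hadamardMatrix *ᵥ ket true

/-- Phase kickback: flipping a flag in this state is multiplication by -1. -/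
theorem minus_not : (fun b => minus !b) = (-1 : ℂ) • minus := by
  funext b
  simp only [minus, hadamard_mulVec, Pi.smul_apply]
  cases b <;> simp

variable (f : Bits n → Bool)

theorem applyCircuit_not_item (i : Fin n) (φ : Fin n → Bool → ℂ)
    (χ μ : Bool → ℂ) : applyCircuit f [.not (item i)] (productState φ χ μ) =
      productState (Function.update φ i (notMatrix *ᵥ φ i)) χ μ := by
  rw [applyCircuit_singleton, Gate.matrix, xorInto_true, onQubit_item_productState]

theorem applyCircuit_not_flag (φ : Fin n → Bool → ℂ)
    (χ μ : Bool → ℂ) : applyCircuit f [.not (flag n)] (productState φ χ μ) =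
      productState φ (notMatrix *ᵥ χ) μ := by
  rw [applyCircuit_singleton, Gate.matrix, xorInto_true, onQubit_flag_productState]

theorem hadamard_layer {L : List (Fin n)} (hL : L.Nodup) (φ : Fin n → Bool → ℂ) (χ μ : Bool → ℂ) :
    applyCircuit f (L.flatMap fun i => [.hadamard (item i)]) (productState φ χ μ) =
      productState (fun i => if i ∈ L then hadamardMatrix *ᵥ φ i else φ i) χ μ :=
  layer_productState (G := fun φ => hadamardMatrix *ᵥ φ) f
    (fun i φ => applyCircuit_hadamard_item f i φ χ μ) hL φ

/-- The reflection about the uniform superposition. -/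
theorem diffusion_productState (φ : Fin n → Bool → ℂ) (μ : Bool → ℂ) :
    applyCircuit f ((List.finRange n).flatMap (fun i => [.hadamard (item i), .not (item i)]) ++
      ((List.finRange n).flatMap (fun i => [ladderGate i]) ++
      [.cnot (anc (Fin.last n)) (flag n) (by simp)] ++
      (List.finRange n).reverse.flatMap (fun i => [ladderGate i])) ++
      (List.finRange n).flatMap (fun i => [.not (item i), .hadamard (item i)]))
      (productState φ minus μ) = productState φ minus μ -
        (2 / 2 ^ n * ∏ i, (φ i false + φ i true)) • productState (fun _ => 1) minus μ := by
  have h₁ : ∀ φ : Fin n → Bool → ℂ, applyCircuit f ((List.finRange n).flatMap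
      fun i => [.hadamard (item i), .not (item i)]) (productState φ minus μ) =
      productState (fun i => notMatrix *ᵥ (hadamardMatrix *ᵥ φ i)) minus μ := fun φ => by
    rw [layer_productState (G := fun φ => notMatrix *ᵥ (hadamardMatrix *ᵥ φ)) f
      (fun i φ => ?_) (List.nodup_finRange n)]
    · simp
    · rw [applyCircuit_cons, ← applyCircuit_singleton f (.hadamard (item i)),
        applyCircuit_hadamard_item, applyCircuit_not_item]
      simp
  have h₂ : ∀ φ : Fin n → Bool → ℂ, applyCircuit f ((List.finRange n).flatMap
      fun i => [.not (item i), .hadamard (item i)]) (productState φ minus μ) =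
      productState (fun i => hadamardMatrix *ᵥ (notMatrix *ᵥ φ i)) minus μ := fun φ => by
    rw [layer_productState (G := fun φ => hadamardMatrix *ᵥ (notMatrix *ᵥ φ)) f
      (fun i φ => ?_) (List.nodup_finRange n)]
    · simp
    · rw [applyCircuit_cons, ← applyCircuit_singleton f (.not (item i)),
        applyCircuit_not_item, applyCircuit_hadamard_item]
      simp
  have h₃ : ∀ φ : Bool → ℂ, hadamardMatrix *ᵥ (notMatrix *ᵥ (notMatrix *ᵥ
      (hadamardMatrix *ᵥ φ))) = φ := fun φ => by
    rw [mulVec_mulVec _ notMatrix notMatrix, notMatrix_mul_self, one_mulVec,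
      hadamard_mulVec_mulVec]
  have h₄ : hadamardMatrix *ᵥ (notMatrix *ᵥ ket true) = (Real.sqrt 2 : ℂ)⁻¹ • 1 := by
    rw [← hadamard_mulVec_ket_false, notMatrix_mulVec]
    congr 1
    funext b
    cases b <;> simp
  have h₅ : ∏ i, (notMatrix *ᵥ (hadamardMatrix *ᵥ φ i)) true =
      (Real.sqrt 2 : ℂ)⁻¹ ^ n * ∏ i, (φ i false + φ i true) := by
    simp only [notMatrix_mulVec, Bool.not_true, hadamard_mulVec, Finset.prod_mul_distrib,
      Finset.prod_const, Finset.card_univ, Fintype.card_fin]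
    simp
  have h₆ : (Real.sqrt 2 : ℂ)⁻¹ ^ n * (Real.sqrt 2 : ℂ)⁻¹ ^ n = 1 / 2 ^ n := by
    rw [← mul_pow, ← mul_inv, sqrt_two_mul_self, inv_pow, one_div]
  rw [applyCircuit_append, applyCircuit_append, h₁, conjunction_productState, applyCircuit_add,
    applyCircuit_smul, applyCircuit_sub, minus_not, productState_smul_flag, applyCircuit_smul, h₂,
    h₂, h₅]
  simp only [h₃, h₄]
  rw [productState_const_smul]
  rw [show (2 / 2 ^ n : ℂ) = 2 * ((Real.sqrt 2 : ℂ)⁻¹ ^ n * (Real.sqrt 2 : ℂ)⁻¹ ^ n) by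
    rw [h₆]; ring]
  module

/-- The amplitude of the target state and of the uniform superposition after `k` steps of
Grover's algorithm, up to sign and normalization. -/
def groverAmplitudes (n : ℕ) : ℕ → ℝ × ℝ
  | 0 => (0, 1)
  | k + 1 => let a := groverAmplitudes n k
      (a.1 + 2 * a.2, a.2 - 2 / 2 ^ n * (a.1 + 2 * a.2))

variable {f} {x : Bits n}

/-- The span of the marked state and the uniform one is invariant. The query replaces (p, q) by (-(p
+ 2q), q). The diffusion sends the marked state to itself minus 2/N times the uniform one and
negates the uniform one; an overall sign is pulled out. -/
theorem applyCircuit_grover (hf : ∀ y, f y = true ↔ y = x) (p q : ℂ) (μ : Bool → ℂ) :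
    applyCircuit f (groverCircuit n)
      (p • productState (fun i => ket (x i)) minus μ + q • productState (fun _ => 1) minus μ) =
    (-1 : ℂ) • ((p + 2 * q) • productState (fun i => ket (x i)) minus μ +
      (q - 2 / 2 ^ n * (p + 2 * q)) • productState (fun _ => 1) minus μ) := by
  have hg : groverCircuit n = [queryGate n] ++
      ((List.finRange n).flatMap (fun i => [.hadamard (item i), .not (item i)]) ++
      ((List.finRange n).flatMap (fun i => [ladderGate i]) ++
      [.cnot (anc (Fin.last n)) (flag n) (by simp)] ++
      (List.finRange n).reverse.flatMap (fun i => [ladderGate i])) ++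
      (List.finRange n).flatMap (fun i => [.not (item i), .hadamard (item i)])) := by
    simp only [groverCircuit, List.append_assoc]
  have h2 : (2 : ℂ) ^ n ≠ 0 := pow_ne_zero _ two_ne_zero
  rw [hg, applyCircuit_append]
  generalize hd : (List.finRange n).flatMap (fun i => [.hadamard (item i), .not (item i)]) ++
      ((List.finRange n).flatMap (fun i => [ladderGate i]) ++
      [.cnot (anc (Fin.last n)) (flag n) (by simp)] ++
      (List.finRange n).reverse.flatMap (fun i => [ladderGate i])) ++
      (List.finRange n).flatMap (fun i => [.not (item i), .hadamard (item i)]) = d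
  have hd' := diffusion_productState f (μ := μ)
  rw [hd] at hd'
  simp only [applyCircuit_add, applyCircuit_smul, applyCircuit_sub, queryGate_productState hf,
    minus_not, productState_smul_flag, hd']
  have e1 : ∏ i, (ket (x i) false + ket (x i) true) = (1 : ℂ) :=
    Finset.prod_eq_one fun i _ => by cases x i <;> simp
  have e2 : ∏ _i : Fin n, ((1 : Bool → ℂ) false + (1 : Bool → ℂ) true) = 2 ^ n := by
    norm_num
  have e3 : ∏ i, ket (x i) (x i) = (1 : ℂ) := by simp
  have e4 : ∏ i, (1 : Bool → ℂ) (x i) = 1 := by simp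
  rw [e1, e2, e3, e4]
  match_scalars <;> field_simp <;> ring

end Search

end Histories

end

noncomputable section

namespace Histories

/-! ### The state after the first circuit -/

namespace Search

variable {n : ℕ}

theorem productState_initial (f : Bits n → Bool) :
    applyCircuit f [.not (anc 0)] (Pi.single (fun _ => false) 1) =
      productState (n := n) (fun _ => ket false) (ket false) (ket false) := by
  funext v
  rw [applyCircuit_singleton, Gate.matrix, xorInto_mulVec fun _ _ => rfl]
  by_cases h : Clean v ∧ (∀ i, v (item i) = false) ∧ v (flag n) = false ∧ v (mark n) = false
  · obtain ⟨h₁, h₂, h₃, h₄⟩ := h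
    have hv : Function.update v (anc 0) (xor (v (anc 0)) true) = fun _ => false := by
      funext w
      refine wire_cases (p := fun w => Function.update v (anc 0) _ w = false) (fun i => ?_)
        (fun i => ?_) ?_ ?_ ?_ w
      · by_cases hi : i = 0
        · subst hi; simp [h₁.1]
        · simp [hi, h₁.1, Function.update_of_ne]
      · simp [h₂, Function.update_of_ne]
      · simp [h₃, Function.update_of_ne]
      · simp [h₄, Function.update_of_ne]
      · simp [h₁.2, Function.update_of_ne]
    rw [hv]
    simp [productState, h₁, h₂, h₃, h₄]
  · rw [Pi.single_eq_of_ne]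
    · rw [productState]
      split_ifs with h₁
      · by_contra h'
        refine h ⟨h₁, ?_⟩
        simp only [eq_comm (a := (0 : ℂ)), mul_eq_zero, not_or, Finset.prod_eq_zero_iff,
          Pi.single_apply, ite_eq_right_iff, one_ne_zero, not_exists, not_and] at h'
        simpa [and_assoc] using h'
      · rfl
    · intro h'
      have h'' : v = Function.update (fun _ => false) (anc 0) true := by
        rw [← h']
        have := congrFun h' (anc 0)
        simp at this
        simp [this]
      subst h''
      refine h ⟨⟨fun i => ?_, ?_⟩, fun i => ?_, ?_, ?_⟩
      · by_cases hi : i = 0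
        · subst hi; simp
        · simp [hi, Function.update_of_ne]
      all_goals simp [Function.update_of_ne]

theorem notMatrix_mulVec_ket (b : Bool) : notMatrix *ᵥ ket b = ket !b := by
  rw [notMatrix_mulVec]
  funext c
  cases b <;> cases c <;> simp

theorem applyCircuit_groverStart (f : Bits n → Bool) :
    applyCircuit f (groverStart n) (Pi.single (fun _ => false) 1) =
      (Real.sqrt 2 : ℂ)⁻¹ ^ n • productState (fun _ => 1) minus (ket false) := by
  rw [groverStart, applyCircuit_append, applyCircuit_append, productState_initial,
    hadamard_layer _ (List.nodup_finRange n), applyCircuit_cons, ← applyCircuit_singleton f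
    (.not (flag n)), applyCircuit_not_flag, applyCircuit_hadamard_flag, notMatrix_mulVec_ket]
  simp only [List.mem_finRange, if_true, hadamard_mulVec_ket_false]
  rw [productState_const_smul, minus]
  rfl

theorem applyCircuit_grover_iterate {f : Bits n → Bool} {x : Bits n}
    (hf : ∀ y, f y = true ↔ y = x) (k : ℕ) (μ : Bool → ℂ) :
    applyCircuit f (List.replicate k (groverCircuit n)).flatten
      (productState (fun _ => 1) minus μ) = (-1 : ℂ) ^ k •
      (((groverAmplitudes n k).1 : ℂ) • productState (fun i => ket (x i)) minus μ +
        ((groverAmplitudes n k).2 : ℂ) • productState (fun _ => 1) minus μ) := by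
  induction k with
  | zero => simp [groverAmplitudes]
  | succ k ih =>
    rw [List.replicate_succ', List.flatten_append, applyCircuit_append, ih, applyCircuit_smul,
      List.flatten_singleton, applyCircuit_grover hf, smul_smul, ← pow_succ]
    congr 4 <;> simp [groverAmplitudes]

theorem highItems_nodup (n : ℕ) : (highItems n).Nodup := by
  rw [highItems, List.nodup_ofFn]
  intro i j h
  simp only [Fin.mk.injEq] at h
  exact Fin.ext (by omega)

theorem lowItems_nodup (n : ℕ) : (lowItems n).Nodup := by
  rw [lowItems, List.nodup_ofFn]
  intro i j h
  simp only [Fin.mk.injEq] at h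
  exact Fin.ext (by omega)

theorem mem_highItems {i : Fin n} : i ∈ highItems n ↔ n - 2 * (n / 3) ≤ i := by
  simp only [highItems, List.mem_ofFn]
  constructor
  · rintro ⟨j, rfl⟩; simp
  · intro h
    exact ⟨⟨i - (n - 2 * (n / 3)), by omega⟩, Fin.ext (by simp; omega)⟩

theorem mem_lowItems {i : Fin n} : i ∈ lowItems n ↔ i ∉ highItems n := by
  rw [mem_highItems, not_le]
  simp only [lowItems, List.mem_ofFn]
  constructor
  · rintro ⟨j, rfl⟩; exact j.2
  · intro h
    exact ⟨⟨i, h⟩, rfl⟩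

/-- Apply the Hadamard matrix to the states of the high item bits. -/
def onHigh (φ : Fin n → Bool → ℂ) (i : Fin n) : Bool → ℂ :=
  if i ∈ highItems n then hadamardMatrix *ᵥ φ i else φ i

/-- Apply the Hadamard matrix to the states of the low item bits. -/
def onLow (φ : Fin n → Bool → ℂ) (i : Fin n) : Bool → ℂ :=
  if i ∈ lowItems n then hadamardMatrix *ᵥ φ i else φ i

theorem onHigh_onHigh (φ : Fin n → Bool → ℂ) : onHigh (onHigh φ) = φ := by
  funext i
  simp only [onHigh]
  split_ifs
  · exact hadamard_mulVec_mulVec _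
  · rfl

theorem onLow_onLow (φ : Fin n → Bool → ℂ) : onLow (onLow φ) = φ := by
  funext i
  simp only [onLow]
  split_ifs
  · exact hadamard_mulVec_mulVec _
  · rfl

/-- The amplitude of the marked item after the first circuit. -/
def markedAmplitude (n : ℕ) : ℝ :=
  (Real.sqrt 2)⁻¹ ^ n * ((groverAmplitudes n (2 ^ (n / 3))).1 + (groverAmplitudes n (2 ^ (n / 3))).2)

/-- The amplitude of each unmarked item before its high bits are brought back to `0`. -/
def unmarkedAmplitude (n : ℕ) : ℝ := (Real.sqrt 2)⁻¹ ^ n * (groverAmplitudes n (2 ^ (n / 3))).2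

/-- The superposition of three product states of which all states in a cycle are instances. -/
def triple (n : ℕ) (φ₁ φ₂ φ₃ : Fin n → Bool → ℂ) (χ₁ χ₂ μ₁ : Bool → ℂ) : Bits (2 * n + 4) → ℂ :=
  (markedAmplitude n : ℂ) • productState φ₁ χ₁ μ₁ +
    (unmarkedAmplitude n : ℂ) • productState φ₂ χ₂ (ket false) -
    (unmarkedAmplitude n : ℂ) • productState φ₃ χ₂ (ket false)

/-- The state before and after each cycle. -/
def cycleState {n : ℕ} (x : Bits n) : Bits (2 * n + 4) → ℂ :=
  triple n (fun i => ket (x i)) (onHigh fun _ => 1) (onHigh fun i => ket (x i)) (ket true)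
    (ket false) (ket false)

theorem controlledHadamard_layer (f : Bits n → Bool) (φ : Fin n → Bool → ℂ) (b : Bool)
    (μ : Bool → ℂ) :
    applyCircuit f ((highItems n).flatMap controlledHadamard) (productState φ (ket b) μ) =
      productState (if b then φ else onHigh φ) (ket b) μ := by
  rw [layer_productState (G := fun φ => if b then φ else hadamardMatrix *ᵥ φ) f
    (fun i φ => applyCircuit_controlledHadamard f i φ b μ) (highItems_nodup n)]
  cases b
  · rfl
  · simp

/-- Unmarked items are described as all items minus `x`, which keeps everything a combination of
three product states. The flag takes basis values in each, so the controlled Hadamards act on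
products. -/
theorem applyCircuit_groverEnd {f : Bits n → Bool} {x : Bits n}
    (hf : ∀ y, f y = true ↔ y = x) (p q : ℂ) (μ : Bool → ℂ) :
    applyCircuit f (groverEnd n)
      (p • productState (fun i => ket (x i)) minus μ + q • productState (fun _ => 1) minus μ) =
    (p + q) • productState (fun i => ket (x i)) (ket true) μ +
      q • productState (onHigh fun _ => 1) (ket false) μ -
      q • productState (onHigh fun i => ket (x i)) (ket false) μ := by
  have h : ∀ φ, applyCircuit f [.hadamard (flag n), .not (flag n), queryGate n]
      (productState φ minus μ) = productState φ (ket false) μ +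
      (∏ i, φ i (x i)) • (productState (fun i => ket (x i)) (ket true) μ -
        productState (fun i => ket (x i)) (ket false) μ) := fun φ => by
    have hk : (fun b => ket false !b) = ket true := by
      funext b
      cases b <;> simp
    rw [applyCircuit_cons, ← applyCircuit_singleton f (.hadamard (flag n)),
      applyCircuit_hadamard_flag, applyCircuit_cons, ← applyCircuit_singleton f (.not (flag n)),
      applyCircuit_not_flag, queryGate_productState hf, minus, hadamard_mulVec_mulVec,
      notMatrix_mulVec_ket, Bool.not_true, hk]
  rw [groverEnd, applyCircuit_append, applyCircuit_add, applyCircuit_smul, applyCircuit_smul, h, h]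
  simp only [applyCircuit_add, applyCircuit_smul, applyCircuit_sub, controlledHadamard_layer]
  simp
  module

theorem applyCircuit_prepCircuit {f : Bits n → Bool} {x : Bits n}
    (hf : ∀ y, f y = true ↔ y = x) (hn : 3 ≤ n) :
    applyCircuit f (prepCircuit n) (Pi.single (fun _ => false) 1) = cycleState x := by
  -- The number of Grover steps is even once `n ≥ 3`, so their signs cancel.
  have he : (-1 : ℂ) ^ 2 ^ (n / 3) = 1 :=
    Even.neg_one_pow ((Nat.even_pow' (by omega)).2 even_two)
  rw [prepCircuit, applyCircuit_append, applyCircuit_append, applyCircuit_groverStart,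
    applyCircuit_smul, applyCircuit_grover_iterate hf, he, one_smul, applyCircuit_smul,
    applyCircuit_groverEnd hf, cycleState, triple, markedAmplitude, unmarkedAmplitude]
  push_cast
  module

theorem lowHadamards_productState (f : Bits n → Bool) (φ : Fin n → Bool → ℂ) (χ μ : Bool → ℂ) :
    applyCircuit f (lowHadamards n) (productState φ χ μ) = productState (onLow φ) χ μ :=
  hadamard_layer f (lowItems_nodup n) φ χ μ

theorem highHadamards_productState (f : Bits n → Bool) (φ : Fin n → Bool → ℂ) (χ μ : Bool → ℂ) :
    applyCircuit f (highHadamards n) (productState φ χ μ) = productState (onHigh φ) χ μ :=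
  hadamard_layer f (highItems_nodup n) φ χ μ

theorem lowHadamards_triple (f : Bits n → Bool) (φ₁ φ₂ φ₃ : Fin n → Bool → ℂ)
    (χ₁ χ₂ μ₁ : Bool → ℂ) : applyCircuit f (lowHadamards n) (triple n φ₁ φ₂ φ₃ χ₁ χ₂ μ₁) =
      triple n (onLow φ₁) (onLow φ₂) (onLow φ₃) χ₁ χ₂ μ₁ := by
  simp only [triple, applyCircuit_add, applyCircuit_smul, applyCircuit_sub,
    lowHadamards_productState]

theorem highHadamards_triple (f : Bits n → Bool) (φ₁ φ₂ φ₃ : Fin n → Bool → ℂ)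
    (χ₁ χ₂ μ₁ : Bool → ℂ) : applyCircuit f (highHadamards n) (triple n φ₁ φ₂ φ₃ χ₁ χ₂ μ₁) =
      triple n (onHigh φ₁) (onHigh φ₂) (onHigh φ₃) χ₁ χ₂ μ₁ := by
  simp only [triple, applyCircuit_add, applyCircuit_smul, applyCircuit_sub,
    highHadamards_productState]

theorem flagHadamard_triple (f : Bits n → Bool) (φ₁ φ₂ φ₃ : Fin n → Bool → ℂ)
    (χ₁ χ₂ μ₁ : Bool → ℂ) : applyCircuit f (flagHadamard n) (triple n φ₁ φ₂ φ₃ χ₁ χ₂ μ₁) =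
      triple n φ₁ φ₂ φ₃ (hadamardMatrix *ᵥ χ₁) (hadamardMatrix *ᵥ χ₂) μ₁ := by
  simp only [triple, applyCircuit_add, applyCircuit_smul, applyCircuit_sub,
    applyCircuit_hadamard_flag, flagHadamard]

theorem markCircuit_triple (f : Bits n → Bool) (φ₁ φ₂ φ₃ : Fin n → Bool → ℂ) (b : Bool) :
    applyCircuit f (markCircuit n) (triple n φ₁ φ₂ φ₃ (ket true) (ket false) (ket b)) =
      triple n φ₁ φ₂ φ₃ (ket true) (ket false) (ket !b) := by
  have hk : (fun c => ket b !c) = ket !b := by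
    funext c
    cases b <;> cases c <;> simp
  simp only [triple, applyCircuit_add, applyCircuit_smul, applyCircuit_sub,
    applyCircuit_singleton, markCircuit, Gate.matrix, cnot_flag_mark_productState, Bool.xor_true,
    Bool.xor_false, hk]

end Search

end Histories

end

noncomputable section

namespace Histories

/-! ### Amplitudes of the basis states -/

namespace Search

variable {n : ℕ}

/-- The clean basis state with item bits `y`, flag `c` and mark `d`. -/
def basisState (y : Bits n) (c d : Bool) : Bits (2 * n + 4) := fun w =>
  if (w : ℕ) = 0 then c else if (w : ℕ) = 2 * n + 2 then d else
    if h : (w : ℕ) % 2 = 0 ∧ 0 < (w : ℕ) ∧ (w : ℕ) < 2 * n + 2 then y ⟨w / 2 - 1, by omega⟩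
    else decide ((w : ℕ) = 1)

@[simp] theorem basisState_flag (y : Bits n) (c d : Bool) : basisState y c d (flag n) = c := by
  simp [basisState, flag]

@[simp] theorem basisState_mark (y : Bits n) (c d : Bool) : basisState y c d (mark n) = d := by
  simp [basisState, mark]

@[simp] theorem basisState_item (y : Bits n) (c d : Bool) (i : Fin n) :
    basisState y c d (item i) = y i := by
  have hw : ((item i : Fin (2 * n + 4)) : ℕ) = 2 * i + 2 := rfl
  rw [basisState, if_neg (by omega), if_neg (by omega), dif_pos (by omega)]
  congr 1
  exact Fin.ext (by simp [hw])

@[simp] theorem basisState_anc (y : Bits n) (c d : Bool) (i : Fin (n + 1)) :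
    basisState y c d (anc i) = decide (i = 0) := by
  have hw : ((anc i : Fin (2 * n + 4)) : ℕ) = 2 * i + 1 := rfl
  rw [basisState, if_neg (by omega), if_neg (by omega), dif_neg (by omega), decide_eq_decide, hw,
    Fin.ext_iff]
  simp

@[simp] theorem basisState_pad (y : Bits n) (c d : Bool) : basisState y c d (pad n) = false := by
  have hw : ((pad n : Fin (2 * n + 4)) : ℕ) = 2 * n + 3 := rfl
  rw [basisState, if_neg (by omega), if_neg (by omega), dif_neg (by omega), hw]
  simp

@[simp] theorem clean_basisState (y : Bits n) (c d : Bool) : Clean (basisState y c d) := by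
  simp [Clean]

theorem Clean.eq_basisState {v : Bits (2 * n + 4)} (hv : Clean v) :
    v = basisState (fun i => v (item i)) (v (flag n)) (v (mark n)) := by
  funext w
  refine wire_cases (p := fun w => v w = basisState _ _ _ w) (fun i => ?_) (fun i => ?_) ?_ ?_ ?_ w
  · simp [hv.1]
  · simp
  · simp
  · simp
  · simp [hv.2]

theorem basisState_injective (c d : Bool) :
    Function.Injective fun y : Bits n => basisState y c d := fun y y' h => by
  funext i
  simpa using congrFun h (item i)

theorem productState_basisState (φ : Fin n → Bool → ℂ) (χ μ : Bool → ℂ) (y : Bits n)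
    (c d : Bool) : productState φ χ μ (basisState y c d) = (∏ i, φ i (y i)) * χ c * μ d := by
  simp [productState]

theorem triple_basisState (φ₁ φ₂ φ₃ : Fin n → Bool → ℂ) (χ₁ χ₂ μ₁ : Bool → ℂ) (y : Bits n)
    (c d : Bool) : triple n φ₁ φ₂ φ₃ χ₁ χ₂ μ₁ (basisState y c d) =
      markedAmplitude n * ((∏ i, φ₁ i (y i)) * χ₁ c * μ₁ d) +
      unmarkedAmplitude n * ((∏ i, φ₂ i (y i)) * χ₂ c * ket false d) -
      unmarkedAmplitude n * ((∏ i, φ₃ i (y i)) * χ₂ c * ket false d) := by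
  simp only [triple, Pi.add_apply, Pi.sub_apply, Pi.smul_apply, smul_eq_mul,
    productState_basisState]

theorem prod_ket (x y : Bits n) : ∏ i, ket (x i) (y i) = if y = x then (1 : ℂ) else 0 := by
  split_ifs with h
  · subst h; simp
  · obtain ⟨i, hi⟩ := Function.ne_iff.1 h
    exact Finset.prod_eq_zero (Finset.mem_univ i) (Pi.single_eq_of_ne hi _)

theorem prod_high (a : ℂ) :
    ∏ i : Fin n, (if i ∈ highItems n then a else 1) = a ^ (2 * (n / 3)) := by
  have h : (Finset.univ.filter fun i : Fin n => i ∈ highItems n) = (highItems n).toFinset := by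
    ext i; simp
  rw [Finset.prod_ite, Finset.prod_const, Finset.prod_const_one, mul_one, h,
    List.toFinset_card_of_nodup (highItems_nodup n)]
  simp [highItems]

theorem sqrt_two_pow (m : ℕ) : (Real.sqrt 2 : ℂ) ^ (2 * m) = 2 ^ m := by
  rw [pow_mul, pow_two, sqrt_two_mul_self]

theorem inv_sqrt_two_pow (m : ℕ) : (Real.sqrt 2 : ℂ)⁻¹ ^ (2 * m) = (2 ^ m)⁻¹ := by
  rw [inv_pow, sqrt_two_pow]

theorem prod_onHigh_one {y : Bits n} (hy : ∀ i ∈ highItems n, y i = false) :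
    ∏ i, onHigh (fun _ => 1) i (y i) = (2 : ℂ) ^ (n / 3) := by
  rw [← sqrt_two_pow, ← prod_high]
  refine Finset.prod_congr rfl fun i _ => ?_
  simp only [onHigh]
  split_ifs with h
  · simp [hadamard_mulVec_one, hy i h]
  · rfl

/-- Hadamards on 2⌊n/3⌋ bits spread one basis state over K² states with amplitudes ±1/K; the sign is
the parity of the common ones of `x` and `y` among the high bits. -/
theorem prod_onHigh_ket {x y : Bits n} (hy : ∀ i ∉ highItems n, y i = x i) :
    ∏ i, onHigh (fun i => ket (x i)) i (y i) = ((2 : ℂ) ^ (n / 3))⁻¹ ∨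
      ∏ i, onHigh (fun i => ket (x i)) i (y i) = -((2 : ℂ) ^ (n / 3))⁻¹ := by
  have h : ∀ i, onHigh (fun i => ket (x i)) i (y i) =
      (if i ∈ highItems n then (Real.sqrt 2 : ℂ)⁻¹ else 1) *
        (if i ∈ highItems n ∧ x i ∧ y i then -1 else 1) := fun i => by
    simp only [onHigh]
    split_ifs with h₁ h₂ h₂ <;> simp_all [hadamard_mulVec]
    · cases hx : x i <;> cases hy' : y i <;> simp_all
  rw [Finset.prod_congr rfl fun i _ => h i, Finset.prod_mul_distrib, prod_high, inv_sqrt_two_pow]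
  have hs : ∏ i, (if i ∈ highItems n ∧ x i ∧ y i then (-1 : ℂ) else 1) = 1 ∨
      ∏ i, (if i ∈ highItems n ∧ x i ∧ y i then (-1 : ℂ) else 1) = -1 := by
    refine Finset.prod_induction _ (fun z : ℂ => z = 1 ∨ z = -1) ?_ (Or.inl rfl) fun i _ => ?_
    · rintro _ _ (rfl | rfl) (rfl | rfl) <;> simp
    · split_ifs <;> simp
  rcases hs with hs | hs <;> rw [hs] <;> simp

theorem prod_onHigh_ket_of_false {x y : Bits n} (hy : ∀ i ∉ highItems n, y i = x i)
    (hy' : ∀ i ∈ highItems n, y i = false) :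
    ∏ i, onHigh (fun i => ket (x i)) i (y i) = ((2 : ℂ) ^ (n / 3))⁻¹ := by
  rw [← inv_sqrt_two_pow, ← prod_high]
  refine Finset.prod_congr rfl fun i _ => ?_
  simp only [onHigh]
  split_ifs with h
  · rw [hadamard_mulVec, hy' i h]
    cases x i <;> simp
  · simp [hy i h]

theorem onLow_onHigh (φ : Fin n → Bool → ℂ) :
    onLow (onHigh φ) = fun i => hadamardMatrix *ᵥ φ i := by
  funext i
  simp only [onLow, onHigh, mem_lowItems]
  split_ifs <;> simp_all

theorem norm_prod_hadamard_ket (x y : Bits n) :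
    ‖∏ i, (hadamardMatrix *ᵥ ket (x i)) (y i)‖ = (Real.sqrt 2)⁻¹ ^ n := by
  rw [norm_prod]
  have : ∀ i, ‖(hadamardMatrix *ᵥ ket (x i)) (y i)‖ = (Real.sqrt 2)⁻¹ := fun i => by
    rw [hadamard_mulVec]
    cases x i <;> cases y i <;> simp [abs_of_nonneg]
  rw [Finset.prod_congr rfl fun i _ => this i, Finset.prod_const, Finset.card_univ,
    Fintype.card_fin]

theorem inv_sqrt_two_pow_sq (n : ℕ) : (Real.sqrt 2)⁻¹ ^ n * (Real.sqrt 2)⁻¹ ^ n = (2 ^ n)⁻¹ := by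
  rw [← mul_pow, ← mul_inv, Real.mul_self_sqrt zero_le_two, inv_pow]

/-- The amplitude of the uniform superposition in Grover's algorithm. -/
def uniformAmplitude (n : ℕ) : ℝ := (groverAmplitudes n (2 ^ (n / 3))).2

/-- The state after the first circuit of a cycle. -/
def lowState (x : Bits n) : Bits (2 * n + 4) → ℂ :=
  triple n (onLow fun i => ket (x i)) (onLow (onHigh fun _ => 1))
    (onLow (onHigh fun i => ket (x i))) (ket true) (ket false) (ket false)

/-- The state after the third circuit of a cycle. -/
def highState (x : Bits n) : Bits (2 * n + 4) → ℂ :=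
  triple n (onHigh fun i => ket (x i)) (fun _ => 1) (fun i => ket (x i)) (ket true) (ket false)
    (ket false)

/-- The state after the fourth circuit of a cycle. -/
def flagState (x : Bits n) : Bits (2 * n + 4) → ℂ :=
  triple n (onHigh fun i => ket (x i)) (fun _ => 1) (fun i => ket (x i))
    (hadamardMatrix *ᵥ ket true) (hadamardMatrix *ᵥ ket false) (ket false)

/-- The state after the seventh circuit of a cycle. -/
def markState (x : Bits n) : Bits (2 * n + 4) → ℂ :=
  triple n (fun i => ket (x i)) (onHigh fun _ => 1) (onHigh fun i => ket (x i)) (ket true)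
    (ket false) (ket true)

/-- Together the low and high Hadamards act on all item bits, so the uniform superposition becomes
the all-zero item. The correction 1/N comes from the absence of `x` from the unmarked part. -/
theorem lowState_origin (x : Bits n) : lowState x (basisState (fun _ => false) false false) =
    (uniformAmplitude n * (1 - (2 ^ n)⁻¹) : ℝ) := by
  have h0 := sqrt_two_ne_zero
  rw [lowState, triple_basisState, onLow_onHigh, onLow_onHigh]
  have h : ∀ i, (hadamardMatrix *ᵥ ket (x i)) false = (Real.sqrt 2 : ℂ)⁻¹ := fun i => by
    rw [hadamard_mulVec]
    cases x i <;> simp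
  have hs : (Real.sqrt 2 : ℂ)⁻¹ ^ n * (Real.sqrt 2 : ℂ) ^ n = 1 := by
    rw [← mul_pow, inv_mul_cancel₀ h0, one_pow]
  have hs' : (Real.sqrt 2 : ℂ)⁻¹ ^ n * (Real.sqrt 2 : ℂ)⁻¹ ^ n = (2 ^ n)⁻¹ := by
    rw [← mul_pow, ← mul_inv, sqrt_two_mul_self, inv_pow]
  simp only [h, hadamard_mulVec_one, unmarkedAmplitude, uniformAmplitude, Finset.prod_const,
    Finset.card_univ, Fintype.card_fin]
  simp only [Pi.smul_apply, Pi.single_eq_same, ne_eq, Bool.false_eq_true, not_false_eq_true,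
    Pi.single_eq_of_ne, smul_eq_mul, mul_one, mul_zero, zero_add]
  push_cast
  linear_combination ((groverAmplitudes n (2 ^ (n / 3))).2 : ℂ) * hs -
    ((groverAmplitudes n (2 ^ (n / 3))).2 : ℂ) * hs'

theorem norm_lowState {x y : Bits n} (hy : y ≠ fun _ => false) :
    ‖lowState x (basisState y false false)‖ ^ 2 = (uniformAmplitude n * (2 ^ n)⁻¹) ^ 2 := by
  obtain ⟨i, hi⟩ := Function.ne_iff.1 hy
  rw [lowState, triple_basisState, onLow_onHigh, onLow_onHigh,
    Finset.prod_eq_zero (f := fun i => (hadamardMatrix *ᵥ (1 : Bool → ℂ)) (y i))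
      (Finset.mem_univ i) (by rw [hadamard_mulVec_one]; simp [Pi.single_eq_of_ne hi])]
  simp only [Pi.single_eq_same, ne_eq, Bool.false_eq_true, not_false_eq_true,
    Pi.single_eq_of_ne, mul_one, mul_zero, zero_add, zero_sub, norm_neg, norm_mul,
    norm_prod_hadamard_ket, Complex.norm_real, Real.norm_eq_abs, unmarkedAmplitude,
    uniformAmplitude, ← inv_sqrt_two_pow_sq]
  rw [mul_pow, mul_pow, sq_abs, sq_abs]
  ring

/-- The uniform block of K² items contributes K, and the missing item `x` takes away 1/K. -/
theorem cycleState_low {x y : Bits n} (hy : ∀ i ∉ highItems n, y i = x i)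
    (hy' : ∀ i ∈ highItems n, y i = false) : cycleState x (basisState y false false) =
      (unmarkedAmplitude n * (2 ^ (n / 3) - (2 ^ (n / 3))⁻¹) : ℝ) := by
  rw [cycleState, triple_basisState, prod_onHigh_one hy', prod_onHigh_ket_of_false hy hy']
  simp
  ring

theorem cycleState_flag (x y : Bits n) (d : Bool) : cycleState x (basisState y true d) =
    if y = x ∧ d = false then (markedAmplitude n : ℂ) else 0 := by
  rw [cycleState, triple_basisState, prod_ket]
  by_cases h : y = x <;> cases d <;> simp [h]

theorem highState_low (x y : Bits n) : highState x (basisState y false false) =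
    if y = x then 0 else (unmarkedAmplitude n : ℂ) := by
  rw [highState, triple_basisState, prod_ket]
  by_cases h : y = x <;> simp [h]

theorem norm_highState_flag {x y : Bits n} (hy : ∀ i ∉ highItems n, y i = x i) :
    ‖highState x (basisState y true false)‖ ^ 2 = (markedAmplitude n / 2 ^ (n / 3)) ^ 2 := by
  rw [highState, triple_basisState]
  rcases prod_onHigh_ket hy with h | h <;> rw [h] <;> simp [mul_pow, div_eq_mul_inv]

/-- The last Hadamard makes the amplitudes of flag 0 and flag 1 interfere. `c` is the flag value
where they add up; it depends on the sign in `prod_onHigh_ket`. -/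
theorem norm_flagState {x y : Bits n} (hy : ∀ i ∉ highItems n, y i = x i) (hyx : y ≠ x) :
    ∃ c, ‖flagState x (basisState y c false)‖ ^ 2 =
        (unmarkedAmplitude n + markedAmplitude n / 2 ^ (n / 3)) ^ 2 / 2 ∧
      ‖flagState x (basisState y (!c) false)‖ ^ 2 =
        (unmarkedAmplitude n - markedAmplitude n / 2 ^ (n / 3)) ^ 2 / 2 := by
  have key : ∀ a : ℝ, ‖((Real.sqrt 2)⁻¹ * a : ℝ)‖ ^ 2 = a ^ 2 / 2 := fun a => by
    rw [Real.norm_eq_abs, sq_abs, mul_pow, inv_pow, Real.sq_sqrt zero_le_two]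
    ring
  have hval : ∀ (c : Bool) (e : ℝ), ∏ i, onHigh (fun i => ket (x i)) i (y i) = (e : ℂ) →
      flagState x (basisState y c false) = (((Real.sqrt 2)⁻¹ * (unmarkedAmplitude n +
        if c then -(markedAmplitude n * e) else markedAmplitude n * e) : ℝ) : ℂ) := fun c e he => by
    rw [flagState, triple_basisState, prod_ket, he, if_neg hyx, hadamard_mulVec, hadamard_mulVec]
    cases c <;> simp <;> ring
  rcases prod_onHigh_ket hy with h | h
  · refine ⟨false, ?_, ?_⟩ <;>
    · rw [hval _ (2 ^ (n / 3))⁻¹ (by rw [h]; push_cast; rfl), Complex.norm_real, key]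
      simp
      ring
  · refine ⟨true, ?_, ?_⟩ <;>
    · rw [hval _ (-(2 ^ (n / 3))⁻¹) (by rw [h]; push_cast; rfl), Complex.norm_real, key]
      simp
      ring

theorem markState_flag (x y : Bits n) : markState x (basisState y true false) = 0 := by
  simp [markState, triple_basisState]

/-! ### Bounds on the amplitudes -/

theorem two_pow_le_iteration (n : ℕ) : ((2 : ℝ) ^ (n / 3)) ^ 3 ≤ 2 ^ n := by
  rw [← pow_mul]
  exact pow_le_pow_right₀ one_le_two (by omega)

/-- K is far below √N, so the uniform amplitude hardly drops from 1 and the marked one grows by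
nearly 2 in each step. -/
theorem groverAmplitudes_bounds (hn : 6 ≤ n) {k : ℕ} (hk : k ≤ 2 ^ (n / 3)) :
    2 * k * (1 - 4 / 2 ^ (n / 3)) ≤ (groverAmplitudes n k).1 ∧ (groverAmplitudes n k).1 ≤ 2 * k ∧
      1 - 4 / 2 ^ (n / 3) ≤ (groverAmplitudes n k).2 ∧ (groverAmplitudes n k).2 ≤ 1 := by
  have hK4 : (4 : ℝ) ≤ 2 ^ (n / 3) := by
    calc (4 : ℝ) = 2 ^ 2 := by norm_num
      _ ≤ 2 ^ (n / 3) := pow_le_pow_right₀ one_le_two (by omega)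
  have hN := two_pow_le_iteration n
  set K : ℝ := 2 ^ (n / 3) with hK
  have hK0 : 0 < K := by linarith
  have hN0 : (0 : ℝ) < 2 ^ n := by positivity
  have hd : 4 / K ≤ 1 := (div_le_one hK0).2 hK4
  have hsmall : ∀ k : ℝ, 0 ≤ k → k ≤ K → 2 / 2 ^ n * (k * (k + 1)) ≤ 4 / K := fun k hk₀ hk => by
    rw [div_mul_eq_mul_div, div_le_div_iff₀ hN0 hK0]
    have h1 : k * (k + 1) ≤ K * (2 * K) := mul_le_mul hk (by linarith) (by linarith) hK0.le
    have h2 := mul_le_mul_of_nonneg_right h1 hK0.le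
    nlinarith
  -- The induction needs the sharper bound 1 - (2/N)k(k + 1): step k costs at most (2/N)·2(k + 1),
  -- the increment of that expression. By `hsmall` the total loss is at most 4/K, because K³ ≤ N.
  have key : 2 * k * (1 - 4 / K) ≤ (groverAmplitudes n k).1 ∧ (groverAmplitudes n k).1 ≤ 2 * k ∧
      1 - 2 / 2 ^ n * (k * (k + 1)) ≤ (groverAmplitudes n k).2 ∧
      (groverAmplitudes n k).2 ≤ 1 := by
    induction k with
    | zero => simp [groverAmplitudes]
    | succ k ih =>
      obtain ⟨h1, h2, h3, h4⟩ := ih (by omega)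
      have hkK : (k : ℝ) ≤ K := by
        rw [hK]; exact_mod_cast (Nat.le_succ k).trans hk
      have h5 := hsmall k (Nat.cast_nonneg k) hkK
      simp only [groverAmplitudes]
      push_cast
      set p := (groverAmplitudes n k).1
      set q := (groverAmplitudes n k).2
      have hp0 : 0 ≤ p := le_trans (mul_nonneg (by positivity) (by linarith)) h1
      have hN2 : (0 : ℝ) ≤ 2 / 2 ^ n := by positivity
      have h6 := mul_le_mul_of_nonneg_left (show p + 2 * q ≤ 2 * (k + 1) by linarith) hN2
      refine ⟨by nlinarith, by linarith, by nlinarith, ?_⟩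
      have : 0 ≤ 2 / 2 ^ n * (p + 2 * q) := mul_nonneg hN2 (by linarith)
      linarith
  obtain ⟨h1, h2, h3, h4⟩ := key
  have := hsmall k (Nat.cast_nonneg k) (by rw [hK]; exact_mod_cast hk)
  exact ⟨h1, h2, by linarith, h4⟩

theorem le_uniformAmplitude (hn : 30 ≤ n) : 99 / 100 ≤ uniformAmplitude n := by
  have h := (groverAmplitudes_bounds (by omega : 6 ≤ n) le_rfl).2.2.1
  have hK : (1024 : ℝ) ≤ 2 ^ (n / 3) := by
    calc (1024 : ℝ) = 2 ^ 10 := by norm_num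
      _ ≤ 2 ^ (n / 3) := pow_le_pow_right₀ one_le_two (by omega)
  have : 4 / (2 : ℝ) ^ (n / 3) ≤ 4 / 1024 := div_le_div_of_nonneg_left (by norm_num) (by norm_num) hK
  rw [uniformAmplitude]
  linarith

theorem unmarkedAmplitude_sq (n : ℕ) :
    unmarkedAmplitude n ^ 2 = uniformAmplitude n ^ 2 / 2 ^ n := by
  rw [unmarkedAmplitude, mul_pow, pow_two ((Real.sqrt 2)⁻¹ ^ n), inv_sqrt_two_pow_sq,
    uniformAmplitude]
  ring

theorem unmarkedAmplitude_pos (hn : 30 ≤ n) : 0 < unmarkedAmplitude n := by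
  have := le_uniformAmplitude hn
  rw [uniformAmplitude] at this
  rw [unmarkedAmplitude]
  exact mul_pos (by positivity) (by linarith)

/-- After Grover's algorithm the amplitudes that meet in the last qubit are about `1 : 2`. -/
theorem amplitude_ratio (hn : 30 ≤ n) :
    199 / 100 * unmarkedAmplitude n ≤ markedAmplitude n / 2 ^ (n / 3) ∧
      markedAmplitude n / 2 ^ (n / 3) ≤ 203 / 100 * unmarkedAmplitude n := by
  obtain ⟨h1, h2, h3, h4⟩ := groverAmplitudes_bounds (by omega : 6 ≤ n) (le_refl (2 ^ (n / 3)))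
  have hK : (1024 : ℝ) ≤ 2 ^ (n / 3) := by
    calc (1024 : ℝ) = 2 ^ 10 := by norm_num
      _ ≤ 2 ^ (n / 3) := pow_le_pow_right₀ one_le_two (by omega)
  have h5 : 4 / (2 : ℝ) ^ (n / 3) ≤ 4 / 1024 := div_le_div_of_nonneg_left (by norm_num) (by norm_num) hK
  have hs : (0 : ℝ) < (Real.sqrt 2)⁻¹ ^ n := by positivity
  rw [markedAmplitude, unmarkedAmplitude]
  push_cast at h1 h2
  set K : ℝ := 2 ^ (n / 3)
  set p := (groverAmplitudes n (2 ^ (n / 3))).1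
  set q := (groverAmplitudes n (2 ^ (n / 3))).2
  set s := (Real.sqrt 2)⁻¹ ^ n
  have hK0 : 0 < K := by linarith
  constructor
  · have h6 : K * (199 / 100) * q ≤ K * (199 / 100) := mul_le_of_le_one_right (by positivity) h4
    have h7 : 2 * K * (1 - 4 / 1024) ≤ 2 * K * (1 - 4 / K) :=
      mul_le_mul_of_nonneg_left (by linarith) (by positivity)
    rw [le_div_iff₀ hK0, show 199 / 100 * (s * q) * K = s * (K * (199 / 100) * q) by ring]
    exact mul_le_mul_of_nonneg_left (by linarith) hs.le
  · have h6 : K * (203 / 100) * (1 - 4 / 1024) ≤ K * (203 / 100) * q :=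
      mul_le_mul_of_nonneg_left (by linarith) (by positivity)
    rw [div_le_iff₀ hK0, show 203 / 100 * (s * q) * K = s * (K * (203 / 100) * q) by ring]
    exact mul_le_mul_of_nonneg_left (by linarith) hs.le

end Search

end Histories

end

noncomputable section

namespace Histories

/-! ### Markov steps -/

section Transition

variable {V : Type*} [Fintype V]

/-- A stochastic matrix that maps the measurement distribution of `ψ` to that of `ψ'`. -/
structure IsTransition (S : Matrix V V ℝ) (ψ ψ' : V → ℂ) : Prop where
  nonneg : ∀ y x, 0 ≤ S y x
  sum_col : ∀ x, ∑ y, S y x = 1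
  marginal : ∀ y, ∑ x, S y x * ‖ψ x‖ ^ 2 = ‖ψ' y‖ ^ 2

/-- A mass distribution is bounded by the measurement distribution of `ψ`. -/
structure Dominated (q : V → ℝ) (ψ : V → ℂ) : Prop where
  nonneg : ∀ v, 0 ≤ q v
  le : ∀ v, q v ≤ ‖ψ v‖ ^ 2

/-- One step of a Markov chain, after which the mass on the states in `s` is removed. -/
def killedStep (s : V → Prop) [DecidablePred s] (S : Matrix V V ℝ) (q : V → ℝ) (y : V) : ℝ :=
  if s y then 0 else ∑ x, S y x * q x

namespace IsTransition

variable {S : Matrix V V ℝ} {ψ ψ' : V → ℂ} (s : V → Prop) [DecidablePred s] {q : V → ℝ}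

/-- The flow along one edge cannot exceed the weight of its target. This is the general tool for
bounding the transitions of an unknown theory from above. -/
theorem mul_le (h : IsTransition S ψ ψ') (y x : V) : S y x * ‖ψ x‖ ^ 2 ≤ ‖ψ' y‖ ^ 2 := by
  rw [← h.marginal y]
  exact Finset.single_le_sum (f := fun x => S y x * ‖ψ x‖ ^ 2)
    (fun x _ => mul_nonneg (h.nonneg y x) (sq_nonneg _)) (Finset.mem_univ x)

theorem eq_zero (h : IsTransition S ψ ψ') {y x : V} (hy : ψ' y = 0) (hx : ψ x ≠ 0) :
    S y x = 0 := by
  have h1 := h.mul_le y x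
  rw [hy, norm_zero, zero_pow two_ne_zero] at h1
  have hpos : 0 < ‖ψ x‖ ^ 2 := by positivity
  exact le_antisymm (nonpos_of_mul_nonpos_left h1 hpos) (h.nonneg y x)

theorem le_one (h : IsTransition S ψ ψ') (y x : V) : S y x ≤ 1 := by
  rw [← h.sum_col x]
  exact Finset.single_le_sum (f := fun y => S y x) (fun y _ => h.nonneg y x) (Finset.mem_univ y)

theorem dominated_killedStep (h : IsTransition S ψ ψ') (hq : Dominated q ψ) :
    Dominated (killedStep s S q) ψ' := by
  constructor <;> intro y <;> rw [killedStep] <;> split_ifs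
  · exact le_rfl
  · exact Finset.sum_nonneg fun x _ => mul_nonneg (h.nonneg y x) (hq.nonneg x)
  · positivity
  · rw [← h.marginal y]
    exact Finset.sum_le_sum fun x _ => mul_le_mul_of_nonneg_left (hq.le x) (h.nonneg y x)

theorem sum_mul (h : IsTransition S ψ ψ') (q : V → ℝ) : ∑ y, ∑ x, S y x * q x = ∑ x, q x := by
  rw [Finset.sum_comm]
  refine Finset.sum_congr rfl fun x _ => ?_
  rw [← Finset.sum_mul, h.sum_col, one_mul]

theorem sum_killedStep_le (h : IsTransition S ψ ψ') (hq : Dominated q ψ) :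
    ∑ y, killedStep s S q y ≤ ∑ x, q x := by
  rw [← h.sum_mul q]
  refine Finset.sum_le_sum fun y _ => ?_
  rw [killedStep]
  split_ifs
  · exact Finset.sum_nonneg fun x _ => mul_nonneg (h.nonneg y x) (hq.nonneg x)
  · exact le_rfl

/-- If all mass at `x₀` is removed in a step then the total mass decreases by it. -/
theorem sum_killedStep_le_sub [DecidableEq V] (h : IsTransition S ψ ψ') (hq : Dominated q ψ)
    {x₀ : V} (hx₀ : ∀ y, ¬ s y → S y x₀ = 0) :
    ∑ y, killedStep s S q y ≤ ∑ x, q x - q x₀ := by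
  -- Deleting the mass at `x₀` beforehand does not change the result of the step, and the smaller
  -- distribution cannot gain mass.
  have h0 : Dominated (Function.update q x₀ 0) ψ := by
    constructor <;> intro v <;> by_cases hv : v = x₀
    · subst hv; simp
    · simpa [hv] using hq.nonneg v
    · subst hv; simp
    · simpa [hv] using hq.le v
  have h1 := h.sum_killedStep_le s h0
  have h2 : ∑ x, Function.update q x₀ 0 x = ∑ x, q x - q x₀ := by
    rw [Finset.sum_update_of_mem (Finset.mem_univ _), zero_add,
      ← Finset.sum_sdiff (Finset.subset_univ {x₀})]
    simp
  rw [h2] at h1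
  refine le_trans (Finset.sum_le_sum fun y _ => ?_) h1
  rw [killedStep, killedStep]
  split_ifs with hy
  · exact le_rfl
  · refine (Finset.sum_congr rfl fun x _ => ?_).le
    by_cases hx : x = x₀
    · subst hx; simp [hx₀ y hy]
    · simp [hx]

theorem mul_le_killedStep (h : IsTransition S ψ ψ') (hq : Dominated q ψ) {y : V} (hy : ¬ s y)
    (x : V) : S y x * q x ≤ killedStep s S q y := by
  rw [killedStep, if_neg hy]
  exact Finset.single_le_sum (f := fun x => S y x * q x)
    (fun x _ => mul_nonneg (h.nonneg y x) (hq.nonneg x)) (Finset.mem_univ x)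

end IsTransition

end Transition

/-! ### The hidden-variable chain with the mass on chosen states removed. -/

section Survivors

variable {l n : ℕ} {𝒯 : HiddenVariableTheory} (f : Bits n → Bool)

theorem isTransition (𝒯 : HiddenVariableTheory) {ψ : Bits l → ℂ} (hψ : ∑ x, ‖ψ x‖ ^ 2 = 1)
    (c : List (Gate n l)) :
    IsTransition (𝒯.S (pureState ψ) (circuitMatrix f c)) ψ (applyCircuit f c ψ) := by
  have hU := circuitMatrix_mem_unitaryGroup f c
  have hS := mem_colStochastic_iff_sum.1 (𝒯.stochastic ψ _ hψ hU)
  exact ⟨hS.1, hS.2, 𝒯.marginal ψ _ hψ hU⟩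

/-- Indifference is used only in this form: qubits that a circuit leaves alone keep their values in
the history. -/
theorem transition_eq_zero (h𝒯 : 𝒯.Indifferent) {ψ : Bits l → ℂ} (hψ : ∑ x, ‖ψ x‖ ^ 2 = 1)
    {c : List (Gate n l)} {s : Set (Fin l)} (hc : ActsOn s (circuitMatrix f c)) {x y : Bits l}
    (hxy : ¬ agreeOff s x y) : 𝒯.S (pureState ψ) (circuitMatrix f c) y x = 0 :=
  h𝒯 ψ _ hψ (circuitMatrix_mem_unitaryGroup f c) (agreeOff s) hc x y hxy

theorem dominated_single : Dominated (fun v : Bits l => if v = fun _ => false then 1 else 0)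
    (Pi.single (fun _ => false) 1) := by
  refine ⟨fun v => ?_, fun v => ?_⟩
  · split_ifs <;> simp
  · rw [Pi.single_apply]
    split_ifs <;> simp

/-- The mass that has avoided the states in `s` after each of the circuits of a list, when the
state before the circuits is `ψ` and the distribution of the hidden variable is `q`. -/
def survivors (𝒯 : HiddenVariableTheory) (s : Bits l → Prop) [DecidablePred s] :
    List (List (Gate n l)) → (Bits l → ℂ) → (Bits l → ℝ) → Bits l → ℝ
  | [], _, q => q
  | c :: cs, ψ, q => survivors 𝒯 s cs (applyCircuit f c ψ)
      (killedStep s (𝒯.S (pureState ψ) (circuitMatrix f c)) q)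

/-- The action of a list of circuits on a vector. -/
def applyCircuits (cs : List (List (Gate n l))) (ψ : Bits l → ℂ) : Bits l → ℂ :=
  cs.foldl (fun ψ c => applyCircuit f c ψ) ψ

theorem survivors_append (𝒯 : HiddenVariableTheory) (s : Bits l → Prop) [DecidablePred s]
    (cs ds : List (List (Gate n l))) (ψ : Bits l → ℂ) (q : Bits l → ℝ) :
    survivors f 𝒯 s (cs ++ ds) ψ q =
      survivors f 𝒯 s ds (applyCircuits f cs ψ) (survivors f 𝒯 s cs ψ q) := by
  induction cs generalizing ψ q with
  | nil => rfl
  | cons c cs ih => exact ih _ _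

/-- Transition matrices are monotone on nonnegative distributions and removal only decreases mass,
so the domination persists. It replaces the exact marginals, which are lost once successes are
removed. -/
theorem dominated_survivors (𝒯 : HiddenVariableTheory) (s : Bits l → Prop) [DecidablePred s]
    (cs : List (List (Gate n l))) {ψ : Bits l → ℂ} {q : Bits l → ℝ} (hψ : ∑ x, ‖ψ x‖ ^ 2 = 1)
    (hq : Dominated q ψ) :
    Dominated (survivors f 𝒯 s cs ψ q) (applyCircuits f cs ψ) := by
  induction cs generalizing ψ q with
  | nil => exact hq
  | cons c cs ih =>
    exact ih (by rw [sum_norm_applyCircuit, hψ])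
      ((isTransition f 𝒯 hψ c).dominated_killedStep s hq)

end Survivors

/-! ### Transition probabilities within one cycle. -/

namespace Search

variable {n : ℕ} {x : Bits n} {S : Matrix (Bits (2 * n + 4)) (Bits (2 * n + 4)) ℝ}

/-- The history entries on account of which `algorithm` accepts. -/
def Successful (v : Bits (2 * n + 4)) : Prop := v (mark n) = true ∧ v (pad n) = false

instance : DecidablePred (Successful (n := n)) := fun v => by unfold Successful; infer_instance

@[simp] theorem not_successful_basisState (y : Bits n) (c : Bool) :
    ¬ Successful (basisState y c false) := by simp [Successful]

/-- The item with the low bits of `x` and all high bits `0`. -/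
def lowPart (x : Bits n) : Bits n := fun i => if i ∈ highItems n then false else x i

/-- The unmarked items with the same low bits as the marked item. -/
def siblings (x : Bits n) : Finset (Bits n) :=
  Finset.univ.filter fun y => (∀ i ∉ highItems n, y i = x i) ∧ y ≠ x

theorem eq_basisState_of_agreeOff {s : Set (Fin (2 * n + 4))} {y : Bits n} {c d : Bool}
    {v : Bits (2 * n + 4)} (hs : s ⊆ Set.range item) (h : agreeOff s (basisState y c d) v) :
    v = basisState (fun i => v (item i)) c d := by
  have h' : ∀ w, w ∉ Set.range (item (n := n)) → basisState y c d w = v w :=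
    fun w hw => h w fun hw' => hw (hs hw')
  have hc : Clean v := by
    refine ⟨fun i => ?_, ?_⟩
    · rw [← h' _ (by simp), basisState_anc]
    · rw [← h' _ (by simp), basisState_pad]
  conv_lhs => rw [hc.eq_basisState]
  rw [← h' (flag n) (by simp), ← h' (mark n) (by simp), basisState_flag, basisState_mark]

theorem eq_basisState_of_agreeOff_flag {y : Bits n} {c d : Bool}
    {v : Bits (2 * n + 4)} (h : agreeOff {flag n} (basisState y c d) v) :
    v = basisState y (v (flag n)) d := by
  have h' : ∀ w, w ≠ flag n → basisState y c d w = v w := fun w hw => h w hw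
  have hc : Clean v := by
    refine ⟨fun i => ?_, ?_⟩
    · rw [← h' _ (by simp), basisState_anc]
    · rw [← h' _ (by simp), basisState_pad]
  conv_lhs => rw [hc.eq_basisState]
  congr 1
  · funext i
    rw [← h' _ (by simp), basisState_item]
  · rw [← h' _ (by simp), basisState_mark]

/-- From the state with all item bits `0`, the low bits become those of the marked item with
probability about `2 ^ (-n / 3)`. -/
theorem transition_low (h : IsTransition S (lowState x) (cycleState x)) (hn : 30 ≤ n)
    (hS : ∀ u v, ¬ agreeOff (Set.range item) u v → S v u = 0) :
    ((2 ^ (n / 3)) ^ 2 - 3) / 2 ^ n ≤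
      S (basisState (lowPart x) false false) (basisState (fun _ => false) false false) := by
  set b : Bits n → Bits (2 * n + 4) := fun y => basisState y false false with hb
  set c := b (lowPart x) with hc
  set o := b fun _ => false with ho
  -- Indifference confines the inflow of the target to clean states with flag and mark 0. The states
  -- other than the origin carry at most u²/N in total, so nearly all of the weight u²(K - 1/K)²/N
  -- must come from the origin.
  have hsum : ∑ y, S c (b y) * ‖lowState x (b y)‖ ^ 2 = ‖cycleState x c‖ ^ 2 := by
    rw [← h.marginal c]
    refine Fintype.sum_of_injective b (basisState_injective _ _) _ _ (fun v hv => ?_) fun _ => rfl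
    by_cases hv1 : agreeOff (Set.range item) v c
    · exact absurd ⟨_, (eq_basisState_of_agreeOff subset_rfl ((agreeOff _).symm hv1)).symm⟩ hv
    · rw [hS _ _ hv1, zero_mul]
  set u := uniformAmplitude n with hu
  have hu0 : 0 < u := by linarith [le_uniformAmplitude hn]
  have hN : (0 : ℝ) < 2 ^ n := by positivity
  have hN1 : ((2 : ℝ) ^ n)⁻¹ ≤ 1 := inv_le_one_of_one_le₀ (one_le_pow₀ one_le_two)
  have hrest : ∑ y ∈ Finset.univ.erase (fun _ => false), S c (b y) * ‖lowState x (b y)‖ ^ 2 ≤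
      u ^ 2 / 2 ^ n := by
    calc ∑ y ∈ Finset.univ.erase (fun _ => false), S c (b y) * ‖lowState x (b y)‖ ^ 2
        ≤ ∑ _y ∈ Finset.univ.erase (fun _ : Fin n => false), (u * (2 ^ n)⁻¹) ^ 2 := by
          refine Finset.sum_le_sum fun y hy => ?_
          rw [hb, norm_lowState (Finset.ne_of_mem_erase hy)]
          exact mul_le_of_le_one_left (sq_nonneg _) (h.le_one _ _)
      _ ≤ ∑ _y : Bits n, (u * (2 ^ n)⁻¹) ^ 2 :=
          Finset.sum_le_sum_of_subset_of_nonneg (Finset.subset_univ _) fun _ _ _ => sq_nonneg _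
      _ = u ^ 2 / 2 ^ n := by
          rw [Finset.sum_const, Finset.card_univ, Fintype.card_fun, Fintype.card_bool,
            Fintype.card_fin, nsmul_eq_mul]
          push_cast
          field_simp
  rw [← Finset.add_sum_erase _ _ (Finset.mem_univ fun _ => false)] at hsum
  have hc' : ‖cycleState x c‖ ^ 2 = u ^ 2 / 2 ^ n * (2 ^ (n / 3) - (2 ^ (n / 3))⁻¹) ^ 2 := by
    rw [hc, hb, cycleState_low (fun i hi => by simp [lowPart, hi]) (fun i hi => by
      simp [lowPart, hi]), Complex.norm_real, Real.norm_eq_abs, sq_abs, mul_pow,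
      unmarkedAmplitude_sq]
  have ho' : S c o * ‖lowState x o‖ ^ 2 ≤ S c o * u ^ 2 := by
    refine mul_le_mul_of_nonneg_left ?_ (h.nonneg _ _)
    rw [ho, hb, lowState_origin, Complex.norm_real, Real.norm_eq_abs, sq_abs, mul_pow]
    refine mul_le_of_le_one_right (sq_nonneg _) (pow_le_one₀ (by linarith) ?_)
    have : (0 : ℝ) < (2 ^ n)⁻¹ := by positivity
    linarith
  have hKK : ((2 : ℝ) ^ (n / 3) - (2 ^ (n / 3))⁻¹) ^ 2 ≥ (2 ^ (n / 3)) ^ 2 - 2 := by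
    have : (2 : ℝ) ^ (n / 3) * (2 ^ (n / 3))⁻¹ = 1 := mul_inv_cancel₀ (by positivity)
    nlinarith [sq_nonneg ((2 : ℝ) ^ (n / 3))⁻¹]
  rw [hc'] at hsum
  have hfin : u ^ 2 / 2 ^ n * ((2 ^ (n / 3)) ^ 2 - 2) ≤ S c o * u ^ 2 + u ^ 2 / 2 ^ n := by
    have := mul_le_mul_of_nonneg_left hKK (show 0 ≤ u ^ 2 / 2 ^ n by positivity)
    have ho'' : S c o * ‖lowState x o‖ ^ 2 = S c (b fun _ => false) *
      ‖lowState x (b fun _ => false)‖ ^ 2 := rfl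
    linarith
  have hu2 : 0 < u ^ 2 := by positivity
  rw [div_le_iff₀ hN]
  have h1 : u ^ 2 * ((2 ^ (n / 3)) ^ 2 - 3) ≤ u ^ 2 * (S c o * 2 ^ n) := by
    have h2 := mul_le_mul_of_nonneg_right hfin hN.le
    have h3 : u ^ 2 / 2 ^ n * ((2 ^ (n / 3)) ^ 2 - 2) * 2 ^ n = u ^ 2 * ((2 ^ (n / 3)) ^ 2 - 2) := by
      field_simp
    have h4 : (S c o * u ^ 2 + u ^ 2 / 2 ^ n) * 2 ^ n = u ^ 2 * (S c o * 2 ^ n) + u ^ 2 := by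
      field_simp
    rw [h3, h4] at h2
    linarith
  exact le_of_mul_le_mul_left h1 hu2

theorem high_subset : {w | ∃ i ∈ highItems n, w = item i} ⊆ Set.range (item (n := n)) := by
  rintro _ ⟨i, _, rfl⟩
  exact ⟨i, rfl⟩

theorem agreeOff_high {y z : Bits n} {c d c' d' : Bool}
    (h : agreeOff {w | ∃ i ∈ highItems n, w = item i} (basisState y c d) (basisState z c' d')) :
    ∀ i ∉ highItems n, z i = y i := fun i hi => by
  have := h (item i) (by simpa using hi)
  simpa using this.symm

/-- The high bits move to those of an unmarked item. -/
theorem transition_high (h : IsTransition S (cycleState x) (highState x)) (hn : 30 ≤ n)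
    (hS : ∀ u v, ¬ agreeOff {w | ∃ i ∈ highItems n, w = item i} u v → S v u = 0) :
    ∑ y ∈ siblings x, S (basisState y false false) (basisState (lowPart x) false false) = 1 := by
  rw [← h.sum_col (basisState (lowPart x) false false),
    ← Fintype.sum_of_injective (fun y : Bits n => basisState y false false)
      (basisState_injective _ _) (fun y => S (basisState y false false) _) _ (fun v hv => ?_)
      fun _ => rfl]
  · refine Finset.sum_subset (Finset.subset_univ _) fun y _ hy => ?_
    by_cases hyx : y = x
    -- The item `x` itself is excluded: with flag 0 its amplitude cancels.
    · refine h.eq_zero (by rw [highState_low, if_pos hyx]) ?_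
      rw [cycleState_low (fun i hi => by simp [lowPart, hi]) (fun i hi => by simp [lowPart, hi])]
      rw [ne_eq, Complex.ofReal_eq_zero]
      have hK : (1 : ℝ) < 2 ^ (n / 3) := one_lt_pow₀ one_lt_two (by omega)
      have hK' : ((2 : ℝ) ^ (n / 3))⁻¹ < 1 := inv_lt_one_of_one_lt₀ hK
      exact (mul_pos (unmarkedAmplitude_pos hn) (by linarith)).ne'
    · refine hS _ _ fun hag => hy ?_
      refine Finset.mem_filter.2 ⟨Finset.mem_univ _, fun i hi => ?_, hyx⟩
      rw [agreeOff_high hag i hi]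
      simp [lowPart, hi]
  · refine hS _ _ fun hag => hv ⟨_, (eq_basisState_of_agreeOff high_subset hag).symm⟩

theorem sum_flag (hS : ∀ u v, ¬ agreeOff {flag n} u v → S v u = 0) (y : Bits n) (c c' d : Bool) :
    S (basisState y c' d) (basisState y c d) + S (basisState y (!c') d) (basisState y c d) =
      ∑ v, S v (basisState y c d) := by
  rw [← Fintype.sum_of_injective (fun e : Bool => basisState y e d) (fun e e' he => by
      simpa using congrFun he (flag n)) (fun e => S (basisState y e d) _) _ (fun v hv => ?_)
      fun _ => rfl, Fintype.sum_bool]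
  · cases c'
    · exact add_comm _ _
    · rfl
  · exact hS _ _ fun hag => hv ⟨_, (eq_basisState_of_agreeOff_flag hag).symm⟩

/-- Two Hadamard gates on the flag move it from `0` to `1` with constant probability. -/
theorem transition_flag {S' : Matrix (Bits (2 * n + 4)) (Bits (2 * n + 4)) ℝ}
    (h : IsTransition S (highState x) (flagState x))
    (h' : IsTransition S' (flagState x) (highState x)) (hn : 30 ≤ n)
    (hS : ∀ u v, ¬ agreeOff {flag n} u v → S v u = 0)
    (hS' : ∀ u v, ¬ agreeOff {flag n} u v → S' v u = 0) {y : Bits n} (hy : y ∈ siblings x) :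
    ∃ c, 46 / 100 ≤ S (basisState y c false) (basisState y false false) ∧
      77 / 100 ≤ S' (basisState y true false) (basisState y c false) := by
  obtain ⟨-, hyl, hyx⟩ := Finset.mem_filter.1 hy
  obtain ⟨c, hc, hc'⟩ := norm_flagState hyl hyx
  obtain ⟨hr, hr'⟩ := amplitude_ratio hn
  have hB := unmarkedAmplitude_pos hn
  set B := unmarkedAmplitude n with hBdef
  set γ := markedAmplitude n / 2 ^ (n / 3)
  have hBB : 0 < B ^ 2 := by positivity
  have hlow : ‖highState x (basisState y false false)‖ ^ 2 = B ^ 2 := by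
    rw [highState_low, if_neg hyx, Complex.norm_real, Real.norm_eq_abs, sq_abs]
  refine ⟨c, ?_, ?_⟩
  · have h1 := sum_flag hS y false c false
    rw [h.sum_col] at h1
    have h2 := h.mul_le (basisState y (!c) false) (basisState y false false)
    rw [hc', hlow] at h2
    -- With γ ≈ 2B the unfavourable flag value has weight (γ - B)²/2 ≈ B²/2, and flag 0 starts with
    -- weight B².
    have h3 : S (basisState y (!c) false) (basisState y false false) ≤ 54 / 100 := by
      refine le_of_mul_le_mul_right (h2.trans ?_) hBB
      nlinarith
    linarith
  · have h1 := sum_flag hS' y c true false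
    rw [h'.sum_col] at h1
    have h2 := h'.mul_le (basisState y false false) (basisState y c false)
    rw [hc, hlow] at h2
    have hp := h'.nonneg (basisState y false false) (basisState y c false)
    -- The favourable value has weight (B + γ)²/2 ≈ 9B²/2, of which at most B² can return to flag 0:
    -- a fraction of about 2/9.
    have h3 : S' (basisState y false false) (basisState y c false) ≤ 23 / 100 := by
      have h4 : (299 / 100) ^ 2 / 2 * B ^ 2 ≤ (B + γ) ^ 2 / 2 := by nlinarith
      have h5 := (mul_le_mul_of_nonneg_left h4 hp).trans h2
      refine le_of_mul_le_mul_right ?_ hBB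
      nlinarith
    simp only [Bool.not_true] at h1
    linarith

theorem markedAmplitude_pos (hn : 30 ≤ n) : 0 < markedAmplitude n := by
  have h1 := (amplitude_ratio hn).1
  have h2 := unmarkedAmplitude_pos hn
  have h3 : 0 < markedAmplitude n / 2 ^ (n / 3) := by linarith
  exact (div_pos_iff_of_pos_right (by positivity)).1 h3

/-- Once the flag is `1` the high bits move to those of the marked item. -/
theorem transition_back (h : IsTransition S (highState x) (cycleState x)) (hn : 30 ≤ n)
    (hS : ∀ u v, ¬ agreeOff {w | ∃ i ∈ highItems n, w = item i} u v → S v u = 0) {y : Bits n}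
    (hy : y ∈ siblings x) : S (basisState x true false) (basisState y true false) = 1 := by
  obtain ⟨-, hyl, hyx⟩ := Finset.mem_filter.1 hy
  rw [← h.sum_col (basisState y true false),
    Finset.sum_eq_single (basisState x true false) (fun v _ hv => ?_) fun h0 =>
      absurd (Finset.mem_univ _) h0]
  by_cases hag : agreeOff {w | ∃ i ∈ highItems n, w = item i} (basisState y true false) v
  · have hvb := eq_basisState_of_agreeOff high_subset hag
    refine h.eq_zero ?_ ?_
    · rw [hvb, cycleState_flag, if_neg]
      rintro ⟨hvx, -⟩
      exact hv (by rw [hvb, hvx])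
    · have h1 := norm_highState_flag hyl
      have h2 := markedAmplitude_pos hn
      intro h0
      rw [h0, norm_zero, zero_pow two_ne_zero] at h1
      have : 0 < (markedAmplitude n / 2 ^ (n / 3)) ^ 2 := by positivity
      linarith
  · exact hS _ _ hag

/-- Only the mark can change, and the state with flag 1 and mark 0 has amplitude 0 afterwards, so
the mark has to be set. -/
theorem transition_mark (h : IsTransition S (cycleState x) (markState x)) (hn : 30 ≤ n)
    (hS : ∀ u v, ¬ agreeOff {mark n} u v → S v u = 0) (v : Bits (2 * n + 4))
    (hv : ¬ Successful v) : S v (basisState x true false) = 0 := by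
  by_cases hag : agreeOff {mark n} (basisState x true false) v
  · have hag' : ∀ w, w ≠ mark n → basisState x true false w = v w := fun w hw => hag w hw
    have hp : v (pad n) = false := by rw [← hag' _ pad_ne_mark, basisState_pad]
    have hm : v (mark n) = false := by
      simpa [Successful, hp] using hv
    have : v = basisState x true false := by
      funext w
      by_cases hw : w = mark n
      · rw [hw, hm, basisState_mark]
      · exact (hag' w hw).symm
    refine h.eq_zero (by rw [this, markState_flag]) ?_
    rw [cycleState_flag, if_pos ⟨rfl, rfl⟩]
    exact_mod_cast (markedAmplitude_pos hn).ne'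
  · exact hS _ _ hag

end Search

end Histories

end

noncomputable section

namespace Histories

/-! ### The success probability of the cycles -/

namespace Search

variable {n : ℕ} (f : Bits n → Bool) (x : Bits n)

theorem lowHadamards_cycleState :
    applyCircuit f (lowHadamards n) (cycleState x) = lowState x := lowHadamards_triple ..

theorem lowHadamards_lowState :
    applyCircuit f (lowHadamards n) (lowState x) = cycleState x := by
  rw [lowState, lowHadamards_triple, onLow_onLow, onLow_onLow, onLow_onLow, cycleState]

theorem highHadamards_cycleState :
    applyCircuit f (highHadamards n) (cycleState x) = highState x := by
  rw [cycleState, highHadamards_triple, onHigh_onHigh, onHigh_onHigh, highState]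

theorem flagHadamard_highState :
    applyCircuit f (flagHadamard n) (highState x) = flagState x := flagHadamard_triple ..

theorem flagHadamard_flagState :
    applyCircuit f (flagHadamard n) (flagState x) = highState x := by
  rw [flagState, flagHadamard_triple, hadamard_mulVec_mulVec, hadamard_mulVec_mulVec, highState]

theorem highHadamards_highState :
    applyCircuit f (highHadamards n) (highState x) = cycleState x := by
  rw [highState, highHadamards_triple, onHigh_onHigh, cycleState]

theorem markCircuit_cycleState :
    applyCircuit f (markCircuit n) (cycleState x) = markState x := markCircuit_triple ..

theorem markCircuit_markState :
    applyCircuit f (markCircuit n) (markState x) = cycleState x := markCircuit_triple ..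

theorem applyCircuits_cycle : applyCircuits f (cycle n) (cycleState x) = cycleState x := by
  simp only [applyCircuits, cycle, List.foldl_cons, List.foldl_nil, lowHadamards_cycleState,
    lowHadamards_lowState, highHadamards_cycleState, flagHadamard_highState,
    flagHadamard_flagState, highHadamards_highState, markCircuit_cycleState,
    markCircuit_markState]

theorem actsOn_lowHadamards :
    ActsOn (Set.range item) (circuitMatrix f (lowHadamards n)) := by
  refine actsOn_circuitMatrix f fun g hg => ?_
  obtain ⟨i, -, hi⟩ := List.mem_flatMap.1 hg
  rw [List.mem_singleton.1 hi]
  exact actsOn_onQubit _ ⟨i, rfl⟩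

theorem actsOn_highHadamards :
    ActsOn {w | ∃ i ∈ highItems n, w = item i} (circuitMatrix f (highHadamards n)) := by
  refine actsOn_circuitMatrix f fun g hg => ?_
  obtain ⟨i, hi', hi⟩ := List.mem_flatMap.1 hg
  rw [List.mem_singleton.1 hi]
  exact actsOn_onQubit _ ⟨i, hi', rfl⟩

theorem actsOn_flagHadamard : ActsOn {flag n} (circuitMatrix f (flagHadamard n)) := by
  refine actsOn_circuitMatrix f fun g hg => ?_
  rw [List.mem_singleton.1 hg]
  exact actsOn_onQubit _ rfl

theorem actsOn_markCircuit : ActsOn {mark n} (circuitMatrix f (markCircuit n)) := by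
  refine actsOn_circuitMatrix f fun g hg => ?_
  rw [List.mem_singleton.1 hg]
  exact actsOn_xorInto _ rfl

variable {f x}

/-- At least 97/100 of the measurement distribution sits at the origin, and dominated mass elsewhere
cannot exceed the remaining 3/100. This restarts each trial regardless of the past. -/
theorem mass_origin {q : Bits (2 * n + 4) → ℝ} (hn : 30 ≤ n) (hq : Dominated q (lowState x))
    (hψ : ∑ v, ‖lowState x v‖ ^ 2 = 1) :
    ∑ v, q v - 3 / 100 ≤ q (basisState (fun _ => false) false false) := by
  set o : Bits (2 * n + 4) := basisState (fun _ => false) false false with ho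
  have h1 : ∑ v ∈ Finset.univ.erase o, q v ≤ ∑ v ∈ Finset.univ.erase o, ‖lowState x v‖ ^ 2 :=
    Finset.sum_le_sum fun v _ => hq.le v
  rw [← Finset.add_sum_erase _ _ (Finset.mem_univ o)] at hψ ⊢
  have hN : ((2 : ℝ) ^ n)⁻¹ ≤ 1 / 1000 := by
    rw [inv_le_comm₀ (by positivity) (by norm_num)]
    calc ((1 : ℝ) / 1000)⁻¹ ≤ 2 ^ 30 := by norm_num
      _ ≤ 2 ^ n := pow_le_pow_right₀ one_le_two hn
  have hu := le_uniformAmplitude hn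
  have h2 : 97 / 100 ≤ ‖lowState x o‖ ^ 2 := by
    rw [ho, lowState_origin, Complex.norm_real, Real.norm_eq_abs, sq_abs]
    have : 98 / 100 * (99 / 100) ≤ uniformAmplitude n * (1 - (2 ^ n)⁻¹) := by nlinarith
    nlinarith
  linarith

/-- Chains the transitions of a cycle: at least κ = 1/(16K) of the mass at the origin arrives at `x`
with flag 1 and is removed by the marking step. The last circuit, which clears the mark, creates no
mass. -/
theorem survivors_cycle {𝒯 : HiddenVariableTheory} (h𝒯 : 𝒯.Indifferent) (hn : 30 ≤ n)
    (hψ : ∑ v, ‖cycleState x v‖ ^ 2 = 1) {q : Bits (2 * n + 4) → ℝ}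
    (hq : Dominated q (cycleState x)) :
    ∑ v, survivors f 𝒯 Successful (cycle n) (cycleState x) q v ≤
      (1 - 1 / (16 * 2 ^ (n / 3))) * ∑ v, q v + 1 / (16 * 2 ^ (n / 3)) * (3 / 100) := by
  have hlow : ∑ v, ‖lowState x v‖ ^ 2 = 1 := by
    rw [← lowHadamards_cycleState f, sum_norm_applyCircuit, hψ]
  have hhigh : ∑ v, ‖highState x v‖ ^ 2 = 1 := by
    rw [← highHadamards_cycleState f, sum_norm_applyCircuit, hψ]
  have hflag : ∑ v, ‖flagState x v‖ ^ 2 = 1 := by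
    rw [← flagHadamard_highState f, sum_norm_applyCircuit, hhigh]
  have hmark : ∑ v, ‖markState x v‖ ^ 2 = 1 := by
    rw [← markCircuit_cycleState f, sum_norm_applyCircuit, hψ]
  have t₁ := isTransition f 𝒯 hψ (lowHadamards n)
  have t₂ := isTransition f 𝒯 hlow (lowHadamards n)
  have t₃ := isTransition f 𝒯 hψ (highHadamards n)
  have t₄ := isTransition f 𝒯 hhigh (flagHadamard n)
  have t₅ := isTransition f 𝒯 hflag (flagHadamard n)
  have t₆ := isTransition f 𝒯 hhigh (highHadamards n)
  have t₇ := isTransition f 𝒯 hψ (markCircuit n)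
  have t₈ := isTransition f 𝒯 hmark (markCircuit n)
  have z₂ := fun u v => transition_eq_zero f h𝒯 hlow (actsOn_lowHadamards f) (x := u) (y := v)
  have z₃ := fun u v => transition_eq_zero f h𝒯 hψ (actsOn_highHadamards f) (x := u) (y := v)
  have z₄ := fun u v => transition_eq_zero f h𝒯 hhigh (actsOn_flagHadamard f) (x := u) (y := v)
  have z₅ := fun u v => transition_eq_zero f h𝒯 hflag (actsOn_flagHadamard f) (x := u) (y := v)
  have z₆ := fun u v => transition_eq_zero f h𝒯 hhigh (actsOn_highHadamards f) (x := u) (y := v)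
  have z₇ := fun u v => transition_eq_zero f h𝒯 hψ (actsOn_markCircuit f) (x := u) (y := v)
  simp only [survivors, cycle, lowHadamards_cycleState, lowHadamards_lowState,
    highHadamards_cycleState, flagHadamard_highState, flagHadamard_flagState,
    highHadamards_highState, markCircuit_cycleState, markCircuit_markState] at t₁ t₂ t₃ t₄ t₅ t₆ t₇ t₈ ⊢
  generalize 𝒯.S (pureState (cycleState x)) (circuitMatrix f (lowHadamards n)) = S₁ at *
  generalize 𝒯.S (pureState (lowState x)) (circuitMatrix f (lowHadamards n)) = S₂ at *
  generalize 𝒯.S (pureState (cycleState x)) (circuitMatrix f (highHadamards n)) = S₃ at *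
  generalize 𝒯.S (pureState (highState x)) (circuitMatrix f (flagHadamard n)) = S₄ at *
  generalize 𝒯.S (pureState (flagState x)) (circuitMatrix f (flagHadamard n)) = S₅ at *
  generalize 𝒯.S (pureState (highState x)) (circuitMatrix f (highHadamards n)) = S₆ at *
  generalize 𝒯.S (pureState (cycleState x)) (circuitMatrix f (markCircuit n)) = S₇ at *
  generalize 𝒯.S (pureState (markState x)) (circuitMatrix f (markCircuit n)) = S₈ at *
  have d₁ := t₁.dominated_killedStep Successful hq
  have m₁ := t₁.sum_killedStep_le Successful hq
  generalize killedStep Successful S₁ q = q₁ at *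
  have d₂ := t₂.dominated_killedStep Successful d₁
  have m₂ := t₂.sum_killedStep_le Successful d₁
  have l₂ := t₂.mul_le_killedStep Successful d₁
    (not_successful_basisState (lowPart x) false) (basisState (fun _ => false) false false)
  generalize killedStep Successful S₂ q₁ = q₂ at *
  have d₃ := t₃.dominated_killedStep Successful d₂
  have m₃ := t₃.sum_killedStep_le Successful d₂
  have l₃ := fun y => t₃.mul_le_killedStep Successful d₂ (not_successful_basisState y false)
    (basisState (lowPart x) false false)
  generalize killedStep Successful S₃ q₂ = q₃ at *
  have d₄ := t₄.dominated_killedStep Successful d₃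
  have m₄ := t₄.sum_killedStep_le Successful d₃
  have l₄ := fun y c => t₄.mul_le_killedStep Successful d₃ (not_successful_basisState y c)
    (basisState y false false)
  generalize killedStep Successful S₄ q₃ = q₄ at *
  have d₅ := t₅.dominated_killedStep Successful d₄
  have m₅ := t₅.sum_killedStep_le Successful d₄
  have l₅ := fun y c => t₅.mul_le_killedStep Successful d₄ (not_successful_basisState y true)
    (basisState y c false)
  generalize killedStep Successful S₅ q₄ = q₅ at *
  have d₆ := t₆.dominated_killedStep Successful d₅
  have m₆ := t₆.sum_killedStep_le Successful d₅
  -- All siblings feed the same state, so their contributions add up. The favourable intermediate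
  -- flag value may differ from sibling to sibling.
  have l₆ : ∑ y ∈ siblings x, S₆ (basisState x true false) (basisState y true false) *
      q₅ (basisState y true false) ≤ killedStep Successful S₆ q₅ (basisState x true false) := by
    rw [killedStep, if_neg (not_successful_basisState x true)]
    refine le_of_eq_of_le (Finset.sum_map (siblings x) ⟨_, basisState_injective true false⟩
      fun v => S₆ (basisState x true false) v * q₅ v).symm ?_
    exact Finset.sum_le_sum_of_subset_of_nonneg (Finset.subset_univ _) fun v _ _ =>
      mul_nonneg (t₆.nonneg _ _) (d₅.nonneg _)
  generalize killedStep Successful S₆ q₅ = q₆ at *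
  have d₇ := t₇.dominated_killedStep Successful d₆
  have m₇ := t₇.sum_killedStep_le_sub Successful d₆ (transition_mark t₇ hn z₇)
  generalize killedStep Successful S₇ q₆ = q₇ at *
  have m₈ := t₈.sum_killedStep_le Successful d₇
  refine m₈.trans (m₇.trans ?_)
  have ho := mass_origin hn d₁ hlow
  have h₂ := transition_low t₂ hn z₂
  have h₃ := transition_high t₃ hn z₃
  have hstep : ∀ y ∈ siblings x, 46 / 100 * (77 / 100) * (S₃ (basisState y false false)
      (basisState (lowPart x) false false) * q₂ (basisState (lowPart x) false false)) ≤
      S₆ (basisState x true false) (basisState y true false) * q₅ (basisState y true false) := by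
    intro y hy
    obtain ⟨c, hc, hc'⟩ := transition_flag t₄ t₅ hn z₄ z₅ hy
    rw [transition_back t₆ hn z₆ hy, one_mul]
    have a₃ := mul_le_mul_of_nonneg_right hc (d₃.nonneg (basisState y false false))
    have a₄ := mul_le_mul_of_nonneg_right hc' (d₄.nonneg (basisState y c false))
    linarith [l₃ y, l₄ y c, l₅ y c]
  have hsum := Finset.sum_le_sum hstep
  rw [← Finset.mul_sum, ← Finset.sum_mul, h₃, one_mul] at hsum
  have hq₁ : 0 ≤ q₁ (basisState (fun _ => false) false false) := d₁.nonneg _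
  -- As N ≤ 4K³, the right side is at least about 0.354/(4K), which exceeds 1/(16K).
  have hκ : 1 / (16 * 2 ^ (n / 3)) ≤
      46 / 100 * (77 / 100) * (((2 ^ (n / 3)) ^ 2 - 3) / 2 ^ n : ℝ) := by
    have hN : (2 : ℝ) ^ n ≤ 4 * (2 ^ (n / 3)) ^ 3 := by
      rw [show (4 : ℝ) = 2 ^ 2 by norm_num, ← pow_mul, ← pow_add]
      exact pow_le_pow_right₀ one_le_two (by omega)
    have hK : (1024 : ℝ) ≤ 2 ^ (n / 3) := by
      calc (1024 : ℝ) = 2 ^ 10 := by norm_num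
        _ ≤ 2 ^ (n / 3) := pow_le_pow_right₀ one_le_two (by omega)
    set K : ℝ := 2 ^ (n / 3)
    have hN0 : (0 : ℝ) < 2 ^ n := by positivity
    rw [← mul_div_assoc, div_le_div_iff₀ (by positivity) hN0, one_mul]
    refine hN.trans ?_
    have : K * 1024 ≤ K * K := mul_le_mul_of_nonneg_left hK (by linarith)
    nlinarith
  have hκ0 : (0 : ℝ) < 1 / (16 * 2 ^ (n / 3)) := by positivity
  have hκ1 : (1 : ℝ) / (16 * 2 ^ (n / 3)) ≤ 1 := by
    rw [div_le_one (by positivity)]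
    linarith [one_le_pow₀ (one_le_two (α := ℝ)) (n := n / 3)]
  set κ : ℝ := 1 / (16 * 2 ^ (n / 3))
  have hX : κ * q₁ (basisState (fun _ => false) false false) ≤ q₆ (basisState x true false) := by
    have b₁ := mul_le_mul_of_nonneg_right hκ hq₁
    have b₂ := mul_le_mul_of_nonneg_right h₂ hq₁
    linarith
  have hX' := mul_le_mul_of_nonneg_left ho hκ0.le
  have hm := mul_le_mul_of_nonneg_left m₁ (sub_nonneg.2 hκ1)
  linarith

/-- The recursion m ↦ (1 - κ)m + 3κ/100 has the fixed point 3/100 and contracts towards it by the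
factor 1 - κ. -/
theorem survivors_cycles {𝒯 : HiddenVariableTheory} (h𝒯 : 𝒯.Indifferent) (hn : 30 ≤ n)
    (hψ : ∑ v, ‖cycleState x v‖ ^ 2 = 1) {q : Bits (2 * n + 4) → ℝ}
    (hq : Dominated q (cycleState x)) (hq1 : ∑ v, q v ≤ 1) (k : ℕ) :
    applyCircuits f (List.replicate k (cycle n)).flatten (cycleState x) = cycleState x ∧
    ∑ v, survivors f 𝒯 Successful (List.replicate k (cycle n)).flatten (cycleState x) q v ≤
      (1 - 1 / (16 * 2 ^ (n / 3))) ^ k + 3 / 100 := by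
  induction k with
  | zero =>
    refine ⟨rfl, ?_⟩
    simp only [List.replicate_zero, List.flatten_nil, survivors, pow_zero]
    linarith
  | succ k ih =>
    rw [List.replicate_succ', List.flatten_append, List.flatten_singleton, survivors_append]
    obtain ⟨ih₁, ih₂⟩ := ih
    have hd := dominated_survivors f 𝒯 Successful (List.replicate k (cycle n)).flatten hψ hq
    rw [ih₁] at hd ⊢
    refine ⟨?_, (survivors_cycle h𝒯 hn hψ hd).trans ?_⟩
    · rw [applyCircuits, List.foldl_append, ← applyCircuits, ← applyCircuits, ih₁,
        applyCircuits_cycle]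
    · have hκ1 : (1 : ℝ) / (16 * 2 ^ (n / 3)) ≤ 1 := by
        rw [div_le_one (by positivity)]
        linarith [one_le_pow₀ (one_le_two (α := ℝ)) (n := n / 3)]
      have := mul_le_mul_of_nonneg_left ih₂ (sub_nonneg.2 hκ1)
      rw [pow_succ]
      linarith

theorem survivors_program {𝒯 : HiddenVariableTheory} (h𝒯 : 𝒯.Indifferent) (hn : 30 ≤ n)
    (hf : ∀ y, f y = true ↔ y = x) :
    ∑ v, survivors f 𝒯 Successful (program n).circuits (Pi.single (fun _ => false) 1)
      (fun v => if v = fun _ => false then 1 else 0) v ≤ 7 / 25 := by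
  set ψ : Bits (2 * n + 4) → ℂ := Pi.single (fun _ => false) 1 with hψdef
  set q : Bits (2 * n + 4) → ℝ := fun v => if v = fun _ => false then 1 else 0 with hqdef
  have hψ : ∑ v, ‖ψ v‖ ^ 2 = 1 := by
    rw [Finset.sum_eq_single (fun _ => false)] <;> simp +contextual [hψdef]
  have hq : Dominated q ψ := dominated_single
  have hq1 : ∑ v, q v = 1 := by simp [hqdef]
  have hprep := applyCircuit_prepCircuit hf (by omega)
  have t := isTransition f 𝒯 hψ (prepCircuit n)
  have hd := t.dominated_killedStep Successful hq
  have hm := (t.sum_killedStep_le Successful hq).trans hq1.le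
  have hψ' : ∑ v, ‖cycleState x v‖ ^ 2 = 1 := by rw [← hprep, sum_norm_applyCircuit, hψ]
  rw [hprep] at hd
  have h := (survivors_cycles (f := f) h𝒯 hn hψ' hd hm (32 * 2 ^ (n / 3))).2
  simp only [program, survivors]
  rw [hψdef] at *
  rw [hprep]
  refine h.trans ?_
  have hK : (0 : ℝ) < 2 ^ (n / 3) := by positivity
  have hκ1 : (1 : ℝ) / (16 * 2 ^ (n / 3)) ≤ 1 := by
    rw [div_le_one (by positivity)]
    linarith [one_le_pow₀ (one_le_two (α := ℝ)) (n := n / 3)]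
  -- There are 32K cycles, each contributing at most the factor exp(-1/(16K)).
  have h1 : (1 - 1 / (16 * 2 ^ (n / 3)) : ℝ) ^ (32 * 2 ^ (n / 3)) ≤ Real.exp (-2) := by
    refine (pow_le_pow_left₀ (by linarith) (Real.one_sub_le_exp_neg _) _).trans ?_
    rw [← Real.exp_nat_mul]
    refine Real.exp_le_exp.2 (le_of_eq ?_)
    push_cast
    field_simp
    norm_num
  have h2 : Real.exp (-2) ≤ 1 / 4 := by
    have h3 : (2 : ℝ) ≤ Real.exp 1 := by linarith [Real.add_one_le_exp (1 : ℝ)]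
    rw [Real.exp_neg, show (2 : ℝ) = 1 + 1 by norm_num, Real.exp_add, one_div]
    exact inv_anti₀ (by norm_num) (by nlinarith)
  linarith

end Search

end Histories

end

noncomputable section

namespace Histories

/-! ### Sums over histories -/

section Sums

variable {l n : ℕ} (f : Bits n → Bool) (𝒯 : HiddenVariableTheory) (s : Bits l → Prop)

/-- The probability that a history avoids `s` after its first entry is the mass of the survivors. -/
theorem sum_history [DecidablePred s] (cs : List (List (Gate n l))) (ψ : Bits l → ℂ)
    (q : Bits l → ℝ) :
    ∑ H : Fin (cs.length + 1) → Bits l, (if ∀ t : Fin cs.length, ¬ s (H t.succ) then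
      q (H 0) * ∏ t : Fin cs.length, 𝒯.S (pureState (applyCircuits f (cs.take t) ψ))
        (circuitMatrix f (cs.get t)) (H t.succ) (H t.castSucc) else 0) =
      ∑ v, survivors f 𝒯 s cs ψ q v := by
  induction cs generalizing ψ q with
  | nil =>
    refine ((Equiv.funUnique (Fin 1) (Bits l)).symm.sum_comp _).symm.trans ?_
    refine Finset.sum_congr rfl fun v _ => ?_
    simp [survivors]
  | cons c cs ih =>
    rw [survivors, ← ih]
    -- Summing over the first entry performs one killed step; the remaining entries form a history
    -- of the shorter list.
    refine ((Fin.consEquiv fun _ : Fin (cs.length + 2) => Bits l).sum_comp _).symm.trans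
      ((Fintype.sum_prod_type_right _).trans ?_)
    refine Finset.sum_congr rfl fun H _ => ?_
    have hprod : ∀ v : Bits l, ∏ t : Fin (c :: cs).length,
        𝒯.S (pureState (applyCircuits f ((c :: cs).take t) ψ)) (circuitMatrix f ((c :: cs).get t))
          ((Fin.cons v H : Fin (cs.length + 2) → Bits l) t.succ)
          ((Fin.cons v H : Fin (cs.length + 2) → Bits l) t.castSucc) =
        𝒯.S (pureState ψ) (circuitMatrix f c) (H 0) v * ∏ t : Fin cs.length,
          𝒯.S (pureState (applyCircuits f (cs.take t) (applyCircuit f c ψ)))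
            (circuitMatrix f (cs.get t)) (H t.succ) (H t.castSucc) := fun v => by
      refine (Fin.prod_univ_succ (n := cs.length) _).trans ?_
      rfl
    have hall : ∀ v : Bits l, (∀ t : Fin (c :: cs).length,
        ¬ s ((Fin.cons v H : Fin (cs.length + 2) → Bits l) t.succ)) ↔
        ¬ s (H 0) ∧ ∀ t : Fin cs.length, ¬ s (H t.succ) := fun v =>
      Fin.forall_fin_succ (n := cs.length) (P := fun t => ¬ s (H t))
    have hterm : ∀ v : Bits l, (if ∀ t : Fin (c :: cs).length,
        ¬ s ((Fin.consEquiv fun _ : Fin (cs.length + 2) => Bits l) (v, H) t.succ) then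
          q ((Fin.consEquiv fun _ : Fin (cs.length + 2) => Bits l) (v, H) 0) *
          ∏ t : Fin (c :: cs).length, 𝒯.S (pureState (applyCircuits f ((c :: cs).take t) ψ))
            (circuitMatrix f ((c :: cs).get t))
            ((Fin.consEquiv fun _ : Fin (cs.length + 2) => Bits l) (v, H) t.succ)
            ((Fin.consEquiv fun _ : Fin (cs.length + 2) => Bits l) (v, H) t.castSucc) else 0) =
        if ∀ t : Fin cs.length, ¬ s (H t.succ) then
          (if s (H 0) then 0 else 𝒯.S (pureState ψ) (circuitMatrix f c) (H 0) v * q v) *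
          ∏ t : Fin cs.length, 𝒯.S (pureState (applyCircuits f (cs.take t) (applyCircuit f c ψ)))
            (circuitMatrix f (cs.get t)) (H t.succ) (H t.castSucc) else 0 := fun v => by
      refine (if_congr (hall v) (congrArg (q v * ·) (hprod v)) rfl).trans ?_
      by_cases h1 : s (H 0) <;> by_cases h2 : ∀ t : Fin cs.length, ¬ s (H t.succ)
      · simp [h1]
      · simp [h1]
      · rw [if_pos ⟨h1, h2⟩, if_pos h2, if_neg h1]; ring
      · rw [if_neg fun h => h2 h.2, if_neg h2]
    refine (Finset.sum_congr rfl fun v _ => hterm v).trans ?_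
    by_cases h2 : ∀ t : Fin cs.length, ¬ s (H t.succ)
    · rw [if_pos h2, Finset.sum_congr rfl fun v _ => if_pos h2, ← Finset.sum_mul, killedStep]
      split_ifs <;> simp
    · rw [if_neg h2, Finset.sum_congr rfl fun v _ => if_neg h2, Finset.sum_const_zero]

/-- The amplitudes of the states in `s` vanish after each of the circuits of a list. -/
def VanishesAlong : List (List (Gate n l)) → (Bits l → ℂ) → Prop
  | [], _ => True
  | c :: cs, ψ => (∀ v, s v → applyCircuit f c ψ v = 0) ∧
      VanishesAlong cs (applyCircuit f c ψ)

variable {f s}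

theorem VanishesAlong.append {cs ds : List (List (Gate n l))} {ψ : Bits l → ℂ}
    (h : VanishesAlong f s cs ψ) (h' : VanishesAlong f s ds (applyCircuits f cs ψ)) :
    VanishesAlong f s (cs ++ ds) ψ := by
  induction cs generalizing ψ with
  | nil => exact h'
  | cons c cs ih => exact ⟨h.1, ih h.2 h'⟩

/-- A state of amplitude 0 receives no dominated mass, so nothing is ever removed. -/
theorem VanishesAlong.sum_survivors [DecidablePred s] {cs : List (List (Gate n l))}
    {ψ : Bits l → ℂ} (h : VanishesAlong f s cs ψ) (hψ : ∑ v, ‖ψ v‖ ^ 2 = 1) {q : Bits l → ℝ}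
    (hq : Dominated q ψ) : ∑ v, survivors f 𝒯 s cs ψ q v = ∑ v, q v := by
  induction cs generalizing ψ q with
  | nil => rfl
  | cons c cs ih =>
    have ht := isTransition f 𝒯 hψ c
    rw [survivors, ih h.2 (by rw [sum_norm_applyCircuit, hψ]) (ht.dominated_killedStep s hq),
      ← ht.sum_mul q]
    refine Finset.sum_congr rfl fun y _ => ?_
    rw [killedStep]
    split_ifs with hy
    · refine (Finset.sum_eq_zero fun x _ => ?_).symm
      have h1 := mul_le_mul_of_nonneg_left (hq.le x) (ht.nonneg y x)
      have h2 := Finset.single_le_sum (f := fun x => _ * ‖ψ x‖ ^ 2)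
        (fun x _ => mul_nonneg (ht.nonneg y x) (sq_nonneg _)) (Finset.mem_univ x)
      rw [ht.marginal y, h.1 y hy, norm_zero, zero_pow two_ne_zero] at h2
      exact le_antisymm (h1.trans h2) (mul_nonneg (ht.nonneg y x) (hq.nonneg x))
    · rfl

end Sums

/-! ### From the surviving mass to the probability of the right answer. -/

namespace Search

variable {n : ℕ}

/-- The history entries that would cause `algorithm` to give an answer other than `x`. -/
def Misleading (x : Bits n) (v : Bits (2 * n + 4)) : Prop :=
  Successful v ∧ ∃ i, v (item i) ≠ x i

instance (x : Bits n) : DecidablePred (Misleading x) := fun v => by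
  unfold Misleading; infer_instance

theorem triple_of_mark {φ₁ φ₂ φ₃ : Fin n → Bool → ℂ} {χ₁ χ₂ : Bool → ℂ} {v : Bits (2 * n + 4)}
    (hv : v (mark n) = true) : triple n φ₁ φ₂ φ₃ χ₁ χ₂ (ket false) v = 0 := by
  simp [triple, productState, hv]

theorem markState_of_misleading {x : Bits n} {v : Bits (2 * n + 4)} (hv : Misleading x v) :
    markState x v = 0 := by
  obtain ⟨⟨hm, -⟩, i, hi⟩ := hv
  have : ∏ i, ket (x i) (v (item i)) = (0 : ℂ) :=
    Finset.prod_eq_zero (Finset.mem_univ i) (Pi.single_eq_of_ne hi _)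
  simp [markState, triple, productState, hm, this]

/-- The mark is set only between the last two circuits of a cycle, and there it accompanies `x`
alone. -/
theorem vanishesAlong_program {f : Bits n → Bool} {x : Bits n} (hf : ∀ y, f y = true ↔ y = x)
    (hn : 3 ≤ n) : VanishesAlong f (Misleading x) (program n).circuits
      (Pi.single (fun _ => false) 1) := by
  have hc : VanishesAlong f (Misleading x) (cycle n) (cycleState x) := by
    simp only [cycle, VanishesAlong, lowHadamards_cycleState, lowHadamards_lowState,
      highHadamards_cycleState, flagHadamard_highState, flagHadamard_flagState,
      highHadamards_highState, markCircuit_cycleState, markCircuit_markState, and_true]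
    exact ⟨fun v h => triple_of_mark h.1.1, fun v h => triple_of_mark h.1.1,
      fun v h => triple_of_mark h.1.1, fun v h => triple_of_mark h.1.1,
      fun v h => triple_of_mark h.1.1, fun v h => triple_of_mark h.1.1,
      fun v h => markState_of_misleading h, fun v h => triple_of_mark h.1.1⟩
  have hcs : ∀ k, VanishesAlong f (Misleading x) (List.replicate k (cycle n)).flatten
      (cycleState x) := fun k => by
    induction k with
    | zero => trivial
    | succ k ih =>
      rw [List.replicate_succ, List.flatten_cons]
      exact hc.append (by rwa [applyCircuits_cycle])
  refine ⟨?_, ?_⟩ <;> rw [applyCircuit_prepCircuit hf hn]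
  · exact fun v h => triple_of_mark h.1.1
  · exact hcs _

/-- The reader keeps the most recent successful entry, and without misleading entries each of these
names `x`. -/
theorem foldl_readStep {x : Bits n} (L : List (Bits (2 * n + 4)))
    (hL : ∀ v ∈ L, ¬ Misleading x v) (o : List Bool)
    (ho : o = List.ofFn x ∨ ∃ v ∈ L, Successful v) : L.foldl readStep o = List.ofFn x := by
  induction L generalizing o with
  | nil => simpa using ho
  | cons v L ih =>
    rw [List.foldl_cons]
    refine ih (fun w hw => hL w (List.mem_cons_of_mem _ hw)) _ ?_
    by_cases hv : Successful v
    · left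
      have hx : ∀ i, v (item i) = x i := by
        by_contra! h
        exact hL v List.mem_cons_self ⟨hv, h⟩
      exact (if_pos hv).trans (congrArg List.ofFn (funext hx))
    · rw [show readStep o v = o from if_neg hv]
      rcases ho with ho | ⟨w, hw, hw'⟩
      · exact Or.inl ho
      · rcases List.mem_cons.1 hw with rfl | hw
        · exact absurd hw' hv
        · exact Or.inr ⟨w, hw, hw'⟩

theorem sum_norm_state {f : Bits n → Bool} (P : Program n) (t : ℕ) :
    ∑ v, ‖P.state f t v‖ ^ 2 = 1 := by
  have h : ∀ (cs : List (List (Gate n P.qubits))) (ψ : Bits P.qubits → ℂ),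
      ∑ v, ‖applyCircuits f cs ψ v‖ ^ 2 = ∑ v, ‖ψ v‖ ^ 2 := fun cs => by
    induction cs with
    | nil => exact fun ψ => rfl
    | cons c cs ih => exact fun ψ => (ih _).trans (sum_norm_applyCircuit f c ψ)
  refine (h _ _).trans ?_
  rw [Finset.sum_eq_single (fun _ => false)] <;> simp +contextual

theorem historyProb_nonneg (P : Program n) (𝒯 : HiddenVariableTheory) (f : Bits n → Bool)
    (H : P.History) : 0 ≤ P.historyProb 𝒯 f H :=
  mul_nonneg (by split_ifs <;> simp) (Finset.prod_nonneg fun t _ =>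
    (isTransition f 𝒯 (sum_norm_state P t) (P.circuits.get t)).nonneg _ _)

/-- A history starting at 0 with some successful entry and no misleading one yields `x`. Misleading
entries have probability 0 and the absence of success at most 7/25, which leaves 18/25 > 2/3. -/
theorem le_probAnswer {𝒯 : HiddenVariableTheory} (h𝒯 : 𝒯.Indifferent) (hn : 30 ≤ n)
    {f : Bits n → Bool} {x : Bits n} (hf : ∀ y, f y = true ↔ y = x) :
    2 / 3 ≤ algorithm.probAnswer 𝒯 f x := by
  have hs := survivors_program h𝒯 hn hf
  have hψ : ∑ v, ‖(Pi.single (fun _ => false) 1 : Bits (2 * n + 4) → ℂ) v‖ ^ 2 = 1 :=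
    sum_norm_state (f := f) (program n) 0
  have hm := (vanishesAlong_program hf (by omega)).sum_survivors 𝒯 hψ
    dominated_single
  replace hs := (sum_history (l := 2 * n + 4) f 𝒯 Successful (program n).circuits _ _).trans_le hs
  replace hm := (sum_history (l := 2 * n + 4) f 𝒯 (Misleading x) (program n).circuits _ _).trans hm
  have h1 : ∑ v : Bits (2 * n + 4), (if v = fun _ => false then (1 : ℝ) else 0) = 1 := by simp
  rw [h1] at hm
  suffices h : ∀ H : Fin ((program n).circuits.length + 1) → Bits (2 * n + 4),
      (if ∀ t : Fin (program n).circuits.length, ¬ Misleading x (H t.succ) then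
        (program n).historyProb 𝒯 f H else 0) -
      (if ∀ t : Fin (program n).circuits.length, ¬ Successful (H t.succ) then
        (program n).historyProb 𝒯 f H else 0) ≤
      if algorithm.answer ⟨n, H⟩ = List.ofFn x then (program n).historyProb 𝒯 f H else 0 by
    have h2 := Finset.sum_le_sum fun H (_ : H ∈ Finset.univ) => h H
    rw [Finset.sum_sub_distrib] at h2
    have h3 : (1 : ℝ) - 7 / 25 ≤ algorithm.probAnswer 𝒯 f x :=
      le_trans (sub_le_sub hm.ge hs) h2
    linarith
  intro H
  have hp := historyProb_nonneg (program n) 𝒯 f H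
  by_cases hM : ∀ t : Fin (program n).circuits.length, ¬ Misleading x (H t.succ)
  · by_cases hS : ∀ t : Fin (program n).circuits.length, ¬ Successful (H t.succ)
    · rw [if_pos hM, if_pos hS, sub_self]
      split_ifs
      · exact hp
      · exact le_rfl
    · by_cases h0 : H 0 = fun _ => false
      · obtain ⟨t, ht⟩ := not_forall_not.1 hS
        have hans : algorithm.answer ⟨n, H⟩ = List.ofFn x := by
          refine foldl_readStep _ (fun v hv => ?_) _ (Or.inr ⟨_, List.mem_ofFn.2 ⟨t.succ, rfl⟩, ht⟩)
          obtain ⟨t, rfl⟩ := List.mem_ofFn.1 hv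
          -- The sums over histories ignore entry 0; it is harmless because its mark is 0.
          refine Fin.cases ?_ hM t
          rintro ⟨⟨hmark, -⟩, -⟩
          change H 0 (mark n) = true at hmark
          rw [h0] at hmark
          exact absurd hmark (by simp)
        rw [if_pos hM, if_neg hS, if_pos hans, sub_zero]
      · have : (program n).historyProb 𝒯 f H = 0 := by
          exact mul_eq_zero_of_left (if_neg h0) _
        simp [this]
  · rw [if_neg hM, zero_sub]
    have : 0 ≤ if ∀ t : Fin (program n).circuits.length, ¬ Successful (H t.succ) then
        (program n).historyProb 𝒯 f H else 0 := by
      split_ifs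
      · exact hp
      · exact le_rfl
    refine le_trans (neg_nonpos.2 this) ?_
    split_ifs
    · exact hp
    · exact le_rfl

/-! ### Query and step counts. -/

theorem two_pow_div_three_le (n : ℕ) : (2 : ℝ) ^ (n / 3) ≤ ((2 : ℝ) ^ n) ^ (1 / 3 : ℝ) := by
  have h : ((2 : ℝ) ^ (n / 3)) = (((2 : ℝ) ^ (n / 3)) ^ 3) ^ (1 / 3 : ℝ) := by
    rw [← Real.rpow_natCast _ 3, ← Real.rpow_mul (by positivity)]
    norm_num
  rw [h]
  exact Real.rpow_le_rpow (by positivity) (two_pow_le_iteration n) (by norm_num)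

theorem queries_algorithm (n : ℕ) : algorithm.queries n = 2 ^ (n / 3) + 1 := queries_program n

theorem length_unaryEncodeNat (n : ℕ) : (unaryEncodeNat n).length = n := by
  induction n with
  | zero => rfl
  | succ n ih => rw [unaryEncodeNat, List.length_cons, ih]

theorem steps_algorithm (n : ℕ) : algorithm.steps n = 9400 * (2 ^ (n / 3) * (n + 1) ^ 2) +
    (10 * (n + 1 + (1 + 256 * 2 ^ (n / 3) + 1) * (2 * n + 4 + 1)) + 1) := by
  rw [SearchAlgorithm.steps, length_unaryEncodeNat]
  change writer.time n + reader.time (n + 1 + ((program n).T + 1) * (2 * n + 4 + 1)) = _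
  rw [time_writer, time_reader, T_program]

theorem steps_algorithm_le {n : ℕ} (hn : 1 ≤ n) :
    algorithm.steps n ≤ 56000 * (2 ^ (n / 3) * n ^ 2) := by
  rw [steps_algorithm]
  have hK : 1 ≤ 2 ^ (n / 3) := Nat.one_le_two_pow
  generalize 2 ^ (n / 3) = K at *
  obtain ⟨k, rfl⟩ := Nat.exists_eq_add_of_le hK
  obtain ⟨m, rfl⟩ := Nat.exists_eq_add_of_le hn
  nlinarith [Nat.zero_le (k * m), Nat.zero_le (k * m ^ 2), Nat.zero_le (m ^ 2)]

end Search

end Histories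

end

theorem theorem6p1 :
    ∃ A : Histories.SearchAlgorithm,
      ((fun n : ℕ => (A.queries n : ℝ)) =O[Filter.atTop]
        fun n : ℕ => ((2 : ℝ) ^ n) ^ (1 / 3 : ℝ)) ∧
      (∃ c : ℕ, (fun n : ℕ => (A.steps n : ℝ)) =O[Filter.atTop]
        fun n : ℕ => ((2 : ℝ) ^ n) ^ (1 / 3 : ℝ) * Real.log ((2 : ℝ) ^ n) ^ c) ∧
      ∃ n₀ : ℕ, ∀ n : ℕ, n₀ ≤ n →
        ∀ 𝒯 : Histories.HiddenVariableTheory, 𝒯.Indifferent →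
          ∀ (f : Histories.Bits n → Bool) (x : Histories.Bits n),
            (∀ y, f y = true ↔ y = x) → 2 / 3 ≤ A.probAnswer 𝒯 f x := by
  -- The exponent 2 reflects O(n) gates per block with unary indices of length O(n), where n = log N
  -- / log 2. From n = 30 on, K ≥ 1024, which makes all numerical estimates valid.
  refine ⟨Histories.Search.algorithm, ?_, ⟨2, ?_⟩, 30, fun n hn 𝒯 h𝒯 f x hf =>
    Histories.Search.le_probAnswer h𝒯 hn hf⟩
  · refine Asymptotics.IsBigO.of_bound 2 (Filter.Eventually.of_forall fun n => ?_)
    have h1 := Histories.Search.two_pow_div_three_le n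
    have h2 : (1 : ℝ) ≤ 2 ^ (n / 3) := one_le_pow₀ one_le_two
    rw [Histories.Search.queries_algorithm, Real.norm_of_nonneg (by positivity),
      Real.norm_of_nonneg (by positivity)]
    push_cast
    linarith
  · have hlog : 0 < Real.log 2 := Real.log_pos one_lt_two
    refine Asymptotics.IsBigO.of_bound (56000 / Real.log 2 ^ 2) ?_
    filter_upwards [Filter.eventually_ge_atTop 1] with n hn
    have h1 := Histories.Search.two_pow_div_three_le n
    have h2 : (Histories.Search.algorithm.steps n : ℝ) ≤ 56000 * (2 ^ (n / 3) * n ^ 2) := by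
      exact_mod_cast Histories.Search.steps_algorithm_le hn
    rw [Real.norm_of_nonneg (by positivity), Real.norm_of_nonneg (by positivity), Real.log_pow]
    refine h2.trans ?_
    calc (56000 : ℝ) * (2 ^ (n / 3) * n ^ 2)
        ≤ 56000 * (((2 : ℝ) ^ n) ^ (1 / 3 : ℝ) * n ^ 2) := by gcongr
      _ = 56000 / Real.log 2 ^ 2 *
          (((2 : ℝ) ^ n) ^ (1 / 3 : ℝ) * (n * Real.log 2) ^ 2) := by
        field_simp
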